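/- Let a connected Lie group $G$ act smoothly and transitively on a manifold $M=G/H$, where $H$ is the isotropy group of a point $p$ (and $M$ carries the manifold structure of $G/H$). Let $\mathfrak g=\mathfrak h\oplus\mathfrak m$ be a reductive decomposition ($\mathfrak m$ is $\mathrm{Ad}(H)$-invariant and $\mathfrak m\simeq T_pM$), let $\mathfrak m=\bigoplus_{i=1}^s\mathfrak m_i$ be a decomposition into $\mathrm{Ad}(H)$-irreducible summands with $s\ge 2$, and let $\alpha_i$ be $\mathrm{Ad}(H)$-invariant scalar products on $\mathfrak m_i$, extended by zero to $\mathfrak m$. For $c=(c^1,\dots,c^s)$ with all $c^i>0$ let $g_c$ be the $G$-invariant Riemannian metric on $M$ given on $\mathfrak m$ by $\sum_i c^i\alpha_i$ (these metrics are called positively related). Terminology. A vector $X\in\mathfrak g$ is a geodesic vector of a $G$-invariant Finsler metric $F$ if $t\mapsto \exp(tX)p$ is a geodesic of $F$. The metric $F$ is geodesic orbit (with respect to $G$) if every geodesic through $p$ is of this form, and naturally reductive (with respect to $G$) if for some reductive decomposition $\mathfrak g=\mathfrak h\oplus\mathfrak m'$ the geodesics through $p$ are the curves $\exp(ty)p$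 with $y\in\mathfrak m'$. A $G$-invariant Riemannian metric is naturally reductive if $\langle[z,x]_{\mathfrak m'},y\rangle+\langle x,[z,y]_{\mathfrak m'}\rangle=0$ for all $x,y,z\in\mathfrak m'$, for some reductive decomposition $\mathfrak g=\mathfrak h\oplus\mathfrak m'$. A geodesic graph is an $\mathrm{Ad}(H)$-equivariant map $\xi\colon\mathfrak m\to\mathfrak h$ such that $y+\xi(y)$ is a geodesic vector for every $y\ne0$. It is called unique if one exists and all geodesic graphs agree on one dense open subset of $\mathfrak m$, and linear if it agrees with a linear map on $\mathfrak m\setminus\{0\}$. A function $L$, continuous on $[0,\infty)^k$ and positively homogeneous of degree $2$, is admissible if on $(0,\infty)^k$ it is smooth and positive, with $L_{,j}\ge0$ for all $j$, $\operatorname{Hess}L$ positive semidefinite and $L_{,1}+\dots+L_{,k}>0$. A Finsler metric $F$ is of the $\alpha_i$-type if on $\mathfrak m$ it has the form $F(y)=f(\alpha_1(y_1,y_1),\dots,\alpha_s(y_s,y_s))$, where $y_i$ is the component of $y$ in $\mathfrak m_i$ and $f$ is continuous on $[0,\infty)^s$ and smooth on $[0,\infty)^s\setminus\{0\}$. Suppose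 that every $g_c$ is naturally reductive and has a unique geodesic graph, and that $M$ is irreducible, in the sense that at least one of the metrics $g_c$ is not, near $p$, a Riemannian product of two manifolds of positive dimension. Then: 1. For all $k$, every admissible $L$ and all metrics $g_1,\dots,g_k$ of the family, $F=\sqrt{L(\sqrt{g_1},\dots,\sqrt{g_k})}$ is a $G$-invariant Finsler metric of the $\alpha_i$-type on $M$; it is geodesic orbit and has a unique geodesic graph. If $F$ is not Riemannian, then no geodesic graph of $F$, with respect to any reductive decomposition, is linear, and $F$ is not naturally reductive. 2. This family of non-Riemannian metrics is large: for every $q>2$ the function $L=(\sum_j x_j^q)^{2/q}$ is admissible, and $F=(\sum_{j=1}^k\sqrt{g_j}^{\,q})^{1/q}$ is not Riemannian whenever $g_1,\dots,g_k$ are not all proportional to each other. Hence all these metrics are geodesic orbit but not naturally reductive. -/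

import Mathlib

open scoped Manifold ContDiff

noncomputable section

namespace FinslerGO

variable {n d : ℕ}
  {G : Type*} [TopologicalSpace G] [ChartedSpace (EuclideanSpace ℝ (Fin n)) G] [Group G]
  {M : Type*} [TopologicalSpace M] [ChartedSpace (EuclideanSpace ℝ (Fin d)) M]

/-! ### The homogeneous space and its reductive decompositions -/

/-- The differential at `1` of the orbit map `g ↦ g • p`, a linear map `𝔤 → T_p M`. -/
def dOrbit [MulAction G M] (p : M) :
    GroupLieAlgebra (𝓡 n) G →L[ℝ] TangentSpace (𝓡 d) p :=
  (mfderiv (𝓡 n) (𝓡 d) (fun g : G => g • p) 1 :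
    EuclideanSpace ℝ (Fin n) →L[ℝ] EuclideanSpace ℝ (Fin d))

/-- The differential at `q` of the diffeomorphism of `M` given by `g`. -/
def dTrans (d : ℕ) {M : Type*} [TopologicalSpace M] [ChartedSpace (EuclideanSpace ℝ (Fin d)) M]
    {G : Type*} [Group G] [MulAction G M] (g : G) (q : M) :
    TangentSpace (𝓡 d) q →L[ℝ] TangentSpace (𝓡 d) (g • q) :=
  mfderiv (𝓡 d) (𝓡 d) (fun x : M => g • x) q

/-- The adjoint representation, `Ad g` being the differential at `1` of `x ↦ g x g⁻¹`. -/
def Ad (g : G) : GroupLieAlgebra (𝓡 n) G →L[ℝ] GroupLieAlgebra (𝓡 n) G :=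
  (mfderiv (𝓡 n) (𝓡 n) (fun x : G => g * x * g⁻¹) 1 :
    EuclideanSpace ℝ (Fin n) →L[ℝ] EuclideanSpace ℝ (Fin n))

/-- The Lie algebra `𝔥` of the isotropy group `H` of `p`: the vectors tangent to `H`, which are
those killed by the differential of `g ↦ g • p`. -/
def isotropyAlg (n d : ℕ) (G : Type*) [TopologicalSpace G]
    [ChartedSpace (EuclideanSpace ℝ (Fin n)) G] [Group G]
    {M : Type*} [TopologicalSpace M] [ChartedSpace (EuclideanSpace ℝ (Fin d)) M]
    [MulAction G M] (p : M) : Submodule ℝ (GroupLieAlgebra (𝓡 n) G) :=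
  (dOrbit (n := n) (d := d) (G := G) p).toLinearMap.ker

variable [MulAction G M]

/-- Invariance of a subspace of `𝔤` under `Ad(H)`, where `H` is the isotropy group of `p`. -/
def AdInvariant (p : M) (V : Submodule ℝ (GroupLieAlgebra (𝓡 n) G)) : Prop :=
  ∀ h ∈ MulAction.stabilizer G p, ∀ x ∈ V, Ad h x ∈ V

/-- `𝔤 = 𝔥 ⊕ 𝔪` is a reductive decomposition. -/
def IsReductive (d : ℕ) {M : Type*} [TopologicalSpace M]
    [ChartedSpace (EuclideanSpace ℝ (Fin d)) M] [MulAction G M]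
    (p : M) (m : Submodule ℝ (GroupLieAlgebra (𝓡 n) G)) : Prop :=
  IsCompl (isotropyAlg n d G p) m ∧ AdInvariant p m

/-- `V` is a nonzero `Ad(H)`-irreducible subspace. -/
def AdIrreducible (p : M) (V : Submodule ℝ (GroupLieAlgebra (𝓡 n) G)) : Prop :=
  V ≠ ⊥ ∧ AdInvariant p V ∧ ∀ W ≤ V, AdInvariant p W → W = ⊥ ∨ W = V

/-- `𝔪 = 𝔪₁ ⊕ ⋯ ⊕ 𝔪ₛ` is a decomposition into `Ad(H)`-irreducible summands. -/
def IsIrredDecomposition {s : ℕ} (p : M) (m : Submodule ℝ (GroupLieAlgebra (𝓡 n) G))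
    (ms : Fin s → Submodule ℝ (GroupLieAlgebra (𝓡 n) G)) : Prop :=
  (∀ i, AdIrreducible p (ms i)) ∧ iSupIndep ms ∧ ⨆ i, ms i = m

/-! ### Metrics -/

/-- A function on the tangent bundle of `M`, such as a Finsler metric. -/
abbrev FinslerFun (d : ℕ) (M : Type*) [TopologicalSpace M]
    [ChartedSpace (EuclideanSpace ℝ (Fin d)) M] : Type _ :=
  ∀ q : M, TangentSpace (𝓡 d) q → ℝ

/-- A field of bilinear forms on the tangent spaces of `M`. -/
abbrev BilinField (d : ℕ) (M : Type*) [TopologicalSpace M]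
    [ChartedSpace (EuclideanSpace ℝ (Fin d)) M] : Type _ :=
  ∀ q : M, TangentSpace (𝓡 d) q →ₗ[ℝ] TangentSpace (𝓡 d) q →ₗ[ℝ] ℝ

/-- A Minkowski norm on `T_q M`, apart from its smoothness. The last clause says that the
fundamental tensor `g_y(v, v) = ½ d²/dt² F²(y + t v)|_{t = 0}` is positive definite. -/
structure IsMinkowski (F : FinslerFun d M) (q : M) : Prop where
  pos : ∀ y : TangentSpace (𝓡 d) q, y ≠ 0 → 0 < F q y
  homog : ∀ (r : ℝ) (y : TangentSpace (𝓡 d) q), 0 ≤ r → F q (r • y) = r * F q y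
  convex : ∀ y v : TangentSpace (𝓡 d) q, y ≠ 0 → v ≠ 0 →
    0 < iteratedDeriv 2 (fun t : ℝ => F q (y + t • v) ^ 2) 0

/-- `F` is a `G`-invariant Finsler metric on `M`: smooth away from the zero section, a Minkowski
norm on every tangent space, and preserved by `G`. -/
structure IsInvariantFinsler [IsManifold (𝓡 d) ∞ M] (G : Type*) [Group G] [MulAction G M]
    (F : FinslerFun d M) : Prop where
  smooth : ContMDiffOn (𝓡 d).tangent 𝓘(ℝ, ℝ) ∞
    (fun v : TangentBundle (𝓡 d) M => F v.1 v.2) {v | v.2 ≠ 0}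
  minkowski : ∀ q, IsMinkowski F q
  invariant : ∀ (g : G) (q : M) (v : TangentSpace (𝓡 d) q), F (g • q) (dTrans d g q v) = F q v

/-- `α₁, …, αₛ` are `Ad(H)`-invariant scalar products on `𝔪₁, …, 𝔪ₛ`. Each `αᵢ` is extended by zero
on the other summands to a bilinear form on `𝔪 ≃ T_p M`, and then to `M` as a `G`-invariant
tensor field. (Such an extension exists and is unique because the form on `T_p M` is invariant
under the isotropy group.) -/
structure IsBasicForms {s : ℕ} (p : M) (ms : Fin s → Submodule ℝ (GroupLieAlgebra (𝓡 n) G))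
    (α : Fin s → BilinField d M) : Prop where
  invariant : ∀ (i : Fin s) (g : G) (q : M) (v w : TangentSpace (𝓡 d) q),
    α i (g • q) (dTrans d g q v) (dTrans d g q w) = α i q v w
  symm : ∀ (i : Fin s) (v w : TangentSpace (𝓡 d) p), α i p v w = α i p w v
  posDef : ∀ i, ∀ x ∈ ms i, x ≠ 0 → 0 < α i p (dOrbit p x) (dOrbit p x)
  zero : ∀ i j, i ≠ j → ∀ x ∈ ms j, ∀ w : TangentSpace (𝓡 d) p, α i p (dOrbit p x) w = 0

/-- The positively related metrics `g_{c¹…cˢ} = ∑ cⁱ αᵢ` (for `cⁱ > 0`). -/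
def relMetric {s : ℕ} (α : Fin s → BilinField d M) (c : Fin s → ℝ) : BilinField d M :=
  fun q => ∑ i, c i • α i q

/-- The norm `√g` of a field of bilinear forms. -/
def normOf (g : BilinField d M) : FinslerFun d M :=
  fun q v => Real.sqrt (g q v v)

/-- The function `F = √(L(√g₁, …, √g_k))`. -/
def combine {k : ℕ} (L : (Fin k → ℝ) → ℝ) (g : Fin k → BilinField d M) : FinslerFun d M :=
  fun q v => Real.sqrt (L fun j => normOf (g j) q v)

/-- The admissible functions `L` of `k` nonnegative variables: continuous, positively homogeneous
of degree two, smooth and positive where all the variables are positive, and there with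
`L_{,i} ≥ 0`, positive semidefinite Hessian and `L_{,1} + ⋯ + L_{,k} > 0`. -/
structure Admissible {k : ℕ} (L : (Fin k → ℝ) → ℝ) : Prop where
  cont : ContinuousOn L {x | ∀ i, 0 ≤ x i}
  smooth : ContDiffOn ℝ ∞ L {x | ∀ i, 0 < x i}
  pos : ∀ x, (∀ i, 0 < x i) → 0 < L x
  homog : ∀ (r : ℝ) (x : Fin k → ℝ), 0 < r → (∀ i, 0 ≤ x i) → L (r • x) = r ^ 2 * L x
  partial_nonneg : ∀ x, (∀ i, 0 < x i) → ∀ i, 0 ≤ fderiv ℝ L x (Pi.single i 1)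
  hess : ∀ x, (∀ i, 0 < x i) → ∀ v, 0 ≤ iteratedDeriv 2 (fun t : ℝ => L (x + t • v)) 0
  sum_pos : ∀ x, (∀ i, 0 < x i) → 0 < ∑ i, fderiv ℝ L x (Pi.single i 1)

/-- The function `L(x) = (∑ x_j ^ q) ^ (2 / q)`. -/
def powerL (k : ℕ) (q : ℝ) : (Fin k → ℝ) → ℝ :=
  fun x => (∑ j, x j ^ q) ^ (2 / q)

/-- `F` is of the `αᵢ`-type: `F(y) = f(α₁(y₁), …, αₛ(yₛ))` on `𝔪`, where `f` is continuous on
`[0, ∞)ˢ` and smooth away from the origin. (As `F` is homogeneous of degree one, `f` is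
homogeneous of degree `1/2` and cannot be smooth at the origin.) -/
def IsAlphaType {s : ℕ} (p : M) (m : Submodule ℝ (GroupLieAlgebra (𝓡 n) G))
    (α : Fin s → BilinField d M) (F : FinslerFun d M) : Prop :=
  ∃ f : (Fin s → ℝ) → ℝ, ContinuousOn f {t | ∀ i, 0 ≤ t i} ∧
    ContDiffOn ℝ ∞ f ({t | ∀ i, 0 ≤ t i} \ {0}) ∧
    ∀ y ∈ m, F p (dOrbit p y) = f fun i => α i p (dOrbit p y) (dOrbit p y)

/-- The norm `F` on `T_p M` comes from a bilinear form. For an invariant Finsler metric this means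
that it is Riemannian. -/
def IsRiemannianAt (F : FinslerFun d M) (p : M) : Prop :=
  ∃ b : TangentSpace (𝓡 d) p →ₗ[ℝ] TangentSpace (𝓡 d) p →ₗ[ℝ] ℝ, ∀ v, F p v ^ 2 = b v v

/-- Near `p` the metric `g` is a Riemannian product: in some smooth coordinates `(x, y)` around `p`,
with at least one coordinate of each kind, `g = g₁(x) + g₂(y)`. -/
def IsLocalProduct (g : BilinField d M) (p : M) : Prop :=
  ∃ (a b : ℕ) (φ : OpenPartialHomeomorph M
      (EuclideanSpace ℝ (Fin a) × EuclideanSpace ℝ (Fin b)))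
    (g₁ : EuclideanSpace ℝ (Fin a) →
      EuclideanSpace ℝ (Fin a) →ₗ[ℝ] EuclideanSpace ℝ (Fin a) →ₗ[ℝ] ℝ)
    (g₂ : EuclideanSpace ℝ (Fin b) →
      EuclideanSpace ℝ (Fin b) →ₗ[ℝ] EuclideanSpace ℝ (Fin b) →ₗ[ℝ] ℝ),
    0 < a ∧ 0 < b ∧ p ∈ φ.source ∧
    ContMDiffOn (𝓡 d) 𝓘(ℝ, EuclideanSpace ℝ (Fin a) × EuclideanSpace ℝ (Fin b)) ∞
      φ φ.source ∧
    ContMDiffOn 𝓘(ℝ, EuclideanSpace ℝ (Fin a) × EuclideanSpace ℝ (Fin b)) (𝓡 d) ∞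
      φ.symm φ.target ∧
    ∀ q ∈ φ.source, ∀ v w : TangentSpace (𝓡 d) q,
      let dφ : TangentSpace (𝓡 d) q →L[ℝ]
          EuclideanSpace ℝ (Fin a) × EuclideanSpace ℝ (Fin b) :=
        mfderiv (𝓡 d) 𝓘(ℝ, EuclideanSpace ℝ (Fin a) × EuclideanSpace ℝ (Fin b)) φ q
      g q v w = g₁ (φ q).1 (dφ v).1 (dφ w).1 + g₂ (φ q).2 (dφ v).2 (dφ w).2

/-! ### Geodesics -/

/-- The velocity vector of a curve in `M`. -/
def velocity (σ : ℝ → M) (t : ℝ) : TangentSpace (𝓡 d) (σ t) :=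
  mfderiv 𝓘(ℝ, ℝ) (𝓡 d) σ t (1 : ℝ)

/-- `σ` is a (constant speed) geodesic of `F`: a smooth curve that is, on every compact interval, a
critical point of the energy `∫ F²(σ')` among smooth variations with fixed end points. -/
def IsGeodesic (F : FinslerFun d M) (σ : ℝ → M) : Prop :=
  ContMDiff 𝓘(ℝ, ℝ) (𝓡 d) ∞ σ ∧
  ∀ a b : ℝ, a < b → ∀ Γ : ℝ × ℝ → M, ContMDiff 𝓘(ℝ, ℝ × ℝ) (𝓡 d) ∞ Γ →
    (∀ t, Γ (0, t) = σ t) → (∀ r, Γ (r, a) = σ a) → (∀ r, Γ (r, b) = σ b) →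
    HasDerivAt (fun r : ℝ => ∫ t in a..b, F (Γ (r, t)) (velocity (fun u => Γ (r, u)) t) ^ 2) 0 0

/-- `γ` is the one-parameter subgroup `t ↦ exp(tX)` of `G`. -/
def IsOneParam (γ : ℝ → G) (X : GroupLieAlgebra (𝓡 n) G) : Prop :=
  ContMDiff 𝓘(ℝ, ℝ) (𝓡 n) ∞ γ ∧ (∀ a b, γ (a + b) = γ a * γ b) ∧
    (mfderiv 𝓘(ℝ, ℝ) (𝓡 n) γ 0 (1 : ℝ) : EuclideanSpace ℝ (Fin n)) = X

/-- `X` is a geodesic vector of `F`: the curve `t ↦ exp(tX) • p` is a geodesic. -/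
def IsGeodesicVector (F : FinslerFun d M) (p : M) (X : GroupLieAlgebra (𝓡 n) G) : Prop :=
  ∃ γ : ℝ → G, IsOneParam γ X ∧ IsGeodesic F fun t => γ t • p

/-- `(G/H, F)` is a geodesic orbit space: the geodesics through `p` are the orbits of one-parameter
subgroups of `G`. As a geodesic is determined by its initial velocity `v`, this says that for
every `v ≠ 0` in `T_p M` such an orbit is a geodesic with initial velocity `v`. -/
def IsGeodesicOrbit (n : ℕ) (G : Type*) [TopologicalSpace G]
    [ChartedSpace (EuclideanSpace ℝ (Fin n)) G] [Group G] [MulAction G M]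
    (F : FinslerFun d M) (p : M) : Prop :=
  ∀ v : TangentSpace (𝓡 d) p, v ≠ 0 →
    ∃ X : GroupLieAlgebra (𝓡 n) G, dOrbit p X = v ∧ IsGeodesicVector F p X

/-- `(G/H, F)` is naturally reductive: for some reductive decomposition `𝔤 = 𝔥 ⊕ 𝔪` the geodesics
through `p` are the curves `exp(ty) • p` with `y ∈ 𝔪`. -/
def IsNaturallyReductive (n : ℕ) (G : Type*) [TopologicalSpace G]
    [ChartedSpace (EuclideanSpace ℝ (Fin n)) G] [Group G] [MulAction G M]
    (F : FinslerFun d M) (p : M) : Prop :=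
  ∃ m : Submodule ℝ (GroupLieAlgebra (𝓡 n) G), IsReductive d p m ∧
    ∀ y ∈ m, y ≠ 0 → IsGeodesicVector F p y

/-- The Riemannian homogeneous space `(G/H, g)` is naturally reductive: for some reductive
decomposition, `⟨[z, x]_𝔪, y⟩ + ⟨x, [z, y]_𝔪⟩ = 0` on `𝔪`. (The differential of the orbit map
kills `𝔥`, so that the projection to `𝔪` need not be written.) -/
def IsNaturallyReductiveRiem (n : ℕ) (G : Type*) [TopologicalSpace G]
    [ChartedSpace (EuclideanSpace ℝ (Fin n)) G] [Group G] [MulAction G M]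
    (g : BilinField d M) (p : M) : Prop :=
  ∃ m : Submodule ℝ (GroupLieAlgebra (𝓡 n) G), IsReductive d p m ∧
    ∀ x ∈ m, ∀ y ∈ m, ∀ z ∈ m,
      g p (dOrbit p ⁅z, x⁆) (dOrbit p y) + g p (dOrbit p x) (dOrbit p ⁅z, y⁆) = 0

/-- `ξ : 𝔪 → 𝔥` is a geodesic graph: `Ad(H)`-equivariant, with `y + ξ(y)` a geodesic vector for every
`y ≠ 0`. -/
structure IsGeodesicGraph (F : FinslerFun d M) (p : M)
    (m : Submodule ℝ (GroupLieAlgebra (𝓡 n) G)) (ξ : m → isotropyAlg n d G p) : Prop where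
  equivariant : ∀ h ∈ MulAction.stabilizer G p, ∀ y y' : m,
    (y' : GroupLieAlgebra (𝓡 n) G) = Ad h (y : GroupLieAlgebra (𝓡 n) G) →
      (ξ y' : GroupLieAlgebra (𝓡 n) G) = Ad h (ξ y : GroupLieAlgebra (𝓡 n) G)
  geodesic : ∀ y : m, y ≠ 0 →
    IsGeodesicVector F p ((y : GroupLieAlgebra (𝓡 n) G) + (ξ y : GroupLieAlgebra (𝓡 n) G))

/-- There is a geodesic graph, and it is unique up to its values outside a dense open set. (At
vectors with a larger isotropy algebra, such as those of the center of the Heisenberg algebra,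
the value of a geodesic graph may be arbitrary.) -/
def HasUniqueGeodesicGraph (F : FinslerFun d M) (p : M)
    (m : Submodule ℝ (GroupLieAlgebra (𝓡 n) G)) : Prop :=
  (∃ ξ, IsGeodesicGraph F p m ξ) ∧
  ∃ U : Set m, IsOpen U ∧ Dense U ∧
    ∀ ξ ξ', IsGeodesicGraph F p m ξ → IsGeodesicGraph F p m ξ' → ∀ y ∈ U, ξ y = ξ' y

/-- A geodesic graph is linear if it agrees with a linear map on the nonzero vectors. -/
def IsLinearGraph {p : M} {m : Submodule ℝ (GroupLieAlgebra (𝓡 n) G)}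
    (ξ : m → isotropyAlg n d G p) : Prop :=
  ∃ l : m →ₗ[ℝ] isotropyAlg n d G p, ∀ y, y ≠ 0 → ξ y = l y

end FinslerGO

end

open scoped Manifold ContDiff
open Filter Topology
noncomputable section
set_option linter.unusedSectionVars false
namespace FinslerGO

/-! For an invariant metric the geodesic equation of an orbit is algebraic. By the first variation
of the energy (`isGeodesicVector_iff`), a vector `X` with `dO X ≠ 0` is a geodesic vector exactly
when the differential of `F²` at `dO X` kills `dO [X, Z]` for all `Z`. Put `tᵢ = αᵢ(y, y)`. Since
`F² = L(√g₁, …, √g_k)` depends on `y` through `t` only, its differential at `y` is `2 ∑ φᵢ(t) αᵢ(y,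
·)`, with positive coefficients `φ = combPartial`. So over `y` the geodesic vectors of `F` are those
of the Riemannian metric `g_c` with `c = φ(t)` (`HasCoeff`). As `t` is `Ad(H)`-invariant, taking at
each `y` the value of a graph of that metric gives a geodesic graph of `F`
(`HasCoeff.exists_graph`). Two values over the same `y` differ by some `η ∈ 𝔥` with `dO [η, y] = 0`.
This condition does not involve the metric, so `η` could be added to a graph of any `g_c` along the
orbit of `y`, and uniqueness passes from one `g_c` to `F` (`HasCoeff.unique_graph`).

Rigidity: a linear graph, or natural reductivity, yields a linear section `σ` of `𝔤 → T_p M`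
consisting of geodesic vectors. Consider the bracket `b(x, y) = dO [σ x, σ y]`. Natural reductivity
of all `g_c` at once makes `αᵢ(b(z, x), y)` vanish when `x`, `y`, `z` lie in three distinct summands
(`NatRed.distinct`). The geodesic condition at two vectors that differ in the sign of one component,
and so have the same `t`, gives `φ_l(t) αₗ(v, b(u, z)) + φ_k(t) αₖ(u, b(v, z)) = 0`. If `φ_l / φ_k`
varies with `t`, both terms vanish (`NatRed.eq_zero_of_not_constRatio`). Let `A` be a class of
indices with constant mutual ratios. The summands outside `A` then act by skew endomorphisms on the
forms with index in `A`, so near `p` the form `∑_{i ∈ A} cⁱ αᵢ` is a pullback under a submersion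
that collapses these summands (`exists_pullback`). The same holds for the complement of `A`, and
every `g_c` is a local product. Irreducibility therefore forces all ratios to be constant; then `F²`
is constant on the level sets of a linear function of `t`, and homogeneity makes it a multiple of
that function (`Admissible.eq_linear`): `F` is Riemannian.

For the explicit family, convexity of `powerL` is the Cauchy–Schwarz inequality, and a Riemannian
`F` would give equality in the Minkowski inequality for vectors that are not proportional
(`powerL_not_additive`). -/

/-- Euclidean space, the model of all tangent spaces. -/
abbrev Eu (n : ℕ) : Type := EuclideanSpace ℝ (Fin n)

/-! ### Manifold derivatives as linear maps between the model spaces -/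

section HasD
variable {E : Type*} [NormedAddCommGroup E] [NormedSpace ℝ E]
  {E' : Type*} [NormedAddCommGroup E'] [NormedSpace ℝ E']
  {E'' : Type*} [NormedAddCommGroup E''] [NormedSpace ℝ E'']
  {H : Type*} [TopologicalSpace H] {I : ModelWithCorners ℝ E H}
  {H' : Type*} [TopologicalSpace H'] {I' : ModelWithCorners ℝ E' H'}
  {H'' : Type*} [TopologicalSpace H''] {I'' : ModelWithCorners ℝ E'' H''}
  {N : Type*} [TopologicalSpace N] [ChartedSpace H N]
  {N' : Type*} [TopologicalSpace N'] [ChartedSpace H' N']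
  {N'' : Type*} [TopologicalSpace N''] [ChartedSpace H'' N'']

/-- `L` is the derivative of `f` at `x`, the tangent spaces being identified with the model
spaces. -/
def HasD (I : ModelWithCorners ℝ E H) (I' : ModelWithCorners ℝ E' H') (f : N → N') (x : N)
    (L : E →L[ℝ] E') : Prop := HasMFDerivAt I I' f x L

theorem HasD.mfderiv_eq {f : N → N'} {x : N} {L : E →L[ℝ] E'} (h : HasD I I' f x L) :
    (mfderiv I I' f x : E →L[ℝ] E') = L := HasMFDerivAt.mfderiv h

theorem hasD_of_mdifferentiableAt {f : N → N'} {x : N} (h : MDifferentiableAt I I' f x) :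
    HasD I I' f x (mfderiv I I' f x : E →L[ℝ] E') := h.hasMFDerivAt

theorem HasD.unique {f : N → N'} {x : N} {L L' : E →L[ℝ] E'} (h : HasD I I' f x L)
    (h' : HasD I I' f x L') : L = L' := hasMFDerivAt_unique h h'

theorem HasD.comp {f : N → N'} {g : N' → N''} {x : N} {y : N'} {L : E →L[ℝ] E'}
    {L' : E' →L[ℝ] E''} (hg : HasD I' I'' g y L') (hf : HasD I I' f x L) (hy : f x = y) :
    HasD I I'' (fun z => g (f z)) x (L'.comp L) := by
  subst hy
  exact HasMFDerivAt.comp x hg hf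

theorem HasD.congr {f g : N → N'} {x : N} {L : E →L[ℝ] E'} (h : HasD I I' f x L)
    (hfg : g =ᶠ[𝓝 x] f) : HasD I I' g x L := HasMFDerivAt.congr_of_eventuallyEq h hfg

theorem HasD.prodMk {f : N → N'} {g : N → N''} {x : N} {L : E →L[ℝ] E'} {L' : E →L[ℝ] E''}
    (hf : HasD I I' f x L) (hg : HasD I I'' g x L') :
    HasD I (I'.prod I'') (fun z => (f z, g z)) x (L.prod L') := HasMFDerivAt.prodMk hf hg

theorem hasD_id (x : N) : HasD I I (fun z : N => z) x (.id ℝ E) := hasMFDerivAt_id x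

theorem hasD_const (x : N) (c : N') : HasD I I' (fun _ : N => c) x 0 := hasMFDerivAt_const c x

theorem hasD_iff_hasFDerivAt {f : E → E'} {x : E} {L : E →L[ℝ] E'} :
    HasD 𝓘(ℝ, E) 𝓘(ℝ, E') f x L ↔ HasFDerivAt f L x := hasMFDerivAt_iff_hasFDerivAt

theorem HasD.prod_partial {f : N × N' → N''} {x : N} {y : N'} {L : E →L[ℝ] E''}
    {L' : E' →L[ℝ] E''} (hf : MDifferentiableAt (I.prod I') I'' f (x, y))
    (hx : HasD I I'' (fun z => f (z, y)) x L) (hy : HasD I' I'' (fun z => f (x, z)) y L') :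
    HasD (I.prod I') I'' f (x, y) (L.coprod L') := by
  obtain ⟨D, h⟩ : ∃ D : E × E' →L[ℝ] E'', HasD (I.prod I') I'' f (x, y) D :=
    ⟨_, hasD_of_mdifferentiableAt hf⟩
  have h1 := (h.comp ((hasD_id x).prodMk (hasD_const (I := I) x y)) rfl).unique hx
  have h2 := (h.comp ((hasD_const (I := I') y x).prodMk (hasD_id y)) rfl).unique hy
  have h3 : D = L.coprod L' := by
    rw [← h1, ← h2]
    refine ContinuousLinearMap.ext fun v => ?_
    simp [← map_add]
  rwa [h3] at h

end HasD

/-! ### The group, its adjoint representation and its action; logarithmic derivatives -/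

section Homogeneous
variable {n d : ℕ}
  {G : Type*} [TopologicalSpace G] [ChartedSpace (EuclideanSpace ℝ (Fin n)) G] [Group G]
  [LieGroup (𝓡 n) ∞ G]
  {M : Type*} [TopologicalSpace M] [ChartedSpace (EuclideanSpace ℝ (Fin d)) M]
  [MulAction G M]
  {E : Type*} [NormedAddCommGroup E] [NormedSpace ℝ E]
  {H : Type*} [TopologicalSpace H] {I : ModelWithCorners ℝ E H}
  {N : Type*} [TopologicalSpace N] [ChartedSpace H N]

/-- The adjoint representation as a linear map of the model space. -/
def AdE (n : ℕ) {G : Type*} [TopologicalSpace G] [ChartedSpace (EuclideanSpace ℝ (Fin n)) G]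
    [Group G] (g : G) : Eu n →L[ℝ] Eu n := Ad (n := n) g

/-- The differential of the orbit map as a linear map of the model spaces. -/
def dO (n d : ℕ) (G : Type*) [TopologicalSpace G] [ChartedSpace (EuclideanSpace ℝ (Fin n)) G]
    [Group G] {M : Type*} [TopologicalSpace M] [ChartedSpace (EuclideanSpace ℝ (Fin d)) M]
    [MulAction G M] (q : M) : Eu n →L[ℝ] Eu d := dOrbit (n := n) (d := d) (G := G) q

/-- The differential of a translation as a linear map of the model space. -/
def dT (d : ℕ) {G : Type*} [Group G] {M : Type*} [TopologicalSpace M]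
    [ChartedSpace (EuclideanSpace ℝ (Fin d)) M] [MulAction G M] (g : G) (q : M) :
    Eu d →L[ℝ] Eu d := dTrans d g q

theorem contMDiff_mul_group :
    ContMDiff ((𝓡 n).prod (𝓡 n)) (𝓡 n) ∞ (fun q : G × G => q.1 * q.2) := contMDiff_mul _ _

theorem contMDiff_conj (g : G) : ContMDiff (𝓡 n) (𝓡 n) ∞ (fun x : G => g * x * g⁻¹) :=
  (contMDiff_const.mul contMDiff_id).mul contMDiff_const

theorem hasD_Ad (g : G) : HasD (𝓡 n) (𝓡 n) (fun x : G => g * x * g⁻¹) 1 (AdE n g) :=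
  hasD_of_mdifferentiableAt ((contMDiff_conj g).mdifferentiable (by simp) _)

theorem hasD_mul_one : HasD ((𝓡 n).prod (𝓡 n)) (𝓡 n) (fun q : G × G => q.1 * q.2) (1, 1)
    ((ContinuousLinearMap.id ℝ (Eu n)).coprod (ContinuousLinearMap.id ℝ (Eu n))) := by
  refine HasD.prod_partial (contMDiff_mul_group.mdifferentiable (by simp) _) ?_ ?_
  · simpa using hasD_id (I := 𝓡 n) (1 : G)
  · simpa using hasD_id (I := 𝓡 n) (1 : G)

theorem HasD.mul_of_one {f g : N → G} {x : N} {L L' : E →L[ℝ] Eu n}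
    (hf : HasD I (𝓡 n) f x L) (hg : HasD I (𝓡 n) g x L') (hf1 : f x = 1) (hg1 : g x = 1) :
    HasD I (𝓡 n) (fun y => f y * g y) x (L + L') := by
  have := hasD_mul_one.comp (hf.prodMk hg) (by rw [hf1, hg1])
  convert this using 1
  ext1 v
  simp

theorem AdE_one : AdE n (1 : G) = ContinuousLinearMap.id ℝ _ := by
  have : HasD (𝓡 n) (𝓡 n) (fun x : G => 1 * x * 1⁻¹) 1 (ContinuousLinearMap.id ℝ (Eu n)) := by
    simpa using hasD_id (I := 𝓡 n) (1 : G)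
  exact this.mfderiv_eq

theorem AdE_mul (g h : G) : AdE n (g * h) = (AdE n g).comp (AdE n h) := by
  have h1 := (hasD_Ad (n := n) g).comp (hasD_Ad h) (by simp)
  have h2 := hasD_Ad (n := n) (g * h)
  simp only [mul_inv_rev] at h2
  refine h2.unique (h1.congr (.of_forall fun x => ?_))
  simp [mul_assoc]

theorem AdE_mul_apply (g h : G) (x : Eu n) : AdE n (g * h) x = AdE n g (AdE n h x) := by
  rw [AdE_mul]; rfl

theorem AdE_inv_AdE (g : G) (x : Eu n) : AdE n g⁻¹ (AdE n g x) = x := by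
  rw [← AdE_mul_apply, inv_mul_cancel, AdE_one]; rfl

theorem AdE_AdE_inv (g : G) (x : Eu n) : AdE n g (AdE n g⁻¹ x) = x := by
  rw [← AdE_mul_apply, mul_inv_cancel, AdE_one]; rfl

section Action
variable [ContMDiffSMul (𝓡 n) (𝓡 d) ∞ G M]

theorem contMDiff_orbit (q : M) : ContMDiff (𝓡 n) (𝓡 d) ∞ (fun g : G => g • q) :=
  contMDiff_id.smul (I := 𝓡 n) contMDiff_const

theorem hasD_dO (q : M) : HasD (𝓡 n) (𝓡 d) (fun g : G => g • q) 1 (dO n d G q) :=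
  hasD_of_mdifferentiableAt ((contMDiff_orbit q).mdifferentiable (by simp) _)

include n in
theorem hasD_dT (g : G) (q : M) : HasD (𝓡 d) (𝓡 d) (fun x : M => g • x) q (dT d g q) :=
  hasD_of_mdifferentiableAt
    ((ContMDiffSMul.contMDiff_const_smul (I := 𝓡 n) (n := ∞) g).mdifferentiable (by simp) _)

include n in
theorem dT_mul (g h : G) (q : M) : dT d (g * h) q = (dT d g (h • q)).comp (dT d h q) := by
  have h1 := (hasD_dT (n := n) (d := d) g (h • q)).comp (hasD_dT (n := n) h q) rfl
  refine (hasD_dT (n := n) (g * h) q).unique (h1.congr (.of_forall fun x => ?_))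
  simp [mul_smul]

theorem dT_one (q : M) : dT d (1 : G) q = .id ℝ _ := by
  have : HasD (𝓡 d) (𝓡 d) (fun x : M => (1 : G) • x) q (.id ℝ _) := by
    simpa using hasD_id (I := 𝓡 d) q
  exact this.mfderiv_eq

include n in
theorem dT_inv_dT (g : G) (q : M) (v : Eu d) : dT d g⁻¹ (g • q) (dT d g q v) = v := by
  have := dT_mul (n := n) (d := d) g⁻¹ g q
  rw [inv_mul_cancel, dT_one] at this
  exact (congrArg (fun L => L v) this).symm

include n in
theorem dT_dT_inv (g : G) (q : M) (v : Eu d) : dT d g q (dT d g⁻¹ (g • q) v) = v := by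
  have := dT_mul (n := n) (d := d) g g⁻¹ (g • q)
  rw [mul_inv_cancel, dT_one, inv_smul_smul] at this
  exact (congrArg (fun L => L v) this).symm

/-- The differential of the translation by `g` intertwines the differentials of the orbit maps. -/
theorem dT_dO (g : G) (q : M) (x : Eu n) :
    dT d g q (dO n d G q x) = dO n d G (g • q) (AdE n g x) := by
  have h1 := (hasD_dT (n := n) (d := d) g q).comp (hasD_dO (n := n) (G := G) q) (one_smul _ _)
  have h2 := (hasD_dO (n := n) (d := d) (G := G) (g • q)).comp (hasD_Ad g) (by simp)
  have := h1.unique (h2.congr (.of_forall fun x => by simp [← mul_smul]))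
  exact congrArg (fun L => L x) this

end Action

/-- `L` is the logarithmic derivative `f⁻¹ df` of the `G`-valued map `f` at `x`. -/
def HasLD (n : ℕ) {G : Type*} [TopologicalSpace G] [ChartedSpace (EuclideanSpace ℝ (Fin n)) G]
    [Group G] (I : ModelWithCorners ℝ E H) (f : N → G) (x : N) (L : E →L[ℝ] Eu n) : Prop :=
  HasD I (𝓡 n) (fun y => (f x)⁻¹ * f y) x L

theorem exists_hasLD {f : N → G} {x : N} (hf : MDifferentiableAt I (𝓡 n) f x) :
    ∃ L, HasLD n I f x L := by
  refine ⟨_, hasD_of_mdifferentiableAt ?_⟩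
  have : ContMDiff (𝓡 n) (𝓡 n) ∞ (fun y => (f x)⁻¹ * y) := contMDiff_const.mul contMDiff_id
  exact (this.mdifferentiable (by simp) (f x)).comp x hf

theorem HasLD.hasD {f : N → G} {x : N} {L : E →L[ℝ] Eu n}
    (hf : HasLD n I f x L) (h1 : f x = 1) : HasD I (𝓡 n) f x L := by
  simpa [HasLD, h1] using hf

theorem HasLD.unique {f : N → G} {x : N} {L L' : E →L[ℝ] Eu n}
    (hf : HasLD n I f x L) (hf' : HasLD n I f x L') : L = L' := HasD.unique hf hf'

/-- With `a = f(x)⁻¹ f(y)` and `b = g(x)⁻¹ g(y)`, the quotient for the product is `(g(x)⁻¹ a g(x))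
b`, and at the unit the derivative of a product is the sum of the derivatives. -/
theorem HasLD.mul {f g : N → G} {x : N} {L L' : E →L[ℝ] Eu n}
    (hf : HasLD n I f x L) (hg : HasLD n I g x L') :
    HasLD n I (fun y => f y * g y) x ((AdE n (g x)⁻¹).comp L + L') := by
  have h1 := ((hasD_Ad (n := n) (g x)⁻¹).comp hf (by simp)).mul_of_one hg (by simp) (by simp)
  refine h1.congr (.of_forall fun y => ?_)
  simp [mul_assoc]

/-- Write `f y • q = f x • (((f x)⁻¹ * f y) • q)`. -/
theorem HasLD.smul [ContMDiffSMul (𝓡 n) (𝓡 d) ∞ G M] {f : N → G} {x : N} {L : E →L[ℝ] Eu n}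
    (hf : HasLD n I f x L) (q : M) :
    HasD I (𝓡 d) (fun y => f y • q) x ((dT d (f x) q).comp ((dO n d G q).comp L)) := by
  have h1 := (hasD_dT (n := n) (d := d) (f x) q).comp
    ((hasD_dO (n := n) (d := d) (G := G) q).comp hf (by simp)) (by simp)
  refine h1.congr (.of_forall fun y => ?_)
  simp [← mul_smul]

end Homogeneous

/-! ### Preferred charts -/

section Chart
variable {d : ℕ} {M : Type*} [TopologicalSpace M] [ChartedSpace (EuclideanSpace ℝ (Fin d)) M]
  [IsManifold (𝓡 d) ∞ M]

theorem contMDiffAt_chart {p q : M} (hq : q ∈ (chartAt (Eu d) p).source) :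
    ContMDiffAt (𝓡 d) 𝓘(ℝ, Eu d) ∞ (chartAt (Eu d) p) q :=
  (contMDiffOn_chart (I := 𝓡 d) (n := ∞) (x := p)).contMDiffAt ((chartAt _ p).open_source.mem_nhds hq)

theorem contMDiffAt_chart_symm {p : M} {x : Eu d} (hx : x ∈ (chartAt (Eu d) p).target) :
    ContMDiffAt 𝓘(ℝ, Eu d) (𝓡 d) ∞ (chartAt (Eu d) p).symm x :=
  (contMDiffOn_chart_symm (I := 𝓡 d) (n := ∞) (x := p)).contMDiffAt
    ((chartAt _ p).open_target.mem_nhds hx)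

/-- The tangent space at `p` is identified with the model space through the preferred chart at `p`.
At its base point the chart thus drops out of derivatives, and coordinate computations give `HasD`
directly. -/
theorem hasD_chart_self (p : M) :
    HasD (𝓡 d) 𝓘(ℝ, Eu d) (chartAt (Eu d) p) p (.id ℝ _) := by
  have h : HasD (𝓡 d) 𝓘(ℝ, Eu d) (extChartAt (𝓡 d) p) p
      (mfderiv (𝓡 d) 𝓘(ℝ, Eu d) (extChartAt (𝓡 d) p) p) :=
    hasD_of_mdifferentiableAt (mdifferentiableAt_extChartAt (I := 𝓡 d) (mem_chart_source (Eu d) p))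
  have h2 : mfderiv (𝓡 d) 𝓘(ℝ, Eu d) (extChartAt (𝓡 d) p) p = .id ℝ _ := mfderiv_extChartAt_self
  rw [h2] at h
  exact h

theorem hasD_chart_symm_self (p : M) :
    HasD 𝓘(ℝ, Eu d) (𝓡 d) (chartAt (Eu d) p).symm (chartAt (Eu d) p p) (.id ℝ _) := by
  obtain ⟨D, hD⟩ : ∃ D, HasD 𝓘(ℝ, Eu d) (𝓡 d) (chartAt (Eu d) p).symm (chartAt (Eu d) p p) D :=
    ⟨_, hasD_of_mdifferentiableAt
      ((contMDiffAt_chart_symm (mem_chart_target (Eu d) p)).mdifferentiableAt (n := ∞) (by simp))⟩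
  have h := (hasD_chart_self p).comp hD ((chartAt (Eu d) p).left_inv (mem_chart_source _ p))
  have h' := h.unique ((hasD_id (I := 𝓘(ℝ, Eu d)) (chartAt (Eu d) p p)).congr ?_)
  · rw [ContinuousLinearMap.id_comp] at h'
    rwa [h'] at hD
  · filter_upwards [(chartAt (Eu d) p).open_target.mem_nhds (mem_chart_target _ p)] with x hx
    exact (chartAt (Eu d) p).right_inv hx


/-- The derivative of a map in the chart at its value. -/
theorem HasD.chart {E : Type*} [NormedAddCommGroup E] [NormedSpace ℝ E]
    {H : Type*} [TopologicalSpace H] {I : ModelWithCorners ℝ E H}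
    {N : Type*} [TopologicalSpace N] [ChartedSpace H N] {f : N → M} {x : N} {p : M}
    {L : E →L[ℝ] Eu d} (hf : HasD I (𝓡 d) f x L) (hp : f x = p) :
    HasD I 𝓘(ℝ, Eu d) (fun y => chartAt (Eu d) p (f y)) x L :=
  (hasD_chart_self p).comp hf hp

end Chart

/-! ### The Lie bracket in coordinates, as the derivative of `Ad` -/

section Bracket
variable {n : ℕ}
  {G : Type*} [TopologicalSpace G] [ChartedSpace (EuclideanSpace ℝ (Fin n)) G] [Group G]
  [LieGroup (𝓡 n) ∞ G]

/-- The multiplication of `G` in the chart at `1`. -/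
def chartMul (n : ℕ) (G : Type*) [TopologicalSpace G]
    [ChartedSpace (EuclideanSpace ℝ (Fin n)) G] [Group G] (z : Eu n × Eu n) : Eu n :=
  chartAt (Eu n) (1 : G) ((chartAt (Eu n) (1 : G)).symm z.1 * (chartAt (Eu n) (1 : G)).symm z.2)

/-- The coordinates of the unit element. -/
def chartOne (n : ℕ) (G : Type*) [TopologicalSpace G]
    [ChartedSpace (EuclideanSpace ℝ (Fin n)) G] [Group G] : Eu n :=
  chartAt (Eu n) (1 : G) 1

theorem chartOne_mem : chartOne n G ∈ (chartAt (Eu n) (1 : G)).target :=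
  mem_chart_target (Eu n) (1 : G)

theorem chart_symm_chartOne : (chartAt (Eu n) (1 : G)).symm (chartOne n G) = 1 :=
  (chartAt (Eu n) (1 : G)).left_inv (mem_chart_source _ _)

theorem contDiffAt_chartMul {x : Eu n} (hx : x ∈ (chartAt (Eu n) (1 : G)).target) :
    ContDiffAt ℝ ∞ (chartMul n G) (x, chartOne n G) := by
  rw [← contMDiffAt_iff_contDiffAt]
  have h1 : ContMDiffAt 𝓘(ℝ, Eu n × Eu n) (𝓡 n) ∞
      (fun z : Eu n × Eu n => (chartAt (Eu n) (1 : G)).symm z.1) (x, chartOne n G) :=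
    ContMDiffAt.comp (x, chartOne n G) (contMDiffAt_chart_symm hx) contDiffAt_fst.contMDiffAt
  have h2 : ContMDiffAt 𝓘(ℝ, Eu n × Eu n) (𝓡 n) ∞
      (fun z : Eu n × Eu n => (chartAt (Eu n) (1 : G)).symm z.2) (x, chartOne n G) :=
    ContMDiffAt.comp (x, chartOne n G) (contMDiffAt_chart_symm chartOne_mem)
      contDiffAt_snd.contMDiffAt
  refine ContMDiffAt.comp (x, chartOne n G) (contMDiffAt_chart ?_) (h1.mul h2)
  simpa [chart_symm_chartOne] using (chartAt (Eu n) (1 : G)).map_target hx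

theorem contDiffAt_chartMul_left {x : Eu n} (hx : x ∈ (chartAt (Eu n) (1 : G)).target) :
    ContDiffAt ℝ ∞ (chartMul n G) (chartOne n G, x) := by
  rw [← contMDiffAt_iff_contDiffAt]
  have h1 : ContMDiffAt 𝓘(ℝ, Eu n × Eu n) (𝓡 n) ∞
      (fun z : Eu n × Eu n => (chartAt (Eu n) (1 : G)).symm z.2) (chartOne n G, x) :=
    ContMDiffAt.comp (chartOne n G, x) (contMDiffAt_chart_symm hx) contDiffAt_snd.contMDiffAt
  have h2 : ContMDiffAt 𝓘(ℝ, Eu n × Eu n) (𝓡 n) ∞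
      (fun z : Eu n × Eu n => (chartAt (Eu n) (1 : G)).symm z.1) (chartOne n G, x) :=
    ContMDiffAt.comp (chartOne n G, x) (contMDiffAt_chart_symm chartOne_mem)
      contDiffAt_fst.contMDiffAt
  refine ContMDiffAt.comp (chartOne n G, x) (contMDiffAt_chart ?_) (h2.mul h1)
  simpa [chart_symm_chartOne] using (chartAt (Eu n) (1 : G)).map_target hx

/-- The left invariant vector field with value `X` at `1`, in the chart at `1`. -/
def chartField (n : ℕ) (G : Type*) [TopologicalSpace G]
    [ChartedSpace (EuclideanSpace ℝ (Fin n)) G] [Group G] (X : Eu n) (x : Eu n) : Eu n :=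
  fderiv ℝ (chartMul n G) (x, chartOne n G) (0, X)

theorem contDiffOn_chartField (X : Eu n) :
    ContDiffOn ℝ ∞ (chartField n G X) (chartAt (Eu n) (1 : G)).target := by
  intro x hx
  have h : ContDiffAt ℝ ∞ (fderiv ℝ (chartMul n G)) (x, chartOne n G) :=
    (contDiffAt_chartMul hx).fderiv_right (by simp)
  have h2 : ContDiffAt ℝ ∞ (fun x : Eu n => (x, chartOne n G)) x :=
    contDiffAt_id.prodMk contDiffAt_const
  exact ((h.comp x h2).clm_apply contDiffAt_const).contDiffWithinAt

/-- Near `y`, with `e` the chart at `1`, one has `e (f z) = chartMul (e g, e (g⁻¹ * f z))`, and the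
inner map has derivative `L`. -/
theorem hasD_chartField (X : Eu n) {g : G} (hg : g ∈ (chartAt (Eu n) (1 : G)).source)
    {E : Type*} [NormedAddCommGroup E] [NormedSpace ℝ E]
    {H : Type*} [TopologicalSpace H] {I : ModelWithCorners ℝ E H}
    {N : Type*} [TopologicalSpace N] [ChartedSpace H N] {f : N → G} {y : N}
    {L : E →L[ℝ] Eu n} (hf : HasLD n I f y L) (hy : f y = g) :
    HasD I 𝓘(ℝ, Eu n) (fun z => chartAt (Eu n) (1 : G) (f z)) y
      (((fderiv ℝ (chartMul n G) (chartAt (Eu n) (1 : G) g, chartOne n G)).comp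
        (ContinuousLinearMap.inr ℝ (Eu n) (Eu n))).comp L) := by
  subst hy
  set e := chartAt (Eu n) (1 : G)
  have h1 : HasFDerivAt (chartMul n G) _ (e (f y), chartOne n G) :=
    ((contDiffAt_chartMul (e.map_source hg)).differentiableAt (by simp)).hasFDerivAt
  have h2 : HasFDerivAt (fun v : Eu n => (e (f y), v)) (ContinuousLinearMap.inr ℝ (Eu n) (Eu n))
    (chartOne n G) := hasFDerivAt_prodMk_right _ _
  have h3 := hasD_iff_hasFDerivAt.2 (h1.comp (chartOne n G) h2)
  have h4 := h3.comp (HasD.chart hf (inv_mul_cancel _)) (by simp [chartOne])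
  refine h4.congr ?_
  have hc : ContinuousAt (fun z => (f y)⁻¹ * f z) y := HasMFDerivAt.continuousAt hf
  have : ∀ᶠ z in 𝓝 y, (f y)⁻¹ * f z ∈ e.source := hc.eventually_mem <| by
    simpa using e.open_source.mem_nhds (mem_chart_source (Eu n) (1 : G))
  filter_upwards [this] with z hz
  simp only [Function.comp, chartMul]
  change e (f z) = e (e.symm (e (f y)) * e.symm (e ((f y)⁻¹ * f z)))
  rw [e.left_inv hz, e.left_inv hg, mul_inv_cancel_left]


/-- The Lie algebra axioms for `GroupLieAlgebra` are available under this smoothness, which over `ℝ`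
is `C³`. -/
instance lieGroup_minSmoothness : LieGroup (𝓡 n) (minSmoothness ℝ 3) G := by
  simpa using (inferInstance : LieGroup (𝓡 n) 3 G)

/-- The Lie bracket of `𝔤` as a function on the model space. -/
def brE (n : ℕ) (G : Type*) [TopologicalSpace G] [ChartedSpace (EuclideanSpace ℝ (Fin n)) G]
    [Group G] (X Y : Eu n) : Eu n :=
  Bracket.bracket (L := GroupLieAlgebra (𝓡 n) G) (M := GroupLieAlgebra (𝓡 n) G) X Y

theorem hasD_mul_left_one (g : G) : HasD (𝓡 n) (𝓡 n) (fun x : G => g * x) 1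
    (mfderiv (𝓡 n) (𝓡 n) (fun x : G => g * x) 1) :=
  hasD_of_mdifferentiableAt
    (((contMDiff_mul_left (I := 𝓡 n) (n := ∞)).mdifferentiable (by simp)) (1 : G))

/-- The bracket is defined by pulling left invariant fields back along the extended chart.
Identifying these pullbacks with `chartField` turns it into a bracket of vector fields on a vector
space. -/
theorem mpullback_chart_symm (X : Eu n) {x : Eu n} (hx : x ∈ (chartAt (Eu n) (1 : G)).target) :
    VectorField.mpullbackWithin 𝓘(ℝ, Eu n) (𝓡 n) (extChartAt (𝓡 n) (1 : G)).symm
      (mulInvariantVectorField (I := 𝓡 n) (G := G) X) (Set.range (𝓡 n)) x = chartField n G X x := by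
  have hr : Set.range (𝓡 n) = Set.univ := (𝓡 n).range_eq_univ
  rw [hr, VectorField.mpullbackWithin_apply, mfderivWithin_univ]
  set e := chartAt (Eu n) (1 : G) with he
  have hs : (extChartAt (𝓡 n) (1 : G)).symm x = e.symm x := rfl
  have hg := e.map_target hx
  obtain ⟨D, hD⟩ : ∃ D, HasD 𝓘(ℝ, Eu n) (𝓡 n) e.symm x D :=
    ⟨_, hasD_of_mdifferentiableAt ((contMDiffAt_chart_symm hx).mdifferentiableAt (n := ∞) (by simp))⟩
  obtain ⟨D', hD'⟩ : ∃ D, HasD (𝓡 n) 𝓘(ℝ, Eu n) e (e.symm x) D :=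
    ⟨_, hasD_of_mdifferentiableAt ((contMDiffAt_chart hg).mdifferentiableAt (n := ∞) (by simp))⟩
  have h1 : D'.comp D = .id ℝ _ := by
    refine (hD'.comp hD rfl).unique ((hasD_id (I := 𝓘(ℝ, Eu n)) x).congr ?_)
    filter_upwards [e.open_target.mem_nhds hx] with y hy using e.right_inv hy
  have h2 : D.comp D' = .id ℝ _ := by
    refine (hD.comp hD' (e.right_inv hx)).unique ((hasD_id (I := 𝓡 n) (e.symm x)).congr ?_)
    filter_upwards [e.open_source.mem_nhds hg] with y hy using e.left_inv hy
  have h3 : (ContinuousLinearMap.inverse D : Eu n →L[ℝ] Eu n) = D' :=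
    ContinuousLinearMap.inverse_eq h2 h1
  have h4 : (mfderiv 𝓘(ℝ, Eu n) (𝓡 n) (extChartAt (𝓡 n) (1 : G)).symm x : Eu n →L[ℝ] Eu n) = D :=
    hD.mfderiv_eq
  obtain ⟨D₁, hD₁⟩ : ∃ D, HasD (𝓡 n) (𝓡 n) (fun y : G => e.symm x * y) 1 D :=
    ⟨_, hasD_mul_left_one _⟩
  have h5 : (mulInvariantVectorField (I := 𝓡 n) (G := G) X (e.symm x) : Eu n) = D₁ X :=
    congrArg (fun L : Eu n →L[ℝ] Eu n => L X) hD₁.mfderiv_eq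
  have h6 : HasLD n (𝓡 n) (fun y : G => e.symm x * y) 1 (.id ℝ _) := by
    simpa [HasLD] using hasD_id (I := 𝓡 n) (1 : G)
  have h7 := (hasD_chartField X hg h6 (mul_one _)).unique (hD'.comp hD₁ (mul_one _))
  have h8 := congrArg (fun L : Eu n →L[ℝ] Eu n => L X) h7
  rw [e.right_inv hx] at h8
  refine Eq.trans (b := (D' (D₁ X) : Eu n)) ?_ ?_
  · exact (congrArg (fun L : Eu n →L[ℝ] Eu n => ContinuousLinearMap.inverse L _) h4).trans
      ((congrArg (fun L : Eu n →L[ℝ] Eu n => L _) h3).trans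
        (congrArg D' (show (mulInvariantVectorField (I := 𝓡 n) (G := G) X
          ((extChartAt (𝓡 n) (1 : G)).symm x) : Eu n) = D₁ X from h5)))
  · exact h8.symm

theorem brE_eq_lieBracket (X Y : Eu n) :
    brE n G X Y = VectorField.lieBracket ℝ (chartField n G X) (chartField n G Y) (chartOne n G) := by
  have hr : Set.range (𝓡 n) = Set.univ := (𝓡 n).range_eq_univ
  have h1 := VectorField.mlieBracketWithin_apply (I := 𝓡 n) (s := Set.univ) (x₀ := (1 : G))
    (V := mulInvariantVectorField (I := 𝓡 n) (G := G) X)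
    (W := mulInvariantVectorField (I := 𝓡 n) (G := G) Y)
  rw [mfderiv_extChartAt_self] at h1
  have hid : ∀ v : Eu n, (ContinuousLinearMap.id ℝ (Eu n)).inverse v = v := fun v => by simp
  refine h1.trans ((hid _).trans ?_)
  rw [Set.preimage_univ, Set.univ_inter]
  have h2 : ∀ Z : Eu n, VectorField.mpullbackWithin 𝓘(ℝ, Eu n) (𝓡 n) (extChartAt (𝓡 n) (1 : G)).symm
      (mulInvariantVectorField (I := 𝓡 n) (G := G) Z) (Set.range (𝓡 n)) =ᶠ[𝓝 (chartOne n G)]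
      chartField n G Z := fun Z => by
    filter_upwards [(chartAt (Eu n) (1 : G)).open_target.mem_nhds chartOne_mem] with y hy
    exact mpullback_chart_symm Z hy
  have h3 : ∀ V W : Eu n → Eu n, V =ᶠ[𝓝 (chartOne n G)] chartField n G X →
      W =ᶠ[𝓝 (chartOne n G)] chartField n G Y →
      VectorField.lieBracketWithin ℝ V W Set.univ (chartOne n G) =
        VectorField.lieBracket ℝ (chartField n G X) (chartField n G Y) (chartOne n G) :=
    fun V W hV hW => by
      rw [VectorField.lieBracketWithin_univ]
      exact hV.lieBracket_vectorField_eq hW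
  rw [hr] at h2 ⊢
  exact h3 _ _ (h2 X) (h2 Y)

/-- `Ad`, logarithmic derivatives and differentials of translations all arise as derivatives in one
variable of a jointly smooth map; this gives their smooth dependence on the other variable. -/
theorem contMDiffAt_fderiv_param {E : Type*} [NormedAddCommGroup E] [NormedSpace ℝ E]
    {H : Type*} [TopologicalSpace H] {I : ModelWithCorners ℝ E H}
    {N : Type*} [TopologicalSpace N] [ChartedSpace H N] [IsManifold I ∞ N]
    {E' : Type*} [NormedAddCommGroup E'] [NormedSpace ℝ E']
    {E'' : Type*} [NormedAddCommGroup E''] [NormedSpace ℝ E'']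
    {f : N → E' → E''} {g : N → E'} {x : N}
    (hf : ContMDiffAt (I.prod 𝓘(ℝ, E')) 𝓘(ℝ, E'') ∞ (Function.uncurry f) (x, g x))
    (hg : ContMDiffAt I 𝓘(ℝ, E') ∞ g x) :
    ContMDiffAt I 𝓘(ℝ, E' →L[ℝ] E'') ∞ (fun y => fderiv ℝ (f y) (g y)) x := by
  have h := ContMDiffAt.mfderiv f g hf hg (m := ∞) (by simp)
  refine h.congr_of_eventuallyEq (.of_forall fun y => ?_)
  have := inTangentCoordinates_model_space (I := 𝓘(ℝ, E')) (I' := 𝓘(ℝ, E'')) g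
    (fun x => f x (g x)) (fun x => mfderiv 𝓘(ℝ, E') 𝓘(ℝ, E'') (f x) (g x)) x
  exact ((congrFun this y).trans mfderiv_eq_fderiv).symm

theorem contMDiff_AdE_apply (X : Eu n) :
    ContMDiff (𝓡 n) 𝓘(ℝ, Eu n) ∞ (fun g : G => AdE n g X) := by
  intro g
  set e := chartAt (Eu n) (1 : G) with he
  have h1 : ContMDiffAt ((𝓡 n).prod 𝓘(ℝ, Eu n)) 𝓘(ℝ, Eu n) ∞
      (Function.uncurry fun (g : G) (y : Eu n) => e (g * e.symm y * g⁻¹)) (g, chartOne n G) := by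
    have h2 : ContMDiffAt ((𝓡 n).prod 𝓘(ℝ, Eu n)) (𝓡 n) ∞
        (fun z : G × Eu n => e.symm z.2) (g, chartOne n G) :=
      ContMDiffAt.comp (g, chartOne n G) (contMDiffAt_chart_symm chartOne_mem) contMDiffAt_snd
    have h3 : ContMDiffAt ((𝓡 n).prod 𝓘(ℝ, Eu n)) (𝓡 n) ∞
        (fun z : G × Eu n => z.1) (g, chartOne n G) := contMDiffAt_fst
    refine ContMDiffAt.comp (g, chartOne n G) (contMDiffAt_chart ?_) ((h3.mul h2).mul h3.inv)
    simp [he, chart_symm_chartOne]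
  have h4 := (contMDiffAt_fderiv_param h1 contMDiffAt_const).clm_apply
    (contMDiffAt_const (c := X))
  refine h4.congr_of_eventuallyEq (.of_forall fun y => ?_)
  have h5 := HasD.chart ((hasD_Ad y).comp (hasD_chart_symm_self (1 : G)) chart_symm_chartOne)
    (p := 1) (by change y * e.symm (chartOne n G) * y⁻¹ = 1; simp [he, chart_symm_chartOne])
  rw [ContinuousLinearMap.comp_id] at h5
  exact congrArg (fun L => L X) (hasD_iff_hasFDerivAt.1 h5).fderiv.symm

theorem chartField_chartOne (X : Eu n) : chartField n G X (chartOne n G) = X := by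
  have h3 : HasFDerivAt (chartMul n G) _ (chartOne n G, chartOne n G) :=
    ((contDiffAt_chartMul chartOne_mem).differentiableAt (by simp)).hasFDerivAt
  have h4 := h3.comp (f := fun y => (chartOne n G, y)) (chartOne n G)
    (hasFDerivAt_prodMk_right _ _)
  have h5 : HasFDerivAt (fun x => chartMul n G (chartOne n G, x)) (.id ℝ _) (chartOne n G) := by
    refine (hasFDerivAt_id (chartOne n G)).congr_of_eventuallyEq ?_
    filter_upwards [(chartAt (Eu n) (1 : G)).open_target.mem_nhds chartOne_mem] with x hx
    simp only [chartMul, chart_symm_chartOne, one_mul, id]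
    exact (chartAt (Eu n) (1 : G)).right_inv hx
  simpa [chartField] using congrArg (fun T => T X) (h4.unique h5)

theorem fderiv_chartField (X w : Eu n) : fderiv ℝ (chartField n G X) (chartOne n G) w =
    fderiv ℝ (fderiv ℝ (chartMul n G)) (chartOne n G, chartOne n G) (w, 0) (0, X) := by
  have h : HasFDerivAt (fderiv ℝ (chartMul n G)) _ (chartOne n G, chartOne n G) :=
    (((contDiffAt_chartMul (G := G) chartOne_mem).fderiv_right (m := ∞) (by simp)).differentiableAt (by simp)).hasFDerivAt
  have h2 := (h.comp (f := fun y => (y, chartOne n G)) (chartOne n G)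
    (hasFDerivAt_prodMk_left _ _)).clm_apply
    (hasFDerivAt_const ((0, X) : Eu n × Eu n) (chartOne n G))
  have h3 := congrArg (fun L => L w) h2.fderiv
  refine h3.trans ?_
  simp

/-- The derivative at `1` of the adjoint representation is the Lie bracket. -/
theorem hasD_AdE_apply (X : Eu n) : ∃ L : Eu n →L[ℝ] Eu n,
    HasD (𝓡 n) 𝓘(ℝ, Eu n) (fun g : G => AdE n g X) 1 L ∧ ∀ w, L w = brE n G w X := by
  obtain ⟨L, hL⟩ : ∃ L, HasD (𝓡 n) 𝓘(ℝ, Eu n) (fun g : G => AdE n g X) 1 L :=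
    ⟨_, hasD_of_mdifferentiableAt ((contMDiff_AdE_apply X).mdifferentiable (by simp) 1)⟩
  refine ⟨L, hL, fun w => ?_⟩
  set e := chartAt (Eu n) (1 : G) with he
  set o := chartOne n G with ho
  set μ := chartMul n G with hμ
  have hA : HasFDerivAt (fun x => AdE n (e.symm x) X) L o :=
    hasD_iff_hasFDerivAt.1 (hL.comp (hasD_chart_symm_self (1 : G)) chart_symm_chartOne)
  -- `x y = (x y x⁻¹) x`: the left translate of `X` by `x` is the right translate of `Ad x X`.
  -- Differentiating this second expression of the field at the unit brings in the derivative of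
  -- `Ad`.
  have key : ∀ x ∈ e.target, chartField n G X x = fderiv ℝ μ (o, x) (AdE n (e.symm x) X, 0) := by
    intro x hx
    have h1 : HasLD n (𝓡 n) (fun y : G => e.symm x * y) 1 (.id ℝ _) := by
      simpa [HasLD] using hasD_id (I := 𝓡 n) (1 : G)
    have h2 := hasD_chartField X (e.map_target hx) h1 (mul_one _)
    have h3 : HasFDerivAt μ _ (o, x) :=
      ((contDiffAt_chartMul_left hx).differentiableAt (by simp)).hasFDerivAt
    have h4 := hasD_iff_hasFDerivAt.2 (h3.comp (f := fun y => (y, x)) o (hasFDerivAt_prodMk_left o x))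
    have h5 := h4.comp (HasD.chart (p := 1) (hasD_Ad (n := n) (e.symm x)) (by simp)) (by simp [ho, chartOne])
    have h6 := h2.unique (h5.congr ?_)
    · have := congrArg (fun L => L X) h6
      rw [e.right_inv hx] at this
      simpa [chartField] using this
    · have hc : ContinuousAt (fun y : G => e.symm x * y * (e.symm x)⁻¹) 1 :=
        HasMFDerivAt.continuousAt (hasD_Ad (n := n) (e.symm x))
      have : ∀ᶠ z in 𝓝 1, e.symm x * z * (e.symm x)⁻¹ ∈ e.source := hc.eventually_mem <| by
        simpa using e.open_source.mem_nhds (mem_chart_source (Eu n) (1 : G))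
      filter_upwards [this] with z hz
      change e _ = e (e.symm (e (e.symm x * z * (e.symm x)⁻¹)) * e.symm x)
      rw [e.left_inv hz]
      simp
  have hμ2 : HasFDerivAt (fderiv ℝ μ) _ (o, o) :=
    (((contDiffAt_chartMul (G := G) chartOne_mem).fderiv_right (m := ∞) (by simp)).differentiableAt (by simp)).hasFDerivAt
  have hR := (hμ2.comp (f := fun y => (o, y)) o (hasFDerivAt_prodMk_right o o)).clm_apply
    (hA.prodMk (hasFDerivAt_const (0 : Eu n) o))
  have hR2 := hR.congr_of_eventuallyEq (f₁ := chartField n G X) (by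
    filter_upwards [e.open_target.mem_nhds chartOne_mem] with x hx using key x hx)
  have hsymm : ∀ a b, fderiv ℝ (fderiv ℝ μ) (o, o) a b = fderiv ℝ (fderiv ℝ μ) (o, o) b a :=
    fun a b => ((contDiffAt_chartMul (G := G) chartOne_mem).isSymmSndFDerivAt
      (by simp [ENat.LEInfty.out])) a b
  have h7 := congrArg (fun L => L w) hR2.fderiv
  rw [brE_eq_lieBracket, VectorField.lieBracket_eq]
  rw [fderiv_chartField X w] at h7
  simp only [chartField_chartOne]
  rw [fderiv_chartField X w, fderiv_chartField w X, h7]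
  have h8 : fderiv ℝ μ (o, o) (L w, 0) = L w := by
    have h3 : HasFDerivAt μ _ (o, o) :=
      ((contDiffAt_chartMul_left chartOne_mem).differentiableAt (by simp)).hasFDerivAt
    have h4 := h3.comp (f := fun y => (y, o)) o (hasFDerivAt_prodMk_left o o)
    have h5 : HasFDerivAt (fun x => μ (x, o)) (.id ℝ _) o := by
      refine (hasFDerivAt_id o).congr_of_eventuallyEq ?_
      filter_upwards [e.open_target.mem_nhds chartOne_mem] with x hx
      change e (e.symm x * e.symm o) = x
      rw [he, ho, chart_symm_chartOne, mul_one, e.right_inv hx]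
    have h6 := h4.unique h5
    simpa using congrArg (fun T => T (L w)) h6
  have h9 : AdE n (e.symm o) X = X := by
    rw [he, ho, chart_symm_chartOne, AdE_one]; rfl
  rw [h9]
  -- The mixed second derivatives of the multiplication agree by symmetry and cancel in the bracket;
  -- the derivative of `Ad` remains.
  have h10 := hsymm (0, w) (X, 0)
  simp only [add_apply, ContinuousLinearMap.comp_apply,
    ContinuousLinearMap.prod_apply, ContinuousLinearMap.flip_apply, ContinuousLinearMap.inr_apply,
    zero_apply, Function.comp] at h10 ⊢
  rw [h8, h10, add_sub_cancel_right]

end Bracket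

/-- Bootstrapping: if `κ` is `C^m`, so is `κ' = f ∘ κ`, and then `κ` is `C^(m+1)`. It upgrades
integral curves, which are a priori only differentiable. -/
theorem contDiffOn_of_hasDerivAt_comp {E : Type*} [NormedAddCommGroup E] [NormedSpace ℝ E]
    {f : E → E} {U : Set E} (hf : ContDiffOn ℝ ∞ f U) {κ : ℝ → E} {s : Set ℝ} (hs : IsOpen s)
    (hκ : ∀ t ∈ s, HasDerivAt κ (f (κ t)) t) (hU : ∀ t ∈ s, κ t ∈ U) : ContDiffOn ℝ ∞ κ s := by
  rw [contDiffOn_infty]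
  intro m
  induction m with
  | zero =>
    simp only [CharP.cast_eq_zero, contDiffOn_zero]
    exact fun t ht => (hκ t ht).continuousAt.continuousWithinAt
  | succ m ih =>
    push_cast
    rw [contDiffOn_succ_iff_deriv_of_isOpen hs]
    refine ⟨fun t ht => (hκ t ht).differentiableAt.differentiableWithinAt, by simp, ?_⟩
    refine ((hf.of_le (by exact_mod_cast le_top)).comp ih hU).congr fun t ht => (hκ t ht).deriv

/-! ### One-parameter subgroups -/

section OneParam
variable {n : ℕ}
  {G : Type*} [TopologicalSpace G] [ChartedSpace (EuclideanSpace ℝ (Fin n)) G] [Group G]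
  [LieGroup (𝓡 n) ∞ G]

/-- Left translation by `γ t` carries `X` to the value of the left invariant field. Integral curves
are thus the curves of constant logarithmic derivative `X`, a condition unaffected by left
multiplication. -/
theorem hasMFDerivAt_mulInvariant_iff {γ : ℝ → G} {t : ℝ} {X : Eu n} :
    HasMFDerivAt 𝓘(ℝ, ℝ) (𝓡 n) γ t
      ((1 : ℝ →L[ℝ] ℝ).smulRight (mulInvariantVectorField (I := 𝓡 n) (G := G) X (γ t))) ↔
    HasLD n 𝓘(ℝ, ℝ) γ t ((1 : ℝ →L[ℝ] ℝ).smulRight X) := by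
  obtain ⟨D, hD⟩ : ∃ D : Eu n →L[ℝ] Eu n, HasD (𝓡 n) (𝓡 n) (fun y : G => γ t * y) 1 D :=
    ⟨_, hasD_mul_left_one (γ t)⟩
  obtain ⟨D', hD'⟩ : ∃ D : Eu n →L[ℝ] Eu n,
      HasD (𝓡 n) (𝓡 n) (fun y : G => (γ t)⁻¹ * y) (γ t) D :=
    ⟨_, hasD_of_mdifferentiableAt
      (((contMDiff_mul_left (I := 𝓡 n) (n := ∞)).mdifferentiable (by simp)) (γ t))⟩
  have h1 : (mulInvariantVectorField (I := 𝓡 n) (G := G) X (γ t) : Eu n) = D X :=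
    congrArg (fun L : Eu n →L[ℝ] Eu n => L X) hD.mfderiv_eq
  have h2 : D'.comp D = .id ℝ _ := by
    refine (hD'.comp hD (mul_one _)).unique ((hasD_id (I := 𝓡 n) (1 : G)).congr ?_)
    exact .of_forall fun y => by simp
  change HasD 𝓘(ℝ, ℝ) (𝓡 n) γ t ((1 : ℝ →L[ℝ] ℝ).smulRight
    (mulInvariantVectorField (I := 𝓡 n) (G := G) X (γ t) : Eu n)) ↔ _
  rw [h1]
  constructor
  · intro h
    have h3 := hD'.comp h rfl
    have h4 : D'.comp ((1 : ℝ →L[ℝ] ℝ).smulRight (D X)) = (1 : ℝ →L[ℝ] ℝ).smulRight X := by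
      refine ContinuousLinearMap.ext_ring ?_
      simpa using congrArg (fun L => L X) h2
    rwa [h4] at h3
  · intro h
    have h3 := hD.comp h (by simp)
    have h4 : D.comp ((1 : ℝ →L[ℝ] ℝ).smulRight X) = (1 : ℝ →L[ℝ] ℝ).smulRight (D X) := by
      ext
      simp
    rw [h4] at h3
    exact h3.congr (.of_forall fun y => by simp)

theorem HasLD.const_mul {E : Type*} [NormedAddCommGroup E] [NormedSpace ℝ E]
    {H : Type*} [TopologicalSpace H] {I : ModelWithCorners ℝ E H}
    {N : Type*} [TopologicalSpace N] [ChartedSpace H N] {f : N → G} {x : N} {L : E →L[ℝ] Eu n}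
    (hf : HasLD n I f x L) (g : G) : HasLD n I (fun y => g * f y) x L :=
  HasD.congr hf (.of_forall fun y => by simp [mul_assoc])

theorem HasLD.comp_add {γ : ℝ → G} {t s : ℝ} {X : Eu n}
    (hf : HasLD n 𝓘(ℝ, ℝ) γ (t + s) ((1 : ℝ →L[ℝ] ℝ).smulRight X)) :
    HasLD n 𝓘(ℝ, ℝ) (fun u => γ (t + u)) s ((1 : ℝ →L[ℝ] ℝ).smulRight X) := by
  have h : HasD 𝓘(ℝ, ℝ) 𝓘(ℝ, ℝ) (fun u : ℝ => t + u) s (.id ℝ ℝ) :=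
    hasD_iff_hasFDerivAt.2 ((hasFDerivAt_id s).const_add t)
  simpa [HasLD] using HasD.comp hf h rfl

theorem contMDiff_one_mulInvariant (X : Eu n) : ContMDiff (𝓡 n) (𝓡 n).tangent 1
    (fun g : G => (⟨g, mulInvariantVectorField (I := 𝓡 n) (G := G) X g⟩ :
      TangentBundle (𝓡 n) G)) :=
  (contMDiff_mulInvariantVectorField (I := 𝓡 n) (G := G) X).of_le (by
    simp only [minSmoothness_of_isRCLikeNormedField]
    norm_num)

/-- A smooth one-parameter subgroup is an integral curve of a left invariant field. -/
theorem IsOneParam.hasLD {γ : ℝ → G} {X : Eu n} (h : IsOneParam γ X) (t : ℝ) :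
    HasLD n 𝓘(ℝ, ℝ) γ t ((1 : ℝ →L[ℝ] ℝ).smulRight X) := by
  obtain ⟨h1, h2, h3⟩ := h
  have h0 : γ 0 = 1 := by simpa using h2 0 0
  have hd : HasD 𝓘(ℝ, ℝ) (𝓡 n) γ 0 ((1 : ℝ →L[ℝ] ℝ).smulRight X) := by
    obtain ⟨D, hD⟩ : ∃ D : ℝ →L[ℝ] Eu n, HasD 𝓘(ℝ, ℝ) (𝓡 n) γ 0 D :=
      ⟨_, hasD_of_mdifferentiableAt (h1.mdifferentiable (by simp) 0)⟩
    have : D 1 = X := (congrArg (fun L : ℝ →L[ℝ] Eu n => L 1) hD.mfderiv_eq).symm.trans h3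
    convert hD using 1
    ext
    simp [this]
  have hs : HasD 𝓘(ℝ, ℝ) 𝓘(ℝ, ℝ) (fun u : ℝ => -t + u) t (.id ℝ ℝ) :=
    hasD_iff_hasFDerivAt.2 ((hasFDerivAt_id t).const_add _)
  have h4 := hd.comp hs (by simp)
  rw [ContinuousLinearMap.comp_id] at h4
  refine h4.congr (.of_forall fun u => ?_)
  have h5 : γ (t + (-t + u)) = γ t * γ (-t + u) := h2 _ _
  simp only [add_neg_cancel_left] at h5
  simp [h5]

/-- Every vector of the Lie algebra generates a one-parameter subgroup. -/
theorem exists_isOneParam [T2Space G] (X : Eu n) :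
    ∃ γ : ℝ → G, IsOneParam (n := n) γ X := by
  have hv := contMDiff_one_mulInvariant (G := G) X
  obtain ⟨γ₀, h0, hγ₀⟩ := exists_isMIntegralCurveAt_of_contMDiffAt_boundaryless (t₀ := 0)
    (hv.contMDiffAt (x := (1 : G)))
  obtain ⟨ε, hε, hγ₁⟩ := isMIntegralCurveAt_iff'.1 hγ₀
  have hball : Metric.ball (0 : ℝ) ε = Set.Ioo (-ε) ε := by
    rw [Real.ball_eq_Ioo]; simp
  rw [hball] at hγ₁
  -- Left translates of one integral curve through `1` start at every point and share its lifetime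
  -- `ε`; a uniform lifetime makes the field complete.
  obtain ⟨γ, hγ0, hγ⟩ := exists_isMIntegralCurve_of_isMIntegralCurveOn hv hε (fun g => by
    refine ⟨fun t => g * γ₀ t, by simp [h0], fun t ht => ?_⟩
    have h1 := (hγ₁ t ht).hasMFDerivAt (Ioo_mem_nhds ht.1 ht.2)
    exact (hasMFDerivAt_mulInvariant_iff.2
      ((hasMFDerivAt_mulInvariant_iff.1 h1).const_mul g)).hasMFDerivWithinAt) (1 : G)
  have hLD : ∀ t, HasLD n 𝓘(ℝ, ℝ) γ t ((1 : ℝ →L[ℝ] ℝ).smulRight X) := fun t =>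
    hasMFDerivAt_mulInvariant_iff.1 (hγ t)
  -- As functions of `b`, both sides are integral curves, and they agree at `b = 0`.
  have hadd : ∀ a b, γ (a + b) = γ a * γ b := by
    intro a b
    have h1 : IsMIntegralCurve (I := 𝓡 n) (fun t => γ (a + t)) (mulInvariantVectorField (G := G) X) :=
      fun t => hasMFDerivAt_mulInvariant_iff.2 (hLD (a + t)).comp_add
    have h2 : IsMIntegralCurve (I := 𝓡 n) (fun t => γ a * γ t) (mulInvariantVectorField (G := G) X) :=
      fun t => hasMFDerivAt_mulInvariant_iff.2 ((hLD t).const_mul _)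
    exact congrFun (isMIntegralCurve_Ioo_eq_of_contMDiff_boundaryless (t₀ := 0) hv h1 h2
      (by simp [hγ0])) b
  -- Near `0` the curve solves an ordinary differential equation in the chart at `1`. Smoothness at
  -- other times `t` comes from `γ s = γ t * γ (-t + s)`.
  have hsm0 : ContMDiffAt 𝓘(ℝ, ℝ) (𝓡 n) ∞ γ 0 := by
    set e := chartAt (Eu n) (1 : G)
    have hcont : Continuous γ := hγ.continuous
    have hopen : IsOpen (γ ⁻¹' e.source) := e.open_source.preimage hcont
    have h0m : (0 : ℝ) ∈ γ ⁻¹' e.source := by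
      change γ 0 ∈ e.source
      rw [hγ0]
      exact mem_chart_source (Eu n) (1 : G)
    have h1 : ContDiffOn ℝ ∞ (fun t => e (γ t)) (γ ⁻¹' e.source) := by
      refine contDiffOn_of_hasDerivAt_comp (contDiffOn_chartField (G := G) X) hopen ?_
        (fun t ht => e.map_source ht)
      intro t ht
      have h2 := hasD_iff_hasFDerivAt.1 (hasD_chartField X ht (hLD t) rfl)
      have h3 := h2.hasDerivAt
      simpa [chartField] using h3
    have h2 : ContDiffAt ℝ ∞ (fun t => e (γ t)) 0 := h1.contDiffAt (hopen.mem_nhds h0m)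
    have h3 : ContMDiffAt 𝓘(ℝ, ℝ) (𝓡 n) ∞ (fun t => e.symm (e (γ t))) 0 :=
      ContMDiffAt.comp 0 (contMDiffAt_chart_symm (e.map_source h0m)) h2.contMDiffAt
    refine h3.congr_of_eventuallyEq ?_
    filter_upwards [hopen.mem_nhds h0m] with t ht using (e.left_inv ht).symm
  refine ⟨γ, ?_, hadd, ?_⟩
  · intro t
    have h1 : ContMDiffAt 𝓘(ℝ, ℝ) (𝓡 n) ∞ (fun s => γ (-t + s)) t := by
      refine ContMDiffAt.comp_of_eq (y := 0) (f := fun s : ℝ => -t + s) hsm0 ?_ (by simp)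
      exact (contDiff_const.add contDiff_id).contMDiff.contMDiffAt
    have h2 : ContMDiffAt 𝓘(ℝ, ℝ) (𝓡 n) ∞ (fun s => γ t * γ (-t + s)) t :=
      contMDiffAt_const.mul h1
    refine h2.congr_of_eventuallyEq (.of_forall fun s => ?_)
    simp [← hadd]
  · have h1 := (hLD 0).hasD hγ0
    exact (congrArg (fun L : ℝ →L[ℝ] Eu n => L 1) h1.mfderiv_eq).trans (by simp)

theorem IsOneParam.map_zero {γ : ℝ → G} {X : Eu n} (h : IsOneParam γ X) : γ 0 = 1 := by
  simpa using h.2.1 0 0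

theorem IsOneParam.hasDerivAt_AdE {γ : ℝ → G} {X : Eu n} (h : IsOneParam γ X) (Z : Eu n) (t : ℝ) :
    HasDerivAt (fun s => AdE n (γ s) Z) (AdE n (γ t) (brE n G X Z)) t := by
  obtain ⟨L, hL, hL2⟩ := hasD_AdE_apply (G := G) Z
  have h1 := hasD_iff_hasFDerivAt.1 (hL.comp (h.hasLD t) (by simp))
  have h2 := ((AdE n (γ t)).hasFDerivAt.comp t h1).hasDerivAt
  have h3 := h2.congr_of_eventuallyEq (f₁ := fun s => AdE n (γ s) Z) (.of_forall fun s => by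
    simp [← AdE_mul_apply])
  simpa [hL2] using h3

theorem IsOneParam.conj {γ : ℝ → G} {X : Eu n} (h : IsOneParam γ X) (g : G) :
    IsOneParam (fun t => g * γ t * g⁻¹) (AdE n g X) := by
  refine ⟨(contMDiff_conj g).comp h.1, fun a b => ?_, ?_⟩
  · simp [h.2.1, mul_assoc]
  · have h1 := (hasD_Ad (n := n) g).comp ((h.hasLD 0).hasD h.map_zero) h.map_zero
    exact (congrArg (fun L : ℝ →L[ℝ] Eu n => L 1) h1.mfderiv_eq).trans (by simp)

/-- Let `γ` be generated by `X` and differentiate `Ad (g γ g⁻¹) (Ad g Y) = Ad g (Ad γ Y)` at `0`. -/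
theorem AdE_brE [T2Space G] (g : G) (X Y : Eu n) :
    AdE n g (brE n G X Y) = brE n G (AdE n g X) (AdE n g Y) := by
  obtain ⟨γ, hγ⟩ := exists_isOneParam (G := G) X
  have h1 := ((AdE n g).hasFDerivAt.comp 0 (hγ.hasDerivAt_AdE Y 0).hasFDerivAt).hasDerivAt
  have h2 := (hγ.conj g).hasDerivAt_AdE (AdE n g Y) 0
  have h3 := h1.unique (h2.congr_of_eventuallyEq (.of_forall fun t => by
    simp [← AdE_mul_apply]))
  simpa [hγ.map_zero, AdE_one] using h3

/-- The bracket is a limit of difference quotients of a curve in `W`, and `W` is closed. -/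
theorem brE_mem [T2Space G] {W : Submodule ℝ (Eu n)} {X Z : Eu n} {γ : ℝ → G}
    (hγ : IsOneParam γ X) (h : ∀ t, AdE n (γ t) Z ∈ W) : brE n G X Z ∈ W := by
  have h1 := hγ.hasDerivAt_AdE Z 0
  rw [hγ.map_zero, AdE_one] at h1
  have h2 : IsClosed (W : Set (Eu n)) := W.closed_of_finiteDimensional
  rw [hasDerivAt_iff_tendsto_slope] at h1
  refine h2.mem_of_tendsto h1 (.of_forall fun t => ?_)
  exact W.smul_mem _ (W.sub_mem (h t) (by simpa [hγ.map_zero] using h 0))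

theorem brE_add_left (X Y Z : Eu n) : brE n G (X + Y) Z = brE n G X Z + brE n G Y Z :=
  add_lie (L := GroupLieAlgebra (𝓡 n) G) (M := GroupLieAlgebra (𝓡 n) G) X Y Z

theorem brE_add_right (X Y Z : Eu n) : brE n G X (Y + Z) = brE n G X Y + brE n G X Z :=
  lie_add (L := GroupLieAlgebra (𝓡 n) G) (M := GroupLieAlgebra (𝓡 n) G) X Y Z

theorem brE_smul_left (c : ℝ) (X Y : Eu n) : brE n G (c • X) Y = c • brE n G X Y :=
  smul_lie (R := ℝ) (L := GroupLieAlgebra (𝓡 n) G) (M := GroupLieAlgebra (𝓡 n) G) c X Y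

theorem brE_smul_right (c : ℝ) (X Y : Eu n) : brE n G X (c • Y) = c • brE n G X Y :=
  lie_smul (R := ℝ) (L := GroupLieAlgebra (𝓡 n) G) (M := GroupLieAlgebra (𝓡 n) G) c X Y

theorem brE_skew (X Y : Eu n) : brE n G X Y = -brE n G Y X :=
  (lie_skew (L := GroupLieAlgebra (𝓡 n) G) X Y).symm

/-- The bracket of `𝔤` as a bilinear map. -/
def brL (n : ℕ) (G : Type*) [TopologicalSpace G] [ChartedSpace (EuclideanSpace ℝ (Fin n)) G]
    [Group G] [LieGroup (𝓡 n) ∞ G] : Eu n →ₗ[ℝ] Eu n →ₗ[ℝ] Eu n :=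
  LinearMap.mk₂ ℝ (brE n G) brE_add_left brE_smul_left brE_add_right brE_smul_right

theorem brL_apply (X Y : Eu n) : brL n G X Y = brE n G X Y := rfl

/-- The orbit has velocity `dT (γ s) (dO X) = 0`, so it is an integral curve of the zero field.
Hence `𝔥`, defined as the kernel of `dOrbit`, exponentiates into the stabilizer, and invariance
under `Ad(H)` can be differentiated. -/
theorem IsOneParam.smul_eq [T2Space G] {d : ℕ}
    {M : Type*} [TopologicalSpace M] [T2Space M] [ChartedSpace (EuclideanSpace ℝ (Fin d)) M]
    [IsManifold (𝓡 d) ∞ M] [MulAction G M] [ContMDiffSMul (𝓡 n) (𝓡 d) ∞ G M] {p : M}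
    {γ : ℝ → G} {X : Eu n} (hγ : IsOneParam γ X) (hX : dO n d G p X = 0) (t : ℝ) :
    γ t • p = p := by
  have hv : ContMDiff (𝓡 d) (𝓡 d).tangent 1
      (fun q : M => (⟨q, (0 : TangentSpace (𝓡 d) q)⟩ : TangentBundle (𝓡 d) M)) :=
    Bundle.contMDiff_zeroSection ℝ (TangentSpace (𝓡 d) : M → Type _)
  have h1 : IsMIntegralCurve (I := 𝓡 d) (fun t => γ t • p)
      (fun q : M => (0 : TangentSpace (𝓡 d) q)) := by
    intro s
    have h2 := (hγ.hasLD s).smul (d := d) p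
    have h3 : (dT d (γ s) p).comp ((dO n d G p).comp ((1 : ℝ →L[ℝ] ℝ).smulRight X)) =
        (1 : ℝ →L[ℝ] ℝ).smulRight (0 : Eu d) := by
      refine ContinuousLinearMap.ext_ring ?_
      simp [hX]
    rw [h3] at h2
    exact h2
  have h2 : IsMIntegralCurve (I := 𝓡 d) (fun _ => p) (fun q : M => (0 : TangentSpace (𝓡 d) q)) :=
    isMIntegralCurve_const rfl
  exact congrFun (isMIntegralCurve_Ioo_eq_of_contMDiff_boundaryless (t₀ := 0) hv h1 h2
    (by simp [hγ.map_zero])) t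

end OneParam

theorem hasDerivAt_bilin {V W : Type*} [NormedAddCommGroup V] [NormedSpace ℝ V]
    [FiniteDimensional ℝ V] [NormedAddCommGroup W] [NormedSpace ℝ W] [FiniteDimensional ℝ W]
    (b : V →ₗ[ℝ] W →ₗ[ℝ] ℝ) {f : ℝ → V} {g : ℝ → W} {f' : V} {g' : W} {t : ℝ}
    (hf : HasDerivAt f f' t) (hg : HasDerivAt g g' t) :
    HasDerivAt (fun s => b (f s) (g s)) (b f' (g t) + b (f t) g') t := by
  have h := (b.toContinuousBilinearMap.hasFDerivAt_of_bilinear hf.hasFDerivAt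
    hg.hasFDerivAt).hasDerivAt
  refine h.congr_deriv ?_
  simp [add_comm]

/-! ### Invariant forms and the isotropy algebra -/

section Forms
variable {n d : ℕ}
  {G : Type*} [TopologicalSpace G] [ChartedSpace (EuclideanSpace ℝ (Fin n)) G] [Group G]
  [LieGroup (𝓡 n) ∞ G]
  {M : Type*} [TopologicalSpace M] [ChartedSpace (EuclideanSpace ℝ (Fin d)) M]
  [MulAction G M]

/-- The value at `q` of a field of bilinear forms, as a form on the model space. -/
def bE (β : BilinField d M) (q : M) : Eu d →ₗ[ℝ] Eu d →ₗ[ℝ] ℝ := β q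

/-- The value at `q` of a function on the tangent bundle, as a function on the model space. -/
def fE (F : FinslerFun d M) (q : M) : Eu d → ℝ := F q

/-- `G`-invariance of a field of bilinear forms. -/
def BilinInv (G : Type*) [Group G] [MulAction G M] (β : BilinField d M) : Prop :=
  ∀ (g : G) (q : M) (v w : Eu d), bE β (g • q) (dT d g q v) (dT d g q w) = bE β q v w

/-- `G`-invariance of a function on the tangent bundle. -/
def FunInv (G : Type*) [Group G] [MulAction G M] (F : FinslerFun d M) : Prop :=
  ∀ (g : G) (q : M) (v : Eu d), fE F (g • q) (dT d g q v) = fE F q v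

variable [ContMDiffSMul (𝓡 n) (𝓡 d) ∞ G M]

theorem BilinInv.apply_AdE {β : BilinField d M} (hβ : BilinInv G β) (g : G) (q : M) (X Y : Eu n) :
    bE β (g • q) (dO n d G (g • q) (AdE n g X)) (dO n d G (g • q) (AdE n g Y)) =
      bE β q (dO n d G q X) (dO n d G q Y) := by
  rw [← dT_dO, ← dT_dO, hβ]

theorem BilinInv.apply_AdE_stab {β : BilinField d M} (hβ : BilinInv G β) {g : G} {p : M}
    (hg : g • p = p) (X Y : Eu n) :
    bE β p (dO n d G p (AdE n g X)) (dO n d G p (AdE n g Y)) =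
      bE β p (dO n d G p X) (dO n d G p Y) := by
  have := hβ.apply_AdE g p X Y
  rwa [hg] at this

theorem dO_AdE_stab {g : G} {p : M} (hg : g • p = p) (X : Eu n) :
    dT d g p (dO n d G p X) = dO n d G p (AdE n g X) := by
  have := dT_dO (d := d) g p X
  rwa [hg] at this

variable [T2Space G] [T2Space M] [IsManifold (𝓡 d) ∞ M]

theorem hasDerivAt_dO_AdE {γ : ℝ → G} {X : Eu n} (h : IsOneParam γ X) (p : M) (Z : Eu n) :
    HasDerivAt (fun s => dO n d G p (AdE n (γ s) Z)) (dO n d G p (brE n G X Z)) 0 := by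
  have h1 := ((dO n d G p).hasFDerivAt.comp 0 (h.hasDerivAt_AdE Z 0).hasFDerivAt).hasDerivAt
  exact h1.congr_deriv (by simp [h.map_zero, AdE_one])

/-- `η` generates a one-parameter group that fixes `p`; the invariance of `β p` under it is
differentiated at `0`. -/
theorem BilinInv.brE_skew {β : BilinField d M} (hβ : BilinInv G β) {p : M} {η : Eu n}
    (hη : dO n d G p η = 0) (X Y : Eu n) :
    bE β p (dO n d G p (brE n G η X)) (dO n d G p Y) +
      bE β p (dO n d G p X) (dO n d G p (brE n G η Y)) = 0 := by
  obtain ⟨γ, hγ⟩ := exists_isOneParam (G := G) η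
  have h1 := hasDerivAt_bilin (bE β p) (hasDerivAt_dO_AdE (d := d) hγ p X)
    (hasDerivAt_dO_AdE (d := d) hγ p Y)
  have h2 := h1.unique ((hasDerivAt_const (0 : ℝ) (bE β p (dO n d G p X) (dO n d G p Y))).congr_of_eventuallyEq
    (.of_forall fun t => hβ.apply_AdE_stab (hγ.smul_eq hη t) X Y))
  simpa [hγ.map_zero, AdE_one] using h2

/-- `𝔥` is a subalgebra: `Ad` of the stabilizer preserves the kernel of `dO`, since `dT ∘ dO = dO ∘
Ad`. -/
theorem dO_brE_isotropy {p : M} {η ζ : Eu n} (hη : dO n d G p η = 0) (hζ : dO n d G p ζ = 0) :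
    dO n d G p (brE n G η ζ) = 0 := by
  obtain ⟨γ, hγ⟩ := exists_isOneParam (G := G) η
  refine brE_mem (W := (dO n d G p).toLinearMap.ker) hγ fun t => ?_
  have := dO_AdE_stab (d := d) (hγ.smul_eq hη t) ζ
  rw [hζ, map_zero] at this
  exact this.symm

theorem brE_mem_of_adInvariant {p : M} {V : Submodule ℝ (Eu n)}
    (hV : AdInvariant (n := n) (G := G) p V) {η : Eu n} (hη : dO n d G p η = 0) {x : Eu n}
    (hx : x ∈ V) : brE n G η x ∈ V := by
  obtain ⟨γ, hγ⟩ := exists_isOneParam (G := G) η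
  exact brE_mem hγ fun t => hV _ (hγ.smul_eq hη t) x hx

end Forms

/-- The inverse function theorem, with a smooth inverse on an open set. -/
theorem exists_openPartialHomeomorph {E E' : Type*} [NormedAddCommGroup E] [NormedSpace ℝ E]
    [CompleteSpace E] [NormedAddCommGroup E'] [NormedSpace ℝ E'] [CompleteSpace E']
    {f : E → E'} {U : Set E} (hU : IsOpen U) (hf : ContDiffOn ℝ ∞ f U) {a : E} (ha : a ∈ U)
    {L : E ≃L[ℝ] E'} (hL : HasFDerivAt f (L : E →L[ℝ] E') a) :
    ∃ φ : OpenPartialHomeomorph E E', a ∈ φ.source ∧ φ.source ⊆ U ∧ (∀ x, φ x = f x) ∧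
      ContDiffOn ℝ ∞ φ.symm φ.target := by
  have hfa : ContDiffAt ℝ ∞ f a := hf.contDiffAt (hU.mem_nhds ha)
  set ψ := hfa.toOpenPartialHomeomorph f hL (by simp) with hψ
  have hψc : ∀ x, ψ x = f x := fun x => rfl
  -- Restricting to the open set where the derivative is invertible makes the inverse smooth on the
  -- whole target, not only at the image of `a`.
  have hopen : IsOpen (U ∩ {x | fderiv ℝ f x ∈ Set.range ((↑) : (E ≃L[ℝ] E') → E →L[ℝ] E')}) :=
    (hf.continuousOn_fderiv_of_isOpen hU (by simp)).isOpen_inter_preimage hU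
      (ContinuousLinearEquiv.isOpen)
  refine ⟨ψ.restrOpen _ hopen, ?_, ?_, fun x => rfl, ?_⟩
  · refine ⟨hfa.mem_toOpenPartialHomeomorph_source hL (by simp), ha, L, ?_⟩
    exact hL.fderiv.symm
  · exact fun x hx => hx.2.1
  · intro y hy
    have hx := (ψ.restrOpen _ hopen).map_target hy
    obtain ⟨L', hL'⟩ := hx.2.2
    have hfx : ContDiffAt ℝ ∞ f ((ψ.restrOpen _ hopen).symm y) := hf.contDiffAt (hU.mem_nhds hx.2.1)
    have h1 : HasFDerivAt (ψ.restrOpen _ hopen) (L' : E →L[ℝ] E') ((ψ.restrOpen _ hopen).symm y) := by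
      rw [hL']
      exact (hfx.differentiableAt (by simp)).hasFDerivAt
    exact ((ψ.restrOpen _ hopen).contDiffAt_symm hy h1 hfx).contDiffWithinAt

/-! ### Local sections of the orbit map -/

section Section
variable {n d : ℕ}
  {G : Type*} [TopologicalSpace G] [ChartedSpace (EuclideanSpace ℝ (Fin n)) G] [Group G]
  [LieGroup (𝓡 n) ∞ G]
  {M : Type*} [TopologicalSpace M] [ChartedSpace (EuclideanSpace ℝ (Fin d)) M]
  [IsManifold (𝓡 d) ∞ M] [MulAction G M] [ContMDiffSMul (𝓡 n) (𝓡 d) ∞ G M]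

/-- Affine coordinates on a submanifold of `G` through `1`. -/
def affineMap (n : ℕ) (G : Type*) [TopologicalSpace G] [ChartedSpace (EuclideanSpace ℝ (Fin n)) G]
    [Group G] {V : Type*} [NormedAddCommGroup V] [NormedSpace ℝ V] (σ : V →L[ℝ] Eu n) (x : V) : G :=
  (chartAt (Eu n) (1 : G)).symm (chartOne n G + σ x)

section
variable {V : Type*} [NormedAddCommGroup V] [NormedSpace ℝ V] (σ : V →L[ℝ] Eu n)

/-- The domain of `affineMap`. -/
def affineDom (n : ℕ) (G : Type*) [TopologicalSpace G] [ChartedSpace (EuclideanSpace ℝ (Fin n)) G]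
    [Group G] {V : Type*} [NormedAddCommGroup V] [NormedSpace ℝ V] (σ : V →L[ℝ] Eu n) : Set V :=
  {x | chartOne n G + σ x ∈ (chartAt (Eu n) (1 : G)).target}

theorem isOpen_affineDom : IsOpen (affineDom n G σ) :=
  (chartAt (Eu n) (1 : G)).open_target.preimage (by fun_prop)

theorem zero_mem_affineDom : (0 : V) ∈ affineDom n G σ := by
  simpa [affineDom] using chartOne_mem (n := n) (G := G)

theorem affineMap_zero : affineMap n G σ 0 = 1 := by
  simp [affineMap, chart_symm_chartOne]

theorem contMDiffAt_affineMap {x : V} (hx : x ∈ affineDom n G σ) :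
    ContMDiffAt 𝓘(ℝ, V) (𝓡 n) ∞ (affineMap n G σ) x := by
  refine ContMDiffAt.comp x (contMDiffAt_chart_symm hx) ?_
  exact (contDiff_const.add σ.contDiff).contMDiff.contMDiffAt

theorem hasD_affineMap : HasD 𝓘(ℝ, V) (𝓡 n) (affineMap n G σ) 0 σ := by
  have h1 : HasD 𝓘(ℝ, V) 𝓘(ℝ, Eu n) (fun x => chartOne n G + σ x) 0 σ :=
    hasD_iff_hasFDerivAt.2 (σ.hasFDerivAt.const_add _)
  have h := (hasD_chart_symm_self (1 : G)).comp h1 (by simp [chartOne])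
  rw [ContinuousLinearMap.id_comp] at h
  exact h

end

/-- The orbit map is a submersion at `1` and has a smooth local section. -/
theorem exists_local_section {p : M} (hsub : Function.Surjective (dO n d G p)) :
    ∃ (U : Set M) (s : M → G), IsOpen U ∧ p ∈ U ∧ ContMDiffOn (𝓡 d) (𝓡 n) ∞ s U ∧ s p = 1 ∧
      ∀ q ∈ U, s q • p = q := by
  -- A linear right inverse `σ` of `dO` gives the slice `x ↦ affineMap σ x • p`, with differential
  -- the identity at `0`. The section is `affineMap σ` after the local inverse of this slice.
  obtain ⟨σ₀, hσ₀⟩ := (dO n d G p).toLinearMap.exists_rightInverse_of_surjective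
    (LinearMap.range_eq_top.2 hsub)
  set σ : Eu d →L[ℝ] Eu n := LinearMap.toContinuousLinearMap σ₀ with hσ
  have hσ1 : (dO n d G p).comp σ = .id ℝ _ := by
    ext1 v
    exact congrArg (fun L => L v) hσ₀
  set c := chartAt (Eu d) p with hc
  set g : Eu d → M := fun x => affineMap n G σ x • p with hg
  have hg0 : g 0 = p := by simp [hg, affineMap_zero]
  have hgs : ∀ x ∈ affineDom n G σ, ContMDiffAt 𝓘(ℝ, Eu d) (𝓡 d) ∞ g x := fun x hx =>
    (contMDiffAt_affineMap σ hx).smul contMDiffAt_const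
  have hgD : HasD 𝓘(ℝ, Eu d) (𝓡 d) g 0 (.id ℝ _) := by
    have := (hasD_dO (d := d) (G := G) p).comp (hasD_affineMap (G := G) σ) (affineMap_zero σ)
    rwa [hσ1] at this
  have hUopen : IsOpen (affineDom n G σ ∩ g ⁻¹' c.source) := by
    refine ContinuousOn.isOpen_inter_preimage (fun x hx => ?_) (isOpen_affineDom σ) c.open_source
    exact (hgs x hx).continuousAt.continuousWithinAt
  have hsm : ContDiffOn ℝ ∞ (fun x => c (g x)) (affineDom n G σ ∩ g ⁻¹' c.source) := fun x hx =>
    (ContMDiffAt.comp x (contMDiffAt_chart hx.2) (hgs x hx.1)).contDiffAt.contDiffWithinAt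
  have hD : HasFDerivAt (fun x => c (g x)) ((ContinuousLinearEquiv.refl ℝ (Eu d) :
      Eu d ≃L[ℝ] Eu d) : Eu d →L[ℝ] Eu d) 0 := hasD_iff_hasFDerivAt.1 (hgD.chart hg0)
  have h0 : (0 : Eu d) ∈ affineDom n G σ ∩ g ⁻¹' c.source :=
    ⟨zero_mem_affineDom σ, by
      change g 0 ∈ c.source
      rw [hg0]
      exact mem_chart_source _ p⟩
  obtain ⟨φ, hφ0, hφU, hφ, hφs⟩ := exists_openPartialHomeomorph hUopen hsm h0 hD
  have hφp : φ 0 = c p := by rw [hφ, hg0]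
  refine ⟨c.source ∩ c ⁻¹' φ.target, fun q => affineMap n G σ (φ.symm (c q)),
    c.isOpen_inter_preimage φ.open_target, ⟨mem_chart_source _ p, ?_⟩, ?_, ?_, ?_⟩
  · change c p ∈ φ.target
    rw [← hφp]
    exact φ.map_source hφ0
  · intro q hq
    refine ContMDiffAt.contMDiffWithinAt ?_
    have h1 : ContMDiffAt (𝓡 d) 𝓘(ℝ, Eu d) ∞ (fun q => φ.symm (c q)) q :=
      ContMDiffAt.comp q (hφs.contDiffAt (φ.open_target.mem_nhds hq.2)).contMDiffAt
        (contMDiffAt_chart hq.1)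
    exact ContMDiffAt.comp (g := affineMap n G σ) (f := fun q => φ.symm (c q)) q
      (contMDiffAt_affineMap σ (hφU (φ.map_target hq.2)).1) h1
  · change affineMap n G σ (φ.symm (c p)) = 1
    rw [← hφp, φ.left_inv hφ0, affineMap_zero]
  · intro q hq
    have h1 := φ.right_inv hq.2
    rw [hφ] at h1
    exact c.injOn (hφU (φ.map_target hq.2)).2 hq.1 h1

end Section

/-! ### The differential of a chart on the tangent bundle -/

section ChartD
variable {d : ℕ} {M : Type*} [TopologicalSpace M] [ChartedSpace (EuclideanSpace ℝ (Fin d)) M]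
  [IsManifold (𝓡 d) ∞ M]

/-- The differential at `q` of the preferred chart at `p`. -/
def chartD (d : ℕ) {M : Type*} [TopologicalSpace M] [ChartedSpace (EuclideanSpace ℝ (Fin d)) M]
    (p q : M) : Eu d →L[ℝ] Eu d :=
  mfderiv (𝓡 d) 𝓘(ℝ, Eu d) (chartAt (Eu d) p) q

theorem hasD_chartD {p q : M} (hq : q ∈ (chartAt (Eu d) p).source) :
    HasD (𝓡 d) 𝓘(ℝ, Eu d) (chartAt (Eu d) p) q (chartD d p q) :=
  hasD_of_mdifferentiableAt ((contMDiffAt_chart hq).mdifferentiableAt (by simp))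

theorem contMDiffAt_chartD {p : M} {v : TangentBundle (𝓡 d) M}
    (hv : v.1 ∈ (chartAt (Eu d) p).source) :
    ContMDiffAt (𝓡 d).tangent 𝓘(ℝ, Eu d) ∞
      (fun v : TangentBundle (𝓡 d) M => chartD d p v.1 v.2) v := by
  have h := (contMDiffOn_chart (I := 𝓡 d) (n := ∞) (x := p)).contMDiffOn_tangentMapWithin
    (m := ∞) (by simp) (chartAt (Eu d) p).open_source.uniqueMDiffOn
  have hopen : IsOpen (Bundle.TotalSpace.proj (F := Eu d) (E := TangentSpace (𝓡 d) (M := M)) ⁻¹'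
      (chartAt (Eu d) p).source) :=
    (chartAt (Eu d) p).open_source.preimage (FiberBundle.continuous_proj _ _)
  have h1 := h.contMDiffAt (hopen.mem_nhds hv)
  have h2 := (contMDiff_snd_tangentBundle_modelSpace (n := ∞) (Eu d) 𝓘(ℝ, Eu d)).contMDiffAt.comp v h1
  refine h2.congr_of_eventuallyEq ?_
  filter_upwards [hopen.mem_nhds hv] with w hw
  have h3 := mfderivWithin_of_isOpen (I := 𝓡 d) (I' := 𝓘(ℝ, Eu d))
    (f := chartAt (Eu d) p) (chartAt (Eu d) p).open_source (x := w.1) hw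
  exact (congrArg (fun L => L w.2) h3).symm

end ChartD

/-! ### Smoothness of invariant functions -/

section Smooth
variable {n d : ℕ}
  {G : Type*} [TopologicalSpace G] [ChartedSpace (EuclideanSpace ℝ (Fin n)) G] [Group G]
  [LieGroup (𝓡 n) ∞ G]
  {M : Type*} [TopologicalSpace M] [ChartedSpace (EuclideanSpace ℝ (Fin d)) M]
  [IsManifold (𝓡 d) ∞ M] [MulAction G M] [ContMDiffSMul (𝓡 n) (𝓡 d) ∞ G M]

theorem exists_local_section_at [MulAction.IsPretransitive G M] {p : M}
    (hsub : Function.Surjective (dO n d G p)) (q₀ : M) :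
    ∃ (U : Set M) (s : M → G), IsOpen U ∧ q₀ ∈ U ∧ ContMDiffOn (𝓡 d) (𝓡 n) ∞ s U ∧
      ∀ q ∈ U, s q • p = q := by
  obtain ⟨U, s, hU, hpU, hs, -, hsp⟩ := exists_local_section hsub
  obtain ⟨g, hg⟩ := MulAction.exists_smul_eq G p q₀
  have hc : ContMDiff (𝓡 d) (𝓡 d) ∞ (fun q : M => g⁻¹ • q) :=
    ContMDiffSMul.contMDiff_const_smul (I := 𝓡 n) (n := ∞) g⁻¹
  refine ⟨(fun q : M => g⁻¹ • q) ⁻¹' U, fun q => g * s (g⁻¹ • q), hU.preimage hc.continuous, ?_, ?_, ?_⟩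
  · simpa [← hg] using hpU
  · intro q hq
    have h1 : ContMDiffAt (𝓡 d) (𝓡 n) ∞ (fun q : M => s (g⁻¹ • q)) q :=
      ContMDiffAt.comp (g := s) (f := fun q : M => g⁻¹ • q) q (hs.contMDiffAt (hU.mem_nhds hq))
        hc.contMDiffAt
    exact (contMDiffAt_const.mul h1).contMDiffWithinAt
  · intro q hq
    rw [mul_smul, hsp _ hq, smul_inv_smul]

/-- An invariant function on the tangent bundle is smooth off the zero section as soon as its
restriction to one tangent space is smooth off zero. -/
theorem contMDiffOn_of_funInv [MulAction.IsPretransitive G M] {p : M}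
    (hsub : Function.Surjective (dO n d G p)) {F : FinslerFun d M} (hinv : FunInv G F)
    (hF : ContDiffOn ℝ ∞ (fE F p) {v | v ≠ 0}) :
    ContMDiffOn (𝓡 d).tangent 𝓘(ℝ, ℝ) ∞
      (fun v : TangentBundle (𝓡 d) M => F v.1 v.2) {v | v.2 ≠ 0} := by
  intro v₀ hv₀
  refine ContMDiffAt.contMDiffWithinAt ?_
  obtain ⟨U, s, hU, hqU, hs, hsp⟩ := exists_local_section_at hsub v₀.1
  set c := chartAt (Eu d) v₀.1 with hc
  have hq0 : v₀.1 ∈ c.source := mem_chart_source _ _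
  have hsi : ∀ q ∈ U, (s q)⁻¹ • q = p := fun q hq => by
    rw [inv_smul_eq_iff, hsp q hq]
  -- For `v` over `q`, invariance says that `F v` is the value at `p` of `F` on the image of `v`
  -- under the translation by `(s q)⁻¹`. The differential of this translation is the derivative in
  -- `x` of `f v x`, which is jointly smooth, so it depends smoothly on `v`.
  set f : TangentBundle (𝓡 d) M → Eu d → Eu d := fun v x =>
    chartAt (Eu d) p ((s v.1)⁻¹ • c.symm x) with hf
  have hproj : ∀ v : TangentBundle (𝓡 d) M, ContMDiffAt (𝓡 d).tangent (𝓡 d) ∞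
      (fun v : TangentBundle (𝓡 d) M => v.1) v := fun v => Bundle.contMDiffAt_proj _
  have hfs : ∀ v : TangentBundle (𝓡 d) M, v.1 ∈ U → v.1 ∈ c.source →
      ContMDiffAt ((𝓡 d).tangent.prod 𝓘(ℝ, Eu d)) 𝓘(ℝ, Eu d) ∞ (Function.uncurry f)
        (v, c v.1) := by
    intro v hvU hvc
    have h1 : ContMDiffAt ((𝓡 d).tangent.prod 𝓘(ℝ, Eu d)) (𝓡 n) ∞
        (fun w : TangentBundle (𝓡 d) M × Eu d => (s w.1.1)⁻¹) (v, c v.1) := by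
      refine ContMDiffAt.inv ?_
      refine ContMDiffAt.comp (g := s) (f := fun w : TangentBundle (𝓡 d) M × Eu d => w.1.1) _
        (hs.contMDiffAt (hU.mem_nhds hvU)) ?_
      exact ContMDiffAt.comp (g := fun v : TangentBundle (𝓡 d) M => v.1)
        (f := fun w : TangentBundle (𝓡 d) M × Eu d => w.1) _ (hproj v) contMDiffAt_fst
    have h2 : ContMDiffAt ((𝓡 d).tangent.prod 𝓘(ℝ, Eu d)) (𝓡 d) ∞
        (fun w : TangentBundle (𝓡 d) M × Eu d => c.symm w.2) (v, c v.1) :=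
      ContMDiffAt.comp (g := c.symm) (f := fun w : TangentBundle (𝓡 d) M × Eu d => w.2) _
        (contMDiffAt_chart_symm (c.map_source hvc)) contMDiffAt_snd
    refine ContMDiffAt.comp (g := chartAt (Eu d) p)
      (f := fun w : TangentBundle (𝓡 d) M × Eu d => (s w.1.1)⁻¹ • c.symm w.2) _
      (contMDiffAt_chart ?_) (h1.smul h2)
    change (s v.1)⁻¹ • c.symm (c v.1) ∈ _
    rw [c.left_inv hvc, hsi _ hvU]
    exact mem_chart_source _ _
  have hW : ContMDiffAt (𝓡 d).tangent 𝓘(ℝ, Eu d) ∞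
      (fun v : TangentBundle (𝓡 d) M => fderiv ℝ (f v) (c v.1) (chartD d v₀.1 v.1 v.2)) v₀ := by
    refine ContMDiffAt.clm_apply ?_ (contMDiffAt_chartD hq0)
    refine contMDiffAt_fderiv_param (hfs v₀ hqU hq0) ?_
    exact ContMDiffAt.comp (g := c) (f := fun v : TangentBundle (𝓡 d) M => v.1) _
      (contMDiffAt_chart hq0) (hproj v₀)
  have hWeq : ∀ v : TangentBundle (𝓡 d) M, v.1 ∈ U → v.1 ∈ c.source →
      fderiv ℝ (f v) (c v.1) (chartD d v₀.1 v.1 v.2) = dT d (s v.1)⁻¹ v.1 v.2 := by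
    intro v hvU hvc
    have h1 : HasD 𝓘(ℝ, Eu d) 𝓘(ℝ, Eu d) (f v) (c v.1) (fderiv ℝ (f v) (c v.1)) := by
      refine hasD_iff_hasFDerivAt.2 (DifferentiableAt.hasFDerivAt ?_)
      have h2 : ContMDiffAt 𝓘(ℝ, Eu d) 𝓘(ℝ, Eu d) ∞ (f v) (c v.1) :=
        ContMDiffAt.comp (g := Function.uncurry f) (f := fun x : Eu d => (v, x)) _
          (hfs v hvU hvc) (contMDiffAt_const.prodMk contMDiffAt_id)
      exact h2.contDiffAt.differentiableAt (by simp)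
    have h3 := h1.comp (hasD_chartD (d := d) hvc) rfl
    have h4 := (hasD_dT (n := n) (d := d) (s v.1)⁻¹ v.1).chart (hsi _ hvU)
    have h5 := h3.congr (g := fun q => chartAt (Eu d) p ((s v.1)⁻¹ • q)) (by
      filter_upwards [c.open_source.mem_nhds hvc] with q hq
      change _ = chartAt (Eu d) p ((s v.1)⁻¹ • c.symm (c q))
      rw [c.left_inv hq])
    exact congrArg (fun L => L v.2) (h5.unique h4)
  have hnear : ∀ᶠ v : TangentBundle (𝓡 d) M in 𝓝 v₀, v.1 ∈ U ∧ v.1 ∈ c.source :=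
    (hproj v₀).continuousAt.eventually
      (Filter.inter_mem (hU.mem_nhds hqU) (c.open_source.mem_nhds hq0))
  have hFW : ContMDiffAt (𝓡 d).tangent 𝓘(ℝ, ℝ) ∞
      (fun v : TangentBundle (𝓡 d) M =>
        fE F p (fderiv ℝ (f v) (c v.1) (chartD d v₀.1 v.1 v.2))) v₀ := by
    refine ContMDiffAt.comp (g := fE F p) v₀ (ContDiffAt.contMDiffAt ?_) hW
    refine hF.contDiffAt (isOpen_ne.mem_nhds ?_)
    rw [hWeq v₀ hqU hq0]
    intro h0
    have h1 := dT_inv_dT (n := n) (d := d) (s v₀.1)⁻¹ v₀.1 v₀.2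
    rw [h0, map_zero] at h1
    exact hv₀ h1.symm
  refine hFW.congr_of_eventuallyEq ?_
  filter_upwards [hnear] with v hv
  rw [hWeq v hv.1 hv.2]
  have h1 := hinv (s v.1)⁻¹ v.1 v.2
  rw [hsi _ hv.1] at h1
  exact h1.symm

end Smooth

/-! ### First variation of an action at a constant curve -/

section FirstVariation

/-- `W` need not contain a strip around the whole line `{0} × ℝ`, but by the tube lemma it contains
one around `{0} × [a, b]`. Compactness then bounds the derivative of the integrand, and one
differentiates under the integral sign. -/
theorem hasDerivAt_integral_of_contDiffOn {E : ℝ × ℝ → ℝ} {W : Set (ℝ × ℝ)} (hW : IsOpen W)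
    (hE : ContDiffOn ℝ ∞ E W) {a b : ℝ} (hab : a ≤ b) (h0 : ∀ t, ((0 : ℝ), t) ∈ W) :
    HasDerivAt (fun r => ∫ t in a..b, E (r, t)) (∫ t in a..b, fderiv ℝ E (0, t) (1, 0)) 0 := by
  obtain ⟨U, V, hU, hV, h0U, hV', hUV⟩ := generalized_tube_lemma (isCompact_singleton (x := (0 : ℝ)))
    (isCompact_Icc (a := a) (b := b)) hW (by
      rintro ⟨r, t⟩ ⟨hr, -⟩
      obtain rfl : r = 0 := hr
      exact h0 t)
  obtain ⟨ε, hε, hεU⟩ := Metric.nhds_basis_closedBall.mem_iff.1 (hU.mem_nhds (h0U rfl))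
  have hsub : Metric.closedBall (0 : ℝ) ε ×ˢ Set.Icc a b ⊆ W :=
    (Set.prod_mono hεU hV').trans hUV
  have hcd : ContinuousOn (fderiv ℝ E) W := hE.continuousOn_fderiv_of_isOpen hW (by simp)
  have hcD : ContinuousOn (fun z => fderiv ℝ E z (1, 0)) W := hcd.clm_apply continuousOn_const
  obtain ⟨C, hC⟩ := ((isCompact_closedBall (0 : ℝ) ε).prod (isCompact_Icc (a := a) (b := b))).exists_bound_of_continuousOn
    (hcD.mono hsub)
  have hE' : ∀ r t, (r, t) ∈ W → HasDerivAt (fun r => E (r, t)) (fderiv ℝ E (r, t) (1, 0)) r := by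
    intro r t hrt
    have h1 : HasFDerivAt E (fderiv ℝ E (r, t)) (r, t) :=
      ((hE.contDiffAt (hW.mem_nhds hrt)).differentiableAt (by simp)).hasFDerivAt
    have h2 := (h1.comp (f := fun r : ℝ => (r, t)) r (hasFDerivAt_prodMk_left r t)).hasDerivAt
    exact h2.congr_deriv (by simp)
  have hball : Metric.ball (0 : ℝ) ε ∈ 𝓝 (0 : ℝ) := Metric.ball_mem_nhds _ hε
  have hcont : ∀ r ∈ Metric.ball (0 : ℝ) ε, ContinuousOn (fun t => E (r, t)) (Set.Icc a b) := by
    intro r hr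
    refine hE.continuousOn.comp (by fun_prop) fun t ht => hsub ⟨Metric.ball_subset_closedBall hr, ht⟩
  have hI : Set.uIoc a b ⊆ Set.Icc a b := by
    rw [Set.uIoc_of_le hab]
    exact Set.Ioc_subset_Icc_self
  refine (intervalIntegral.hasDerivAt_integral_of_dominated_loc_of_deriv_le (bound := fun _ => C)
    (F := fun r t => E (r, t)) (F' := fun r t => fderiv ℝ E (r, t) (1, 0))
    hball ?_ ?_ ?_ ?_ ?_ ?_).2
  · filter_upwards [hball] with r hr
    exact ((hcont r hr).mono hI).aestronglyMeasurable measurableSet_uIoc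
  · exact ContinuousOn.intervalIntegrable (by
      rw [Set.uIcc_of_le hab]
      exact hcont 0 (Metric.mem_ball_self hε))
  · refine ContinuousOn.aestronglyMeasurable ?_ measurableSet_uIoc
    exact hcD.comp (by fun_prop) fun t _ => h0 t
  · exact .of_forall fun t ht r hr => hC (r, t) ⟨Metric.ball_subset_closedBall hr, hI ht⟩
  · exact intervalIntegrable_const
  · exact .of_forall fun t ht r hr => hE' r t (hsub ⟨Metric.ball_subset_closedBall hr, hI ht⟩)

/-- First variation of the functional with Lagrangian `R` at a constant curve. -/
theorem hasDerivAt_action {V : Type*} [NormedAddCommGroup V] [NormedSpace ℝ V] [CompleteSpace V]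
    {κ : ℝ × ℝ → V} {W : Set (ℝ × ℝ)} (hW : IsOpen W) (hκ : ContDiffOn ℝ ∞ κ W) {a b : ℝ}
    (hab : a ≤ b) (h0 : ∀ t, ((0 : ℝ), t) ∈ W) {o : V} (hκ0 : ∀ t, κ (0, t) = o)
    {R : V × V → ℝ} {O : Set (V × V)} (hO : IsOpen O) (hR : ContDiffOn ℝ ∞ R O)
    (hoO : (o, (0 : V)) ∈ O) (hζa : fderiv ℝ κ (0, a) (1, 0) = 0)
    (hζb : fderiv ℝ κ (0, b) (1, 0) = 0) :
    HasDerivAt (fun r => ∫ t in a..b, R (κ (r, t), fderiv ℝ κ (r, t) (0, 1)))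
      (∫ t in a..b, fderiv ℝ R (o, 0) (fderiv ℝ κ (0, t) (1, 0), 0)) 0 := by
  have hdκ : ContDiffOn ℝ ∞ (fderiv ℝ κ) W := hκ.fderiv_of_isOpen hW (by simp)
  have hdκv : ∀ v, ContDiffOn ℝ ∞ (fun z => fderiv ℝ κ z v) W := fun v =>
    hdκ.clm_apply contDiffOn_const
  set P : ℝ × ℝ → V × V := fun z => (κ z, fderiv ℝ κ z (0, 1)) with hP
  have hPs : ContDiffOn ℝ ∞ P W := hκ.prodMk (hdκv _)
  have hκD : ∀ z ∈ W, HasFDerivAt κ (fderiv ℝ κ z) z := fun z hz =>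
    ((hκ.contDiffAt (hW.mem_nhds hz)).differentiableAt (by simp)).hasFDerivAt
  have hdκD : ∀ z ∈ W, HasFDerivAt (fderiv ℝ κ) (fderiv ℝ (fderiv ℝ κ) z) z := fun z hz =>
    ((hdκ.contDiffAt (hW.mem_nhds hz)).differentiableAt (by simp)).hasFDerivAt
  have hvert : ∀ t, fderiv ℝ κ (0, t) (0, 1) = 0 := by
    intro t
    have h2 := ((hκD _ (h0 t)).comp (f := fun t : ℝ => ((0 : ℝ), t)) t
      (hasFDerivAt_prodMk_right 0 t)).hasDerivAt
    have h3 := h2.unique ((hasDerivAt_const t o).congr_of_eventuallyEq (.of_forall hκ0))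
    simpa using h3
  have hP0 : ∀ t, P (0, t) = (o, 0) := fun t => by simp [hP, hκ0, hvert]
  have hW1 : IsOpen (W ∩ P ⁻¹' O) := hPs.continuousOn.isOpen_inter_preimage hW hO
  have h01 : ∀ t, ((0 : ℝ), t) ∈ W ∩ P ⁻¹' O := fun t =>
    ⟨h0 t, by rw [Set.mem_preimage, hP0]; exact hoO⟩
  have hE : ContDiffOn ℝ ∞ (fun z => R (P z)) (W ∩ P ⁻¹' O) :=
    hR.comp (hPs.mono Set.inter_subset_left) fun z hz => hz.2
  have hmain := hasDerivAt_integral_of_contDiffOn hW1 hE hab h01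
  have hRD : HasFDerivAt R (fderiv ℝ R (o, 0)) (o, 0) :=
    ((hR.contDiffAt (hO.mem_nhds hoO)).differentiableAt (by simp)).hasFDerivAt
  set ζ : ℝ → V := fun t => fderiv ℝ κ (0, t) (1, 0) with hζ
  set ζ' : ℝ → V := fun t => fderiv ℝ (fderiv ℝ κ) (0, t) (0, 1) (1, 0) with hζ'
  have hζD : ∀ t, HasDerivAt ζ (ζ' t) t := by
    intro t
    have h2 := ((hdκD _ (h0 t)).comp (f := fun t : ℝ => ((0 : ℝ), t)) t
      (hasFDerivAt_prodMk_right 0 t)).hasDerivAt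
    have h3 := h2.clm_apply (hasDerivAt_const t ((1 : ℝ), (0 : ℝ)))
    refine h3.congr_deriv ?_
    simp [hζ']
  have hline : Continuous (fun t : ℝ => ((0 : ℝ), t)) := by fun_prop
  have hζc : Continuous ζ := continuous_iff_continuousAt.2 fun t => (hζD t).continuousAt
  have hζ'c : Continuous ζ' := by
    have h1 : ContinuousOn (fderiv ℝ (fderiv ℝ κ)) W :=
      hdκ.continuousOn_fderiv_of_isOpen hW (by simp)
    have h2 : Continuous (fun t : ℝ => fderiv ℝ (fderiv ℝ κ) (0, t)) := h1.comp_continuous hline h0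
    exact (h2.clm_apply continuous_const).clm_apply continuous_const
  -- The variation has a term in `ζ` and one in `ζ'`. As the base curve is constant, `R` is
  -- differentiated at the fixed point `(o, 0)`, so the second term is the derivative of a linear
  -- function of `ζ`; it integrates to zero because `ζ` vanishes at both ends.
  have hED : ∀ t, fderiv ℝ (fun z => R (P z)) (0, t) (1, 0) =
      fderiv ℝ R (o, 0) (ζ t, 0) + fderiv ℝ R (o, 0) (0, ζ' t) := by
    intro t
    have h1 : HasFDerivAt P ((fderiv ℝ κ (0, t)).prod
        ((fderiv ℝ (fderiv ℝ κ) (0, t)).flip (0, 1))) (0, t) :=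
      (hκD _ (h0 t)).prodMk (by
        have := (hdκD _ (h0 t)).clm_apply (hasFDerivAt_const ((0 : ℝ), (1 : ℝ)) ((0 : ℝ), t))
        simpa using this)
    have h2 : HasFDerivAt (fun z => R (P z)) _ ((0 : ℝ), t) :=
      HasFDerivAt.comp (g := R) (f := P) ((0 : ℝ), t) (by rw [hP0]; exact hRD) h1
    rw [h2.fderiv, ← map_add]
    have hsymm : IsSymmSndFDerivAt ℝ κ (0, t) :=
      (hκ.contDiffAt (hW.mem_nhds (h0 t))).isSymmSndFDerivAt (by simp [ENat.LEInfty.out])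
    have h3 : fderiv ℝ (fderiv ℝ κ) (0, t) (1, 0) (0, 1) = ζ' t := hsymm _ _
    simp [h3, hζ]
  refine hmain.congr_deriv ?_
  simp only [hED]
  rw [intervalIntegral.integral_add]
  · have h1 : ∀ t ∈ Set.uIcc a b, HasDerivAt (fun t => fderiv ℝ R (o, 0) (0, ζ t))
        (fderiv ℝ R (o, 0) (0, ζ' t)) t := by
      intro t _
      exact ((fderiv ℝ R (o, 0)).hasFDerivAt.comp_hasDerivAt t
        ((hasDerivAt_const t (0 : V)).prodMk (hζD t)))
    rw [intervalIntegral.integral_eq_sub_of_hasDerivAt h1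
      (Continuous.intervalIntegrable (by fun_prop) _ _)]
    simp [hζ, hζa, hζb]
  · exact Continuous.intervalIntegrable (by fun_prop) _ _
  · exact Continuous.intervalIntegrable (by fun_prop) _ _

end FirstVariation

/-! ### The energy of variations of an orbit and the criterion for geodesic vectors -/

section Energy
variable {n d : ℕ}
  {G : Type*} [TopologicalSpace G] [ChartedSpace (EuclideanSpace ℝ (Fin n)) G] [Group G]
  [LieGroup (𝓡 n) ∞ G]
  {M : Type*} [TopologicalSpace M] [ChartedSpace (EuclideanSpace ℝ (Fin d)) M]
  [IsManifold (𝓡 d) ∞ M] [MulAction G M] [ContMDiffSMul (𝓡 n) (𝓡 d) ∞ G M]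

/-- The chart at the unit, moved so as to be centered at the point with coordinates `x`. -/
def chartDiff (n : ℕ) (G : Type*) [TopologicalSpace G] [ChartedSpace (EuclideanSpace ℝ (Fin n)) G]
    [Group G] (x z : Eu n) : Eu n :=
  chartAt (Eu n) (1 : G) (((chartAt (Eu n) (1 : G)).symm x)⁻¹ * (chartAt (Eu n) (1 : G)).symm z)

theorem contMDiffAt_chartDiff {x : Eu n} (hx : x ∈ (chartAt (Eu n) (1 : G)).target) :
    ContMDiffAt (𝓘(ℝ, Eu n).prod 𝓘(ℝ, Eu n)) 𝓘(ℝ, Eu n) ∞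
      (Function.uncurry (chartDiff n G)) (x, x) := by
  have h1 : ContMDiffAt (𝓘(ℝ, Eu n).prod 𝓘(ℝ, Eu n)) (𝓡 n) ∞
      (fun w : Eu n × Eu n => ((chartAt (Eu n) (1 : G)).symm w.1)⁻¹) (x, x) :=
    ContMDiffAt.inv (ContMDiffAt.comp (g := (chartAt (Eu n) (1 : G)).symm)
      (f := fun w : Eu n × Eu n => w.1) _ (contMDiffAt_chart_symm hx) contMDiffAt_fst)
  have h2 : ContMDiffAt (𝓘(ℝ, Eu n).prod 𝓘(ℝ, Eu n)) (𝓡 n) ∞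
      (fun w : Eu n × Eu n => (chartAt (Eu n) (1 : G)).symm w.2) (x, x) :=
    ContMDiffAt.comp (g := (chartAt (Eu n) (1 : G)).symm)
      (f := fun w : Eu n × Eu n => w.2) _ (contMDiffAt_chart_symm hx) contMDiffAt_snd
  refine ContMDiffAt.comp (g := chartAt (Eu n) (1 : G)) (f := fun w : Eu n × Eu n =>
    ((chartAt (Eu n) (1 : G)).symm w.1)⁻¹ * (chartAt (Eu n) (1 : G)).symm w.2) _
    (contMDiffAt_chart ?_) (h1.mul h2)
  simp [mem_chart_source]

/-- The left logarithmic derivative in coordinates. -/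
def chartLD (n : ℕ) (G : Type*) [TopologicalSpace G] [ChartedSpace (EuclideanSpace ℝ (Fin n)) G]
    [Group G] (x : Eu n) : Eu n →L[ℝ] Eu n :=
  fderiv ℝ (chartDiff n G x) x

theorem contDiffOn_chartLD :
    ContDiffOn ℝ ∞ (chartLD n G) (chartAt (Eu n) (1 : G)).target := by
  intro x hx
  have h := contMDiffAt_fderiv_param (contMDiffAt_chartDiff (G := G) hx)
    (g := fun x => x) contMDiffAt_id
  exact h.contDiffAt.contDiffWithinAt

/-- Read in the chart, `z ↦ (f y)⁻¹ * f z` is `chartDiff` based at the coordinates of `f y`, applied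
to the coordinates of `f z`. So `chartLD`, which is smooth in the point, converts coordinate
velocities into logarithmic ones. -/
theorem hasLD_chartLD {E : Type*} [NormedAddCommGroup E] [NormedSpace ℝ E]
    {H : Type*} [TopologicalSpace H] {I : ModelWithCorners ℝ E H}
    {N : Type*} [TopologicalSpace N] [ChartedSpace H N] {f : N → G} {y : N} {L D : E →L[ℝ] Eu n}
    (hf : HasLD n I f y L) (hc : ContinuousAt f y)
    (hy : f y ∈ (chartAt (Eu n) (1 : G)).source)
    (hD : HasD I 𝓘(ℝ, Eu n) (fun z => chartAt (Eu n) (1 : G) (f z)) y D) :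
    L = (chartLD n G (chartAt (Eu n) (1 : G) (f y))).comp D := by
  set e := chartAt (Eu n) (1 : G) with he
  have hx := e.map_source hy
  have h1 : HasD I 𝓘(ℝ, Eu n) (fun z => e ((f y)⁻¹ * f z)) y L := HasD.chart hf (by simp)
  have h2 : ContMDiffAt 𝓘(ℝ, Eu n) 𝓘(ℝ, Eu n) ∞ (chartDiff n G (e (f y))) (e (f y)) :=
    ContMDiffAt.comp (g := Function.uncurry (chartDiff n G)) (f := fun x : Eu n => (e (f y), x)) _
      (contMDiffAt_chartDiff hx) (contMDiffAt_const.prodMk contMDiffAt_id)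
  have h3 : HasD 𝓘(ℝ, Eu n) 𝓘(ℝ, Eu n) (chartDiff n G (e (f y))) (e (f y))
      (chartLD n G (e (f y))) :=
    hasD_iff_hasFDerivAt.2 (h2.contDiffAt.differentiableAt (by simp)).hasFDerivAt
  refine h1.unique ((h3.comp hD rfl).congr ?_)
  filter_upwards [hc.eventually (e.open_source.mem_nhds hy)] with z hz
  change e ((f y)⁻¹ * f z) = e ((e.symm (e (f y)))⁻¹ * e.symm (e (f z)))
  rw [e.left_inv hy, e.left_inv hz]

variable [T2Space G] [T2Space M]

/-- The Lagrangian of an invariant function, in the coordinates given by the group. -/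
def lagr (G : Type*) [TopologicalSpace G] [ChartedSpace (EuclideanSpace ℝ (Fin n)) G] [Group G]
    [MulAction G M] (F : FinslerFun d M) (p : M) (X : Eu n) (w : Eu n × Eu n) : ℝ :=
  fE F p (dO n d G p (AdE n ((chartAt (Eu n) (1 : G)).symm w.1)⁻¹ X + chartLD n G w.1 w.2)) ^ 2

omit [T2Space G] [T2Space M] [IsManifold (𝓡 d) ∞ M] [ContMDiffSMul (𝓡 n) (𝓡 d) ∞ G M] in
theorem contDiffOn_lagr_arg (X : Eu n) : ContDiffOn ℝ ∞
    (fun w : Eu n × Eu n => AdE n ((chartAt (Eu n) (1 : G)).symm w.1)⁻¹ X + chartLD n G w.1 w.2)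
    {w | w.1 ∈ (chartAt (Eu n) (1 : G)).target} := by
  intro w hw
  have h1 : ContMDiffAt 𝓘(ℝ, Eu n) 𝓘(ℝ, Eu n) ∞
      (fun x => AdE n ((chartAt (Eu n) (1 : G)).symm x)⁻¹ X) w.1 :=
    ContMDiffAt.comp (g := fun g : G => AdE n g X)
      (f := fun x => ((chartAt (Eu n) (1 : G)).symm x)⁻¹) w.1
      (contMDiff_AdE_apply X).contMDiffAt (contMDiffAt_chart_symm hw).inv
  have h2 : ContDiffAt ℝ ∞ (chartLD n G) w.1 :=
    contDiffOn_chartLD.contDiffAt ((chartAt (Eu n) (1 : G)).open_target.mem_nhds hw)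
  exact ((h1.contDiffAt.comp (f := fun w : Eu n × Eu n => w.1) w contDiffAt_fst).add
    ((h2.comp (f := fun w : Eu n × Eu n => w.1) w contDiffAt_fst).clm_apply
      contDiffAt_snd)).contDiffWithinAt

/-- The variation is `Γ = γ k p` with `k = 1` at `r = 0`. Its velocity is the translate by `γ k` of
`dO (Ad k⁻¹ X + k⁻¹ k')`, and invariance of `F` removes the translation. In the chart at `1` the
energy becomes the action of the time-independent Lagrangian `lagr` near a constant curve, so
`hasDerivAt_action` applies; the derivative of `Ad k⁻¹ X` in the direction `ζ` is `[X, ζ]`. -/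
theorem hasDerivAt_energy {F : FinslerFun d M} (hinv : FunInv G F) {p : M}
    (hF : ContDiffOn ℝ ∞ (fE F p) {v | v ≠ 0}) {γ : ℝ → G} {X : Eu n} (hγ : IsOneParam γ X)
    (hX : dO n d G p X ≠ 0) {W : Set (ℝ × ℝ)} (hW : IsOpen W) {k : ℝ × ℝ → G}
    (hk : ContMDiffOn 𝓘(ℝ, ℝ × ℝ) (𝓡 n) ∞ k W) (h0 : ∀ t, ((0 : ℝ), t) ∈ W)
    (hk0 : ∀ t, k (0, t) = 1) {Γ : ℝ × ℝ → M} (hΓ : ∀ z ∈ W, (γ z.2 * k z) • p = Γ z)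
    {a b : ℝ} (hab : a ≤ b) {ζ : ℝ → Eu n}
    (hζ : ∀ t, HasD 𝓘(ℝ, ℝ) (𝓡 n) (fun r => k (r, t)) 0 ((1 : ℝ →L[ℝ] ℝ).smulRight (ζ t)))
    (hζa : ζ a = 0) (hζb : ζ b = 0) :
    HasDerivAt (fun r : ℝ => ∫ t in a..b, F (Γ (r, t)) (velocity (fun u => Γ (r, u)) t) ^ 2)
      (∫ t in a..b, fderiv ℝ (fun v => fE F p v ^ 2) (dO n d G p X)
        (dO n d G p (brE n G X (ζ t)))) 0 := by
  set e := chartAt (Eu n) (1 : G) with he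
  set o := chartOne n G with ho
  set κ : ℝ × ℝ → Eu n := fun z => e (k z) with hκ
  set W' := W ∩ k ⁻¹' e.source with hW'
  have hW'o : IsOpen W' := hk.continuousOn.isOpen_inter_preimage hW e.open_source
  have h0' : ∀ t, ((0 : ℝ), t) ∈ W' := fun t => ⟨h0 t, by
    rw [Set.mem_preimage, hk0]
    exact mem_chart_source _ _⟩
  have hks : ∀ z ∈ W', ContMDiffAt 𝓘(ℝ, ℝ × ℝ) (𝓡 n) ∞ k z := fun z hz =>
    hk.contMDiffAt (hW.mem_nhds hz.1)
  have hκs : ContDiffOn ℝ ∞ κ W' := fun z hz =>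
    (ContMDiffAt.comp (g := e) (f := k) z (contMDiffAt_chart hz.2)
      (hks z hz)).contDiffAt.contDiffWithinAt
  have hκ0 : ∀ t, κ (0, t) = o := fun t => by simp only [hκ, hk0]; rfl
  have hκD : ∀ z ∈ W', HasFDerivAt κ (fderiv ℝ κ z) z := fun z hz =>
    ((hκs.contDiffAt (hW'o.mem_nhds hz)).differentiableAt (by simp)).hasFDerivAt
  have hζκ : ∀ t, fderiv ℝ κ (0, t) (1, 0) = ζ t := by
    intro t
    have h1 := hasD_iff_hasFDerivAt.1 ((hζ t).chart (hk0 t))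
    have h2 := (hκD _ (h0' t)).comp (f := fun r : ℝ => (r, t)) (0 : ℝ)
      (hasFDerivAt_prodMk_left 0 t)
    have h3 := congrArg (fun L : ℝ →L[ℝ] Eu n => L 1) (h2.unique h1)
    simpa using h3
  set P : Eu n × Eu n → Eu n := fun w => AdE n (e.symm w.1)⁻¹ X + chartLD n G w.1 w.2 with hP
  have hPs := contDiffOn_lagr_arg (G := G) X
  have hTo : IsOpen {w : Eu n × Eu n | w.1 ∈ e.target} := e.open_target.preimage continuous_fst
  set O : Set (Eu n × Eu n) := {w | w.1 ∈ e.target} ∩ P ⁻¹' {x | dO n d G p x ≠ 0} with hO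
  have hOo : IsOpen O := hPs.continuousOn.isOpen_inter_preimage hTo
    (isOpen_ne.preimage (dO n d G p).continuous)
  have hP0 : ∀ x, P (x, 0) = AdE n (e.symm x)⁻¹ X := fun x => by simp [hP]
  have hPo : P (o, 0) = X := by
    rw [hP0, chart_symm_chartOne, inv_one, AdE_one]; rfl
  have hoO : (o, (0 : Eu n)) ∈ O := ⟨chartOne_mem, by
    rw [Set.mem_preimage, hPo]; exact hX⟩
  have hRs : ContDiffOn ℝ ∞ (lagr G F p X) O := by
    have h1 : ContDiffOn ℝ ∞ (fun w => dO n d G p (P w)) O :=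
      (dO n d G p).contDiff.comp_contDiffOn (hPs.mono Set.inter_subset_left)
    exact (hF.comp h1 fun w hw => hw.2).pow 2
  have hmain := hasDerivAt_action hW'o hκs hab h0' hκ0 hOo hRs hoO
    (by rw [hζκ, hζa]) (by rw [hζκ, hζb])
  have hder : ∀ w, fderiv ℝ (lagr G F p X) (o, 0) (w, 0) =
      fderiv ℝ (fun v => fE F p v ^ 2) (dO n d G p X) (dO n d G p (brE n G X w)) := by
    intro w
    have h1 : HasFDerivAt (lagr G F p X) (fderiv ℝ (lagr G F p X) (o, 0)) (o, 0) :=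
      ((hRs.contDiffAt (hOo.mem_nhds hoO)).differentiableAt (by simp)).hasFDerivAt
    have h2 := h1.comp (f := fun x : Eu n => (x, (0 : Eu n))) o (hasFDerivAt_prodMk_left o 0)
    obtain ⟨A, hA, hAw⟩ := hasD_AdE_apply (G := G) X
    have h3 : HasD 𝓘(ℝ, Eu n) (𝓡 n) (fun x => (e.symm x)⁻¹) o (-(.id ℝ _)) := by
      obtain ⟨D, hD⟩ : ∃ D : Eu n →L[ℝ] Eu n, HasD 𝓘(ℝ, Eu n) (𝓡 n) (fun x => (e.symm x)⁻¹) o D :=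
        ⟨_, hasD_of_mdifferentiableAt
          ((contMDiffAt_chart_symm (M := G) chartOne_mem).inv.mdifferentiableAt (n := ∞) (by simp))⟩
      have h4 : HasD 𝓘(ℝ, Eu n) (𝓡 n) e.symm o (.id ℝ _) := hasD_chart_symm_self (1 : G)
      have h5 := h4.mul_of_one hD chart_symm_chartOne
        (by rw [chart_symm_chartOne, inv_one])
      have h6 := h5.unique ((hasD_const o (1 : G)).congr (.of_forall fun x => by simp))
      rw [← eq_neg_of_add_eq_zero_right h6]
      exact hD
    have h4 := hA.comp h3 (by rw [chart_symm_chartOne, inv_one])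
    have h5 : HasFDerivAt (fun v => fE F p v ^ 2)
        (fderiv ℝ (fun v => fE F p v ^ 2) (dO n d G p X)) (dO n d G p X) :=
      (((hF.contDiffAt (isOpen_ne.mem_nhds hX)).pow 2).differentiableAt (by simp)).hasFDerivAt
    have h6 := ((dO n d G p).hasFDerivAt.comp o (hasD_iff_hasFDerivAt.1 h4))
    have h7 : HasFDerivAt (fun x => fE F p (dO n d G p (AdE n (e.symm x)⁻¹ X)) ^ 2) _ o :=
      HasFDerivAt.comp (g := fun v => fE F p v ^ 2)
        (f := fun x => dO n d G p (AdE n (e.symm x)⁻¹ X)) o (by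
          rw [chart_symm_chartOne, inv_one, AdE_one]; exact h5) h6
    have h8 := h2.unique (h7.congr_of_eventuallyEq (.of_forall fun x => by
      change fE F p (dO n d G p (P (x, 0))) ^ 2 = _
      rw [hP0]))
    have h9 := congrArg (fun L => L w) h8
    have h10 : brE n G X w = -A w := by rw [hAw]; exact FinslerGO.brE_skew X w
    rw [h10, map_neg, map_neg]
    simpa using h9
  simp only [hζκ, hder] at hmain
  refine hmain.congr_of_eventuallyEq ?_
  obtain ⟨U, V, hU, hV, h0U, hV', hUV⟩ := generalized_tube_lemma (isCompact_singleton (x := (0 : ℝ)))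
    (isCompact_Icc (a := a) (b := b)) hW'o (by
      rintro ⟨r, t⟩ ⟨hr, -⟩
      obtain rfl : r = 0 := hr
      exact h0' t)
  filter_upwards [hU.mem_nhds (h0U rfl)] with r hr
  refine intervalIntegral.integral_congr fun t ht => ?_
  rw [Set.uIcc_of_le hab] at ht
  have hrt : (r, t) ∈ W' := hUV ⟨hr, hV' ht⟩
  have hline : ContMDiff 𝓘(ℝ, ℝ) 𝓘(ℝ, ℝ × ℝ) ∞ (fun u : ℝ => (r, u)) :=
    (contDiff_const.prodMk contDiff_id).contMDiff
  have hkr : ContMDiffAt 𝓘(ℝ, ℝ) (𝓡 n) ∞ (fun u => k (r, u)) t :=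
    ContMDiffAt.comp (g := k) (f := fun u : ℝ => (r, u)) t (hks _ hrt) hline.contMDiffAt
  obtain ⟨L, hL⟩ := exists_hasLD (n := n) (hkr.mdifferentiableAt (by simp))
  have hDκ := (hκD _ hrt).comp (f := fun u : ℝ => (r, u)) t (hasFDerivAt_prodMk_right r t)
  have hLeq := hasLD_chartLD hL hkr.continuousAt hrt.2 (hasD_iff_hasFDerivAt.2 hDκ)
  have h1 := ((hγ.hasLD t).mul hL).smul (d := d) p
  have h2 := h1.congr (g := fun u => Γ (r, u)) (by
    have : ∀ᶠ u in 𝓝 t, (r, u) ∈ W :=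
      hline.continuous.continuousAt.eventually (hW.mem_nhds hrt.1)
    filter_upwards [this] with u hu
    exact (hΓ _ hu).symm)
  have h3 : velocity (fun u => Γ (r, u)) t = dT d (γ t * k (r, t)) p
      (dO n d G p (P (κ (r, t), fderiv ℝ κ (r, t) (0, 1)))) := by
    refine (congrArg (fun L : ℝ →L[ℝ] Eu d => L 1) h2.mfderiv_eq).trans ?_
    have h4 : e.symm (κ (r, t)) = k (r, t) := e.left_inv hrt.2
    simp [hP, hLeq, h4]
    rfl
  have h4 : F (Γ (r, t)) (velocity (fun u => Γ (r, u)) t) =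
      fE F (Γ (r, t)) (dT d (γ t * k (r, t)) p
        (dO n d G p (P (κ (r, t), fderiv ℝ κ (r, t) (0, 1))))) :=
    congrArg (fE F (Γ (r, t))) h3
  change F (Γ (r, t)) (velocity (fun u => Γ (r, u)) t) ^ 2 = _
  rw [h4, ← hΓ _ hrt.1, hinv]
  rfl

/-- The first variation at the orbit of `exp(tX)` is the integral over time of the differential of
`F²` at `dO X`, applied to `dO [X, ζ]`, and enough fields `ζ` occur to test every `Z`. -/
theorem isGeodesicVector_iff [MulAction.IsPretransitive G M] {F : FinslerFun d M}
    (hinv : FunInv G F) {p : M} (hsub : Function.Surjective (dO n d G p))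
    (hF : ContDiffOn ℝ ∞ (fE F p) {v | v ≠ 0}) {X : Eu n} (hX : dO n d G p X ≠ 0) :
    IsGeodesicVector (n := n) (G := G) F p X ↔
      ∀ Z, fderiv ℝ (fun v => fE F p v ^ 2) (dO n d G p X) (dO n d G p (brE n G X Z)) = 0 := by
  constructor
  · rintro ⟨γ, hγ, -, hgeo⟩ Z
    -- Test variation `exp(tX) exp(r t(1 - t) Z) p`: the factor `t(1 - t)` fixes the end points of
    -- `[0, 1]` and contributes its integral `1/6`.
    obtain ⟨δ, hδ⟩ := exists_isOneParam (G := G) Z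
    have hk : ContMDiff 𝓘(ℝ, ℝ × ℝ) (𝓡 n) ∞ (fun z : ℝ × ℝ => δ (z.1 * (z.2 * (1 - z.2)))) :=
      hδ.1.comp (f := fun z : ℝ × ℝ => z.1 * (z.2 * (1 - z.2))) (ContDiff.contMDiff (by fun_prop))
    have hγ' : ContMDiff 𝓘(ℝ, ℝ × ℝ) (𝓡 n) ∞ (fun z : ℝ × ℝ => γ z.2) :=
      hγ.1.comp (f := fun z : ℝ × ℝ => z.2) contDiff_snd.contMDiff
    have hΓ : ContMDiff 𝓘(ℝ, ℝ × ℝ) (𝓡 d) ∞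
        (fun z : ℝ × ℝ => (γ z.2 * δ (z.1 * (z.2 * (1 - z.2)))) • p) :=
      (contMDiff_orbit p).comp (f := fun z : ℝ × ℝ => γ z.2 * δ (z.1 * (z.2 * (1 - z.2))))
        (hγ'.mul hk)
    have hδD : HasD 𝓘(ℝ, ℝ) (𝓡 n) δ 0 ((1 : ℝ →L[ℝ] ℝ).smulRight Z) :=
      (hδ.hasLD 0).hasD hδ.map_zero
    have h1 := hgeo 0 1 one_pos _ hΓ (fun t => by simp [hδ.map_zero])
      (fun r => by simp [hδ.map_zero]) (fun r => by simp [hδ.map_zero])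
    have h2 := hasDerivAt_energy hinv hF hγ hX isOpen_univ hk.contMDiffOn
      (fun t => Set.mem_univ _) (fun t => by simp [hδ.map_zero]) (fun z _ => rfl)
      zero_le_one (ζ := fun t => (t * (1 - t)) • Z) (fun t => by
        have h3 : HasFDerivAt (fun r : ℝ => r * (t * (1 - t)))
            ((1 : ℝ →L[ℝ] ℝ).smulRight (t * (1 - t))) 0 := by
          refine ((1 : ℝ →L[ℝ] ℝ).smulRight (t * (1 - t))).hasFDerivAt.congr_of_eventuallyEq
            (.of_forall fun r => ?_)
          simp
        have h4 := hδD.comp (hasD_iff_hasFDerivAt.2 h3) (zero_mul _)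
        have h5 : ((1 : ℝ →L[ℝ] ℝ).smulRight Z).comp
            ((1 : ℝ →L[ℝ] ℝ).smulRight (t * (1 - t))) =
            (1 : ℝ →L[ℝ] ℝ).smulRight ((t * (1 - t)) • Z) := by
          ext1; simp
        rw [h5] at h4
        exact h4) (by simp) (by simp)
    have h3 := h1.unique h2
    simp only [brE_smul_right, map_smul, smul_eq_mul, intervalIntegral.integral_mul_const] at h3
    have h4 : ∫ t in (0 : ℝ)..1, t * (1 - t) = 1 / 6 := by
      have : ∀ t : ℝ, t * (1 - t) = t - t ^ 2 := fun t => by ring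
      simp only [this]
      rw [intervalIntegral.integral_sub (by simp) (by simp)]
      simp only [integral_id, integral_pow]
      norm_num
    rw [h4] at h3
    linarith
  · intro h
    obtain ⟨γ, hγ⟩ := exists_isOneParam (G := G) X
    refine ⟨γ, hγ, (contMDiff_orbit p).comp hγ.1, ?_⟩
    intro a b hab Γ hΓ hΓ0 hΓa hΓb
    -- Conversely, an arbitrary variation has the form `γ k p` near `r = 0`: `k` is the local
    -- section at `p` applied to `γ(t)⁻¹ Γ(r, t)`, which equals `p` for `r = 0`.
    obtain ⟨U, s, hU, hpU, hs, hs1, hsp⟩ := exists_local_section hsub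
    have hγ' : ContMDiff 𝓘(ℝ, ℝ × ℝ) (𝓡 n) ∞ (fun z : ℝ × ℝ => (γ z.2)⁻¹) :=
      (hγ.1.comp (f := fun z : ℝ × ℝ => z.2) contDiff_snd.contMDiff).inv
    have hΘ : ContMDiff 𝓘(ℝ, ℝ × ℝ) (𝓡 d) ∞ (fun z : ℝ × ℝ => (γ z.2)⁻¹ • Γ z) :=
      hγ'.smul hΓ
    have hΘ0 : ∀ t, (γ t)⁻¹ • Γ (0, t) = p := fun t => by simp [hΓ0]
    have hW := hU.preimage hΘ.continuous
    have h0W : ∀ t, ((0 : ℝ), t) ∈ (fun z : ℝ × ℝ => (γ z.2)⁻¹ • Γ z) ⁻¹' U := fun t => by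
      simpa [hΘ0] using hpU
    have hk : ContMDiffOn 𝓘(ℝ, ℝ × ℝ) (𝓡 n) ∞ (fun z : ℝ × ℝ => s ((γ z.2)⁻¹ • Γ z))
        ((fun z : ℝ × ℝ => (γ z.2)⁻¹ • Γ z) ⁻¹' U) :=
      hs.comp hΘ.contMDiffOn fun z hz => hz
    have hkD : ∀ t, ∃ z : Eu n, HasD 𝓘(ℝ, ℝ) (𝓡 n) (fun r : ℝ => s ((γ t)⁻¹ • Γ (r, t))) 0
        ((1 : ℝ →L[ℝ] ℝ).smulRight z) := by
      intro t
      have h1 : ContMDiffAt 𝓘(ℝ, ℝ) (𝓡 n) ∞ (fun r : ℝ => s ((γ t)⁻¹ • Γ (r, t))) 0 :=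
        ContMDiffAt.comp (g := fun z : ℝ × ℝ => s ((γ z.2)⁻¹ • Γ z)) (f := fun r : ℝ => (r, t)) 0
          (hk.contMDiffAt (hW.mem_nhds (h0W t)))
          (contDiff_id.prodMk contDiff_const).contMDiff.contMDiffAt
      obtain ⟨D, hD⟩ : ∃ D : ℝ →L[ℝ] Eu n, HasD 𝓘(ℝ, ℝ) (𝓡 n)
          (fun r : ℝ => s ((γ t)⁻¹ • Γ (r, t))) 0 D :=
        ⟨_, hasD_of_mdifferentiableAt (h1.mdifferentiableAt (by simp))⟩
      refine ⟨D 1, ?_⟩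
      have h2 : (1 : ℝ →L[ℝ] ℝ).smulRight (D 1) = D := by ext1; simp
      rwa [h2]
    choose ζ hζ using hkD
    have hend : ∀ t, (∀ r, Γ (r, t) = γ t • p) → ζ t = 0 := by
      intro t ht
      have h1 := (hζ t).unique ((hasD_const (0 : ℝ) (1 : G)).congr (.of_forall fun r => by
        simp [ht, hs1]))
      simpa using congrArg (fun L : ℝ →L[ℝ] Eu n => L 1) h1
    have h2 := hasDerivAt_energy hinv hF hγ hX hW hk h0W (fun t => by simp [hΘ0, hs1])
      (Γ := Γ) (fun z hz => by
        rw [mul_smul, hsp _ hz, smul_inv_smul]) hab.le hζ (hend a hΓa) (hend b hΓb)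
    simpa [h] using h2

end Energy

/-! ### Second derivatives of compositions -/

section Calculus

theorem iteratedDeriv_two_comp {E : Type*} [NormedAddCommGroup E] [NormedSpace ℝ E]
    {L : E → ℝ} {U : Set E} (hU : IsOpen U) (hL : ContDiffOn ℝ ∞ L U) {c c' : ℝ → E} {c'' : E}
    (hc0 : c 0 ∈ U) (hc : ∀ᶠ t in 𝓝 0, HasDerivAt c (c' t) t) (hc' : HasDerivAt c' c'' 0) :
    iteratedDeriv 2 (fun t => L (c t)) 0 =
      fderiv ℝ (fderiv ℝ L) (c 0) (c' 0) (c' 0) + fderiv ℝ L (c 0) c'' := by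
  have hD : ∀ x ∈ U, HasFDerivAt L (fderiv ℝ L x) x := fun x hx =>
    ((hL.contDiffAt (hU.mem_nhds hx)).differentiableAt (by simp)).hasFDerivAt
  have hD2 : HasFDerivAt (fderiv ℝ L) (fderiv ℝ (fderiv ℝ L) (c 0)) (c 0) :=
    (((hL.fderiv_of_isOpen hU (m := ∞) (by simp)).contDiffAt
      (hU.mem_nhds hc0)).differentiableAt (by simp)).hasFDerivAt
  have hcont : ContinuousAt c 0 := hc.self_of_nhds.continuousAt
  have h1 : deriv (fun t => L (c t)) =ᶠ[𝓝 0] fun t => fderiv ℝ L (c t) (c' t) := by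
    filter_upwards [hc, hcont.eventually (hU.mem_nhds hc0)] with t ht htU
    exact ((hD _ htU).comp_hasDerivAt t ht).deriv
  rw [iteratedDeriv_succ, iteratedDeriv_one, h1.deriv_eq]
  have h2 : HasDerivAt (fun t => fderiv ℝ L (c t)) (fderiv ℝ (fderiv ℝ L) (c 0) (c' 0)) 0 :=
    hD2.comp_hasDerivAt 0 hc.self_of_nhds
  exact (h2.clm_apply hc').deriv

/-- The first two derivatives of the square root of a positive function. -/
theorem hasDerivAt_sqrt_two {q q' : ℝ → ℝ} {q'' : ℝ} (hq : ∀ t, HasDerivAt q (q' t) t)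
    (hq' : HasDerivAt q' q'' 0) (h0 : 0 < q 0) :
    (∀ᶠ t in 𝓝 0, HasDerivAt (fun t => √(q t)) (q' t / (2 * √(q t))) t) ∧
      HasDerivAt (fun t => q' t / (2 * √(q t)))
        ((2 * q 0 * q'' - q' 0 ^ 2) / (4 * q 0 * √(q 0))) 0 := by
  have h1 : ∀ t, 0 < q t → HasDerivAt (fun t => √(q t)) (q' t / (2 * √(q t))) t := fun t ht =>
    (hq t).sqrt ht.ne'
  refine ⟨?_, ?_⟩
  · filter_upwards [(hq 0).continuousAt.eventually (lt_mem_nhds h0)] with t ht using h1 t ht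
  · have hs : 0 < √(q 0) := Real.sqrt_pos.2 h0
    refine (hq'.div ((h1 0 h0).const_mul 2) (by positivity)).congr_deriv ?_
    have hs2 : q 0 = √(q 0) ^ 2 := (Real.sq_sqrt h0.le).symm
    generalize √(q 0) = r at *
    rw [hs2]
    field_simp
    ring

end Calculus

/-! ### `L` as a function of the values of the basic forms -/

section Combine

variable {s k : ℕ}

theorem clm_pi_apply (f : (Fin k → ℝ) →L[ℝ] ℝ) (w : Fin k → ℝ) :
    f w = ∑ j, f (Pi.single j 1) * w j := by
  have := LinearMap.pi_apply_eq_sum_univ f.toLinearMap w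
  simpa [mul_comm, ← Pi.single_apply, Pi.single_comm] using this

/-- The vector of the norms `√g_j`, as a function of the values `tᵢ` of the basic forms. -/
def normVec (c : Fin k → Fin s → ℝ) (t : Fin s → ℝ) : Fin k → ℝ :=
  fun j => √(∑ i, c j i * t i)

/-- The partial derivatives of `t ↦ L(√g₁, …, √g_k)`. -/
def combPartial (L : (Fin k → ℝ) → ℝ) (c : Fin k → Fin s → ℝ) (t : Fin s → ℝ) (i : Fin s) : ℝ :=
  ∑ j, fderiv ℝ L (normVec c t) (Pi.single j 1) * (c j i / (2 * normVec c t j))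

theorem isOpen_pos (k : ℕ) : IsOpen {x : Fin k → ℝ | ∀ i, 0 < x i} := by
  have : {x : Fin k → ℝ | ∀ i, 0 < x i} = Set.univ.pi fun _ => Set.Ioi 0 := by
    ext; simp
  rw [this]
  exact isOpen_set_pi Set.finite_univ fun _ _ => isOpen_Ioi

theorem sum_mul_pos {c t : Fin s → ℝ} (hc : ∀ i, 0 < c i) (ht : ∀ i, 0 ≤ t i) (ht0 : t ≠ 0) :
    0 < ∑ i, c i * t i := by
  obtain ⟨i, hi⟩ := Function.ne_iff.1 ht0
  exact Finset.sum_pos' (fun i _ => mul_nonneg (hc i).le (ht i))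
    ⟨i, Finset.mem_univ _, mul_pos (hc i) ((ht i).lt_of_ne' hi)⟩

theorem normVec_pos {c : Fin k → Fin s → ℝ} (hc : ∀ j i, 0 < c j i) {t : Fin s → ℝ}
    (ht : ∀ i, 0 ≤ t i) (ht0 : t ≠ 0) (j : Fin k) : 0 < normVec c t j :=
  Real.sqrt_pos.2 (sum_mul_pos (hc j) ht ht0)

theorem normVec_zero (c : Fin k → Fin s → ℝ) : normVec c 0 = 0 := by
  ext; simp [normVec]

theorem continuous_normVec (c : Fin k → Fin s → ℝ) : Continuous (normVec c) := by
  unfold normVec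
  fun_prop

theorem contDiffAt_normVec {c : Fin k → Fin s → ℝ} {t : Fin s → ℝ} (h : ∀ j, 0 < normVec c t j) :
    ContDiffAt ℝ ∞ (normVec c) t := by
  refine contDiffAt_pi.2 fun j => ?_
  refine ContDiffAt.sqrt (by fun_prop) (Real.sqrt_pos.1 (h j)).ne'

variable {L : (Fin k → ℝ) → ℝ}

theorem Admissible.contDiffAt (hL : Admissible L) {x : Fin k → ℝ} (hx : ∀ i, 0 < x i) :
    ContDiffAt ℝ ∞ L x := hL.smooth.contDiffAt ((isOpen_pos k).mem_nhds hx)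

theorem Admissible.zero (hL : Admissible L) : L 0 = 0 := by
  have := hL.homog 2 0 (by norm_num) (fun _ => le_rfl)
  rw [smul_zero] at this
  linarith

theorem Admissible.nonneg (hL : Admissible L) {c : Fin k → Fin s → ℝ} (hc : ∀ j i, 0 < c j i)
    {t : Fin s → ℝ} (ht : ∀ i, 0 ≤ t i) : 0 ≤ L (normVec c t) := by
  by_cases h : t = 0
  · rw [h, normVec_zero, hL.zero]
  · exact (hL.pos _ (normVec_pos hc ht h)).le

theorem Admissible.hasFDerivAt_comp (hL : Admissible L) {c : Fin k → Fin s → ℝ} {t : Fin s → ℝ}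
    (h : ∀ j, 0 < normVec c t j) :
    HasFDerivAt (fun t => L (normVec c t))
      (∑ i, combPartial L c t i • ContinuousLinearMap.proj (R := ℝ) (φ := fun _ : Fin s => ℝ) i) t := by
  have h1 : HasFDerivAt L (fderiv ℝ L (normVec c t)) (normVec c t) :=
    ((hL.contDiffAt h).differentiableAt (by simp)).hasFDerivAt
  have h2 : HasFDerivAt (normVec c) (ContinuousLinearMap.pi fun j =>
      (1 / (2 * normVec c t j)) • ∑ i, c j i •
        ContinuousLinearMap.proj (R := ℝ) (φ := fun _ : Fin s => ℝ) i) t := by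
    refine hasFDerivAt_pi.2 fun j => ?_
    refine HasFDerivAt.sqrt (f := fun t : Fin s → ℝ => ∑ i, c j i * t i) ?_ (Real.sqrt_pos.1 (h j)).ne'
    refine HasFDerivAt.fun_sum fun i _ => ?_
    exact (hasFDerivAt_apply i t).const_mul (c j i)
  refine (h1.comp t h2).congr_fderiv ?_
  ext1 τ
  simp only [ContinuousLinearMap.comp_apply, sum_apply]
  rw [clm_pi_apply]
  simp only [ContinuousLinearMap.pi_apply, smul_apply,
    sum_apply, ContinuousLinearMap.proj_apply, smul_eq_mul, combPartial,
    Finset.mul_sum, Finset.sum_mul]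
  rw [Finset.sum_comm]
  refine Finset.sum_congr rfl fun i _ => Finset.sum_congr rfl fun j _ => ?_
  ring

/-- No partial derivative of `L` is negative and at least one is positive; since each `g_j` contains
every basic form with positive weight, all coefficients are positive. -/
theorem Admissible.combPartial_pos (hL : Admissible L) {c : Fin k → Fin s → ℝ}
    (hc : ∀ j i, 0 < c j i) {t : Fin s → ℝ} (h : ∀ j, 0 < normVec c t j) (i : Fin s) :
    0 < combPartial L c t i := by
  have hn : ∀ j, 0 ≤ fderiv ℝ L (normVec c t) (Pi.single j 1) := hL.partial_nonneg _ h
  obtain ⟨j, -, hj⟩ := Finset.exists_lt_of_sum_lt (s := Finset.univ) (f := fun _ : Fin k => (0 : ℝ))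
    (g := fun j => fderiv ℝ L (normVec c t) (Pi.single j 1)) (by simpa using hL.sum_pos _ h)
  exact Finset.sum_pos' (fun j _ => mul_nonneg (hn j) (div_pos (hc j i) (by linarith [h j])).le)
    ⟨j, Finset.mem_univ _, mul_pos hj (div_pos (hc j i) (by linarith [h j]))⟩

theorem Admissible.contDiffAt_sqrt (hL : Admissible L) {c : Fin k → Fin s → ℝ}
    {t : Fin s → ℝ} (h : ∀ j, 0 < normVec c t j) :
    ContDiffAt ℝ ∞ (fun t => √(L (normVec c t))) t :=
  ((hL.contDiffAt h).comp t (contDiffAt_normVec h)).sqrt (hL.pos _ h).ne'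

theorem Admissible.continuousOn_sqrt (hL : Admissible L) (c : Fin k → Fin s → ℝ) :
    ContinuousOn (fun t => √(L (normVec c t))) {t | ∀ i, 0 ≤ t i} :=
  (hL.cont.comp (continuous_normVec c).continuousOn fun _ _ _ => Real.sqrt_nonneg _).sqrt

end Combine

/-! ### The norm on one tangent space: smoothness, differential, convexity -/

section Forms

variable {s k : ℕ} {E : Type*} [NormedAddCommGroup E] [NormedSpace ℝ E]

/-- The values of the basic forms on a vector. -/
def formVec (a : Fin s → E →ₗ[ℝ] E →ₗ[ℝ] ℝ) (v : E) : Fin s → ℝ := fun i => a i v v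

/-- Symmetric positive semidefinite forms, whose sum is positive definite. -/
structure IsFormFamily (a : Fin s → E →ₗ[ℝ] E →ₗ[ℝ] ℝ) : Prop where
  symm : ∀ i v w, a i v w = a i w v
  nonneg : ∀ i v, 0 ≤ a i v v
  definite : ∀ v, (∀ i, a i v v = 0) → v = 0

variable {a : Fin s → E →ₗ[ℝ] E →ₗ[ℝ] ℝ}

theorem IsFormFamily.formVec_ne_zero (ha : IsFormFamily a) {v : E} (hv : v ≠ 0) :
    formVec a v ≠ 0 := fun h => hv (ha.definite v fun i => congrFun h i)

theorem IsFormFamily.normVec_pos (ha : IsFormFamily a) {c : Fin k → Fin s → ℝ}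
    (hc : ∀ j i, 0 < c j i) {v : E} (hv : v ≠ 0) (j : Fin k) : 0 < normVec c (formVec a v) j :=
  FinslerGO.normVec_pos hc (fun i => ha.nonneg i v) (ha.formVec_ne_zero hv) j

theorem formVec_smul (a : Fin s → E →ₗ[ℝ] E →ₗ[ℝ] ℝ) (r : ℝ) (v : E) :
    formVec a (r • v) = r ^ 2 • formVec a v := by
  ext i; simp [formVec]; ring

variable [FiniteDimensional ℝ E]

theorem contDiff_formVec (a : Fin s → E →ₗ[ℝ] E →ₗ[ℝ] ℝ) : ContDiff ℝ ∞ (formVec a) := by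
  refine contDiff_pi.2 fun i => ?_
  exact ((a i).toContinuousBilinearMap.contDiff).clm_apply contDiff_id

theorem IsFormFamily.hasFDerivAt_formVec (ha : IsFormFamily a) (v : E) :
    HasFDerivAt (formVec a) (ContinuousLinearMap.pi fun i =>
      (2 : ℝ) • LinearMap.toContinuousLinearMap (a i v)) v := by
  refine hasFDerivAt_pi.2 fun i => ?_
  have h := (a i).toContinuousBilinearMap.hasFDerivAt_of_bilinear (hasFDerivAt_id v)
    (hasFDerivAt_id v)
  refine h.congr_fderiv ?_
  ext1 w
  simp [two_mul, ha.symm i w v]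

variable {L : (Fin k → ℝ) → ℝ}

theorem Admissible.contDiffAt_norm (hL : Admissible L) (ha : IsFormFamily a)
    {c : Fin k → Fin s → ℝ} (hc : ∀ j i, 0 < c j i) {v : E} (hv : v ≠ 0) :
    ContDiffAt ℝ ∞ (fun v => √(L (normVec c (formVec a v)))) v :=
  (hL.contDiffAt_sqrt (ha.normVec_pos hc hv)).comp (f := formVec a) v
    (contDiff_formVec a).contDiffAt

/-- At `v` the squared norm has the same differential as the quadratic form `∑ φᵢ aᵢ` with its
coefficients frozen at `v`. This is the link between `F` and the Riemannian family. -/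
theorem Admissible.fderiv_norm_sq (hL : Admissible L) (ha : IsFormFamily a)
    {c : Fin k → Fin s → ℝ} (hc : ∀ j i, 0 < c j i) {v : E} (hv : v ≠ 0) (w : E) :
    fderiv ℝ (fun v => √(L (normVec c (formVec a v))) ^ 2) v w =
      2 * ∑ i, combPartial L c (formVec a v) i * a i v w := by
  have h1 : (fun v => √(L (normVec c (formVec a v))) ^ 2) = fun v => L (normVec c (formVec a v)) := by
    ext v
    exact Real.sq_sqrt (hL.nonneg hc fun i => ha.nonneg i v)
  have h2 := (hL.hasFDerivAt_comp (ha.normVec_pos hc hv)).comp v (ha.hasFDerivAt_formVec v)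
  rw [h1, HasFDerivAt.fderiv (f := fun v => L (normVec c (formVec a v))) h2]
  simp only [ContinuousLinearMap.comp_apply, sum_apply,
    smul_apply, ContinuousLinearMap.proj_apply, ContinuousLinearMap.pi_apply,
    LinearMap.coe_toContinuousLinearMap', smul_eq_mul, Finset.mul_sum]
  exact Finset.sum_congr rfl fun i _ => by ring

theorem Admissible.norm_smul (hL : Admissible L) (a : Fin s → E →ₗ[ℝ] E →ₗ[ℝ] ℝ)
    (c : Fin k → Fin s → ℝ) {r : ℝ} (hr : r ≠ 0) (v : E) :
    L (normVec c (formVec a (r • v))) = r ^ 2 * L (normVec c (formVec a v)) := by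
  have h1 : normVec c (formVec a (r • v)) = |r| • normVec c (formVec a v) := by
    ext j
    rw [formVec_smul]
    simp only [normVec, Pi.smul_apply, smul_eq_mul]
    have : ∑ i, c j i * (r ^ 2 * formVec a v i) = r ^ 2 * ∑ i, c j i * formVec a v i := by
      rw [Finset.mul_sum]
      exact Finset.sum_congr rfl fun i _ => by ring
    rw [this, Real.sqrt_mul (sq_nonneg r), Real.sqrt_sq_eq_abs]
  rw [h1, hL.homog _ (normVec c (formVec a v)) (abs_pos.2 hr) (fun _ => Real.sqrt_nonneg _), sq_abs]

/-- If `v = r y`, homogeneity gives `F²(y + t v) = (1 + t r)² F²(y)` for small `t`. Otherwise the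
second derivative is the Hessian of `L`, which is nonnegative, plus `∑ L_{,j} (√g_j)''`, and every
`(√g_j)''` is positive by the strict Cauchy–Schwarz inequality. -/
theorem Admissible.norm_convex (hL : Admissible L) (ha : IsFormFamily a)
    {c : Fin k → Fin s → ℝ} (hc : ∀ j i, 0 < c j i) {y v : E} (hy : y ≠ 0) (hv : v ≠ 0) :
    0 < iteratedDeriv 2 (fun t : ℝ => √(L (normVec c (formVec a (y + t • v)))) ^ 2) 0 := by
  have h1 : (fun t : ℝ => √(L (normVec c (formVec a (y + t • v)))) ^ 2) =
      fun t : ℝ => L (normVec c (formVec a (y + t • v))) := by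
    ext t
    exact Real.sq_sqrt (hL.nonneg hc fun i => ha.nonneg i _)
  rw [h1]
  have hpos : ∀ j, 0 < normVec c (formVec a y) j := ha.normVec_pos hc hy
  by_cases hpar : ∃ r : ℝ, v = r • y
  · obtain ⟨r, rfl⟩ := hpar
    have hr : r ≠ 0 := fun h => hv (by simp [h])
    have h2 : (fun t : ℝ => L (normVec c (formVec a (y + t • r • y)))) =ᶠ[𝓝 0]
        fun t => (1 + t * r) ^ 2 * L (normVec c (formVec a y)) := by
      have : ∀ᶠ t : ℝ in 𝓝 0, 1 + t * r ≠ 0 := by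
        refine ContinuousAt.eventually_ne (by fun_prop) (by simp)
      filter_upwards [this] with t ht
      rw [← hL.norm_smul a c ht, add_smul, one_smul, mul_smul]
    have h3 : ∀ t : ℝ, HasDerivAt (fun t => (1 + t * r) ^ 2 * L (normVec c (formVec a y)))
        (2 * (1 + t * r) * r * L (normVec c (formVec a y))) t := by
      intro t
      have := ((((hasDerivAt_id t).mul_const r).const_add 1).pow 2).mul_const
        (L (normVec c (formVec a y)))
      refine this.congr_deriv ?_
      simp
    have h4 : HasDerivAt (fun t => 2 * (1 + t * r) * r * L (normVec c (formVec a y)))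
        (2 * r * r * L (normVec c (formVec a y))) 0 := by
      have := (((((hasDerivAt_id (0 : ℝ)).mul_const r).const_add 1).const_mul 2).mul_const r).mul_const
        (L (normVec c (formVec a y)))
      refine this.congr_deriv ?_
      simp
    rw [h2.iteratedDeriv_eq, iteratedDeriv_succ, iteratedDeriv_one,
      funext fun t => (h3 t).deriv, h4.deriv]
    have := hL.pos _ hpos
    have hr2 : 0 < r * r := mul_self_pos.2 hr
    have h5 : 2 * r * r * L (normVec c (formVec a y)) = 2 * ((r * r) * L (normVec c (formVec a y))) := by
      ring
    rw [h5]
    positivity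
  · set B : Fin k → E →ₗ[ℝ] E →ₗ[ℝ] ℝ := fun j => ∑ i, c j i • a i with hB
    have hBa : ∀ j u w, B j u w = ∑ i, c j i * a i u w := fun j u w => by
      simp [hB, LinearMap.sum_apply]
    have hBs : ∀ j u w, B j u w = B j w u := fun j u w => by
      rw [hBa, hBa]
      exact Finset.sum_congr rfl fun i _ => by rw [ha.symm]
    have hBp : ∀ j u, u ≠ 0 → 0 < B j u u := fun j u hu => by
      rw [hBa]
      exact sum_mul_pos (hc j) (fun i => ha.nonneg i u) (ha.formVec_ne_zero hu)
    have hBv : ∀ u, normVec c (formVec a u) = fun j => √(B j u u) := fun u => by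
      ext j; rw [hBa]; rfl
    have hq : ∀ j t, HasDerivAt (fun t : ℝ => B j (y + t • v) (y + t • v))
        (2 * B j y v + 2 * t * B j v v) t := by
      intro j t
      have h2 : HasDerivAt (fun t : ℝ => y + t • v) v t := by
        simpa using ((hasDerivAt_id t).smul_const v).const_add y
      refine (hasDerivAt_bilin (B j) h2 h2).congr_deriv ?_
      simp [hBs j v y]; ring
    have hq' : ∀ j, HasDerivAt (fun t : ℝ => 2 * B j y v + 2 * t * B j v v) (2 * B j v v) 0 := by
      intro j
      have := (((hasDerivAt_id (0 : ℝ)).const_mul 2).mul_const (B j v v)).const_add (2 * B j y v)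
      refine this.congr_deriv ?_
      simp
    have hsq := fun j => hasDerivAt_sqrt_two (hq j) (hq' j) (by simpa using hBp j y hy)
    have hlin : ∀ x : Fin k → ℝ, (∀ j, 0 < x j) → ∀ w, 0 ≤ fderiv ℝ (fderiv ℝ L) x w w := by
      intro x hx w
      have h2 : ∀ t : ℝ, HasDerivAt (fun t : ℝ => x + t • w) w t := fun t => by
        simpa using ((hasDerivAt_id t).smul_const w).const_add x
      have h3 := iteratedDeriv_two_comp (isOpen_pos k) hL.smooth (c := fun t : ℝ => x + t • w)
        (c' := fun _ => w) (c'' := 0) (by simpa using hx) (.of_forall h2) (hasDerivAt_const _ _)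
      have h4 := hL.hess x hx w
      rw [h3] at h4
      simpa using h4
    have hmain := iteratedDeriv_two_comp (isOpen_pos k) hL.smooth
      (c := fun t : ℝ => normVec c (formVec a (y + t • v)))
      (c' := fun t j => (2 * B j y v + 2 * t * B j v v) / (2 * √(B j (y + t • v) (y + t • v))))
      (c'' := fun j => (2 * B j (y + (0 : ℝ) • v) (y + (0 : ℝ) • v) * (2 * B j v v) -
        (2 * B j y v + 2 * 0 * B j v v) ^ 2) / (4 * B j (y + (0 : ℝ) • v) (y + (0 : ℝ) • v) *
          √(B j (y + (0 : ℝ) • v) (y + (0 : ℝ) • v))))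
      (by simpa using hpos) (by
        have := eventually_all.2 fun j => (hsq j).1
        filter_upwards [this] with t ht
        simp only [hBv]
        exact hasDerivAt_pi.2 ht) (hasDerivAt_pi.2 fun j => (hsq j).2)
    rw [hmain]
    refine add_pos_of_nonneg_of_pos (hlin _ (by simpa using hpos) _) ?_
    simp only [zero_smul, add_zero, mul_zero, zero_mul]
    set c'' : Fin k → ℝ := fun j => (2 * B j y y * (2 * B j v v) - (2 * B j y v) ^ 2) /
      (4 * B j y y * √(B j y y)) with hc''
    have hc''p : ∀ j, 0 < c'' j := by
      intro j
      have hyy := hBp j y hy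
      -- The part of `v` orthogonal to `y` for `B j`; that it is nonzero is the strictness in
      -- Cauchy–Schwarz.
      have hw : v - (B j y v / B j y y) • y ≠ 0 := fun h =>
        hpar ⟨B j y v / B j y y, sub_eq_zero.1 h⟩
      have hww := hBp j _ hw
      have h2 : B j (v - (B j y v / B j y y) • y) (v - (B j y v / B j y y) • y) =
          (B j y y * B j v v - B j y v ^ 2) / B j y y := by
        simp [hBs j v y]
        field_simp
        ring
      rw [h2] at hww
      have h3 := (div_pos_iff_of_pos_right hyy).1 hww
      have hs := Real.sqrt_pos.2 hyy
      refine div_pos (by nlinarith) (by positivity)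
    have hn : ∀ j, 0 ≤ fderiv ℝ L (normVec c (formVec a y)) (Pi.single j 1) :=
      hL.partial_nonneg _ hpos
    rw [clm_pi_apply]
    obtain ⟨j, -, hj⟩ := Finset.exists_lt_of_sum_lt (s := Finset.univ)
      (f := fun _ : Fin k => (0 : ℝ))
      (g := fun j => fderiv ℝ L (normVec c (formVec a y)) (Pi.single j 1))
      (by simpa using hL.sum_pos _ hpos)
    exact Finset.sum_pos' (fun j _ => mul_nonneg (hn j) (hc''p j).le)
      ⟨j, Finset.mem_univ _, mul_pos hj (hc''p j)⟩

end Forms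

/-! ### The metrics on `M` and their geodesic vectors -/

section Metrics
variable {n d s : ℕ}
  {G : Type*} [TopologicalSpace G] [ChartedSpace (EuclideanSpace ℝ (Fin n)) G] [Group G]
  [LieGroup (𝓡 n) ∞ G]
  {M : Type*} [TopologicalSpace M] [ChartedSpace (EuclideanSpace ℝ (Fin d)) M]
  [IsManifold (𝓡 d) ∞ M] [MulAction G M] [ContMDiffSMul (𝓡 n) (𝓡 d) ∞ G M]
  {p : M} {m : Submodule ℝ (Eu n)} {ms : Fin s → Submodule ℝ (Eu n)} {α : Fin s → BilinField d M}

/-- The values at `q` of the basic forms. -/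
def basicForm (α : Fin s → BilinField d M) (q : M) (i : Fin s) : Eu d →ₗ[ℝ] Eu d →ₗ[ℝ] ℝ :=
  bE (α i) q

omit [IsManifold (𝓡 d) ∞ M] in
theorem bE_relMetric (α : Fin s → BilinField d M) (c : Fin s → ℝ) (q : M) (v w : Eu d) :
    bE (relMetric α c) q v w = ∑ i, c i * basicForm α q i v w := by
  have : bE (relMetric α c) q = ∑ i, c i • basicForm α q i := rfl
  rw [this, LinearMap.sum_apply, LinearMap.sum_apply]
  simp

theorem fE_normOf (g : BilinField d M) (q : M) (v : Eu d) : fE (normOf g) q v = √(bE g q v v) := rfl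

theorem fE_normOf_relMetric (α : Fin s → BilinField d M) (c : Fin s → ℝ) (q : M) (v : Eu d) :
    fE (normOf (relMetric α c)) q v = √(∑ i, c i * formVec (basicForm α q) v i) := by
  rw [fE_normOf, bE_relMetric]
  rfl

theorem fE_combine {k : ℕ} (L : (Fin k → ℝ) → ℝ) (α : Fin s → BilinField d M)
    (c : Fin k → Fin s → ℝ) (q : M) (v : Eu d) :
    fE (combine L fun j => relMetric α (c j)) q v =
      √(L (normVec c (formVec (basicForm α q) v))) := by
  refine congrArg (fun x => √(L x)) ?_
  funext j
  exact fE_normOf_relMetric α (c j) q v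

theorem BilinInv.basicForm {α : Fin s → BilinField d M} (h : ∀ i, BilinInv G (α i)) (g : G) (q : M)
    (i : Fin s) (v w : Eu d) :
    basicForm α (g • q) i (dT d g q v) (dT d g q w) = FinslerGO.basicForm α q i v w := h i g q v w

theorem BilinInv.formVec {α : Fin s → BilinField d M} (h : ∀ i, BilinInv G (α i)) (g : G) (q : M)
    (v : Eu d) : formVec (FinslerGO.basicForm α (g • q)) (dT d g q v) =
      FinslerGO.formVec (FinslerGO.basicForm α q) v :=
  funext fun i => h i g q v v

theorem BilinInv.combine {k : ℕ} (L : (Fin k → ℝ) → ℝ) {α : Fin s → BilinField d M}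
    (h : ∀ i, BilinInv G (α i)) (c : Fin k → Fin s → ℝ) :
    FunInv G (combine L fun j => relMetric α (c j)) := fun g q v => by
  rw [fE_combine, fE_combine, BilinInv.formVec h]

theorem BilinInv.normOf {α : Fin s → BilinField d M}
    (h : ∀ i, BilinInv G (α i)) (c : Fin s → ℝ) :
    FunInv G (normOf (relMetric α c)) := fun g q v => by
  rw [fE_normOf_relMetric, fE_normOf_relMetric, BilinInv.formVec h]

theorem IsBasicForms.bilinInv (hα : IsBasicForms (n := n) (G := G) p ms α) (i : Fin s) :
    BilinInv G (α i) := hα.invariant i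

theorem IsBasicForms.basicForm_symm (hα : IsBasicForms (n := n) (G := G) p ms α) (i : Fin s)
    (v w : Eu d) : basicForm α p i v w = basicForm α p i w v := hα.symm i v w

theorem IsBasicForms.basicForm_pos (hα : IsBasicForms (n := n) (G := G) p ms α) (i : Fin s)
    {x : Eu n} (hx : x ∈ ms i) (hx0 : x ≠ 0) :
    0 < basicForm α p i (dO n d G p x) (dO n d G p x) := hα.posDef i x hx hx0

theorem IsBasicForms.basicForm_zero (hα : IsBasicForms (n := n) (G := G) p ms α) {i j : Fin s}
    (hij : i ≠ j) {x : Eu n} (hx : x ∈ ms j) (w : Eu d) :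
    basicForm α p i (dO n d G p x) w = 0 := hα.zero i j hij x hx w

/-- Every tangent vector is a sum of vectors tangent to the summands. -/
theorem exists_decomposition (hsub : Function.Surjective (dO n d G p))
    (hm : IsReductive (n := n) (G := G) d p m)
    (hms : IsIrredDecomposition (n := n) (G := G) p m ms) (v : Eu d) :
    ∃ x : Fin s → Eu n, (∀ i, x i ∈ ms i) ∧ dO n d G p (∑ i, x i) = v := by
  obtain ⟨X, rfl⟩ := hsub v
  have h1 : (dO n d G p).toLinearMap.ker ⊔ m = ⊤ := hm.1.sup_eq_top
  obtain ⟨η, hη, y, hy, rfl⟩ := Submodule.mem_sup.1 (h1 ▸ Submodule.mem_top (x := X))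
  have hη0 : dO n d G p η = 0 := hη
  have h2 : (⨆ i, ms i) = m := hms.2.2
  rw [← h2, Submodule.iSup_eq_span] at hy
  obtain ⟨f, hf, -, hfy⟩ : ∃ f : Fin s → Eu n, (∀ i, f i ∈ ms i) ∧ True ∧ ∑ i, f i = y := by
    rw [← Submodule.iSup_eq_span] at hy
    obtain ⟨f, hf⟩ := (Submodule.mem_iSup_finset_iff_exists_sum (s := Finset.univ) ms y).1
      (by simpa using hy)
    exact ⟨fun i => f i, fun i => (f i).2, trivial, by simpa using hf⟩
  exact ⟨f, hf, by rw [hfy, map_add, hη0, zero_add]⟩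

theorem basicForm_decomposition (hα : IsBasicForms (n := n) (G := G) p ms α) {x : Fin s → Eu n}
    (hx : ∀ i, x i ∈ ms i) (i : Fin s) (w : Eu d) :
    basicForm α p i (dO n d G p (∑ j, x j)) w = basicForm α p i (dO n d G p (x i)) w := by
  rw [map_sum, map_sum, LinearMap.sum_apply, Finset.sum_eq_single i]
  · exact fun j _ hj => hα.basicForm_zero hj.symm (hx j) w
  · simp

/-- `αᵢ` sees only the `i`-th component of a vector, and is definite there. -/
theorem isFormFamily (hsub : Function.Surjective (dO n d G p))
    (hm : IsReductive (n := n) (G := G) d p m)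
    (hms : IsIrredDecomposition (n := n) (G := G) p m ms)
    (hα : IsBasicForms (n := n) (G := G) p ms α) : IsFormFamily (basicForm α p) := by
  have key : ∀ (x : Fin s → Eu n), (∀ i, x i ∈ ms i) → ∀ i,
      basicForm α p i (dO n d G p (∑ j, x j)) (dO n d G p (∑ j, x j)) =
      basicForm α p i (dO n d G p (x i)) (dO n d G p (x i)) := fun x hx i => by
    rw [basicForm_decomposition hα hx, hα.basicForm_symm, basicForm_decomposition hα hx]
  refine ⟨fun i => hα.basicForm_symm i, fun i v => ?_, fun v hv => ?_⟩
  · obtain ⟨x, hx, rfl⟩ := exists_decomposition hsub hm hms v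
    rw [key x hx]
    by_cases h : x i = 0
    · simp [h]
    · exact (hα.basicForm_pos i (hx i) h).le
  · obtain ⟨x, hx, rfl⟩ := exists_decomposition hsub hm hms v
    have : ∀ i, x i = 0 := fun i => by
      by_contra h
      exact (hα.basicForm_pos i (hx i) h).ne' ((key x hx i).symm.trans (hv i))
    simp [this]

include n in
theorem isFormFamily_at [MulAction.IsPretransitive G M] (hinv : ∀ i, BilinInv G (α i))
    (h : IsFormFamily (basicForm α p)) (q : M) : IsFormFamily (basicForm α q) := by
  obtain ⟨g, rfl⟩ := MulAction.exists_smul_eq G p q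
  have key : ∀ i v w, basicForm α (g • p) i v w =
      basicForm α p i (dT d g⁻¹ (g • p) v) (dT d g⁻¹ (g • p) w) := fun i v w => by
    rw [← BilinInv.basicForm hinv g p, dT_dT_inv (n := n), dT_dT_inv (n := n)]
  refine ⟨fun i v w => ?_, fun i v => ?_, fun v hv => ?_⟩
  · rw [key, key, h.symm]
  · rw [key]
    exact h.nonneg _ _
  · have h1 := h.definite _ fun i => (key i v v).symm.trans (hv i)
    rw [← dT_dT_inv (n := n) (d := d) g p v, h1, map_zero]

variable {k : ℕ} {L : (Fin k → ℝ) → ℝ} {c : Fin k → Fin s → ℝ}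

theorem fE_combine_eq (L : (Fin k → ℝ) → ℝ) (α : Fin s → BilinField d M)
    (c : Fin k → Fin s → ℝ) (q : M) :
    fE (combine L fun j => relMetric α (c j)) q =
      fun v => √(L (normVec c (formVec (basicForm α q) v))) :=
  funext fun v => fE_combine L α c q v

theorem contDiffOn_fE_combine (hL : Admissible L) (hc : ∀ j i, 0 < c j i)
    (h : IsFormFamily (basicForm α p)) :
    ContDiffOn ℝ ∞ (fE (combine L fun j => relMetric α (c j)) p) {v | v ≠ 0} := by
  rw [fE_combine_eq]
  exact fun v hv => (hL.contDiffAt_norm h hc hv).contDiffWithinAt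

theorem isMinkowski_combine (hL : Admissible L) (hc : ∀ j i, 0 < c j i)
    (h : IsFormFamily (basicForm α p)) :
    IsMinkowski (combine L fun j => relMetric α (c j)) p := by
  refine ⟨fun y hy => ?_, fun r y hr => ?_, fun y v hy hv => ?_⟩
  · have key : ∀ (y : Eu d), y ≠ 0 → 0 < fE (combine L fun j => relMetric α (c j)) p y := by
      intro y hy
      rw [fE_combine]
      exact Real.sqrt_pos.2 (hL.pos _ (h.normVec_pos hc hy))
    exact key y hy
  · have key : ∀ (y : Eu d), fE (combine L fun j => relMetric α (c j)) p (r • y) =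
        r * fE (combine L fun j => relMetric α (c j)) p y := by
      intro y
      rw [fE_combine, fE_combine]
      rcases hr.eq_or_lt with rfl | hr
      · have : formVec (basicForm α p) ((0 : ℝ) • y) = 0 := by rw [formVec_smul]; simp
        rw [this, normVec_zero, hL.zero]
        simp
      · rw [hL.norm_smul _ _ hr.ne', Real.sqrt_mul (sq_nonneg r), Real.sqrt_sq hr.le]
    exact key y
  · have key : ∀ (y v : Eu d), y ≠ 0 → v ≠ 0 → 0 < iteratedDeriv 2
        (fun t : ℝ => fE (combine L fun j => relMetric α (c j)) p (y + t • v) ^ 2) 0 := by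
      intro y v hy hv
      rw [fE_combine_eq]
      exact hL.norm_convex h hc hy hv
    exact key y v hy hv

theorem isInvariantFinsler_combine [MulAction.IsPretransitive G M]
    (hsub : Function.Surjective (dO n d G p)) (hL : Admissible L) (hc : ∀ j i, 0 < c j i)
    (hinv : ∀ i, BilinInv G (α i)) (h : IsFormFamily (basicForm α p)) :
    IsInvariantFinsler G (combine L fun j => relMetric α (c j)) where
  smooth := contMDiffOn_of_funInv hsub (BilinInv.combine L hinv c) (contDiffOn_fE_combine hL hc h)
  minkowski q := isMinkowski_combine hL hc (isFormFamily_at (n := n) hinv h q)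
  invariant := BilinInv.combine L hinv c

theorem isAlphaType_combine (hL : Admissible L) (hc : ∀ j i, 0 < c j i) :
    IsAlphaType (n := n) (G := G) p m α (combine L fun j => relMetric α (c j)) := by
  refine ⟨fun t => √(L (normVec c t)), hL.continuousOn_sqrt c, fun t ht => ?_, fun y _ => ?_⟩
  · exact (hL.contDiffAt_sqrt (normVec_pos hc ht.1 ht.2)).contDiffWithinAt
  · exact fE_combine L α c p (dO n d G p y)

variable [T2Space G] [T2Space M] [MulAction.IsPretransitive G M]

theorem isGeodesicVector_combine_iff
    (hsub : Function.Surjective (dO n d G p)) (hL : Admissible L) (hc : ∀ j i, 0 < c j i)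
    (hinv : ∀ i, BilinInv G (α i)) (h : IsFormFamily (basicForm α p)) {X : Eu n}
    (hX : dO n d G p X ≠ 0) :
    IsGeodesicVector (n := n) (G := G) (combine L fun j => relMetric α (c j)) p X ↔
      ∀ Z, ∑ i, combPartial L c (formVec (basicForm α p) (dO n d G p X)) i *
        basicForm α p i (dO n d G p X) (dO n d G p (brE n G X Z)) = 0 := by
  rw [isGeodesicVector_iff (BilinInv.combine L hinv c) hsub (contDiffOn_fE_combine hL hc h) hX]
  refine forall_congr' fun Z => ?_
  rw [fE_combine_eq, hL.fderiv_norm_sq h hc hX]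
  simp

theorem isGeodesicVector_normOf_iff
    (hsub : Function.Surjective (dO n d G p)) {c : Fin s → ℝ} (hc : ∀ i, 0 < c i)
    (hinv : ∀ i, BilinInv G (α i)) (h : IsFormFamily (basicForm α p)) {X : Eu n}
    (hX : dO n d G p X ≠ 0) :
    IsGeodesicVector (n := n) (G := G) (normOf (relMetric α c)) p X ↔
      ∀ Z, ∑ i, c i *
        basicForm α p i (dO n d G p X) (dO n d G p (brE n G X Z)) = 0 := by
  have hF : fE (normOf (relMetric α c)) p =
      fun v => √(∑ i, c i * formVec (basicForm α p) v i) :=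
    funext fun v => fE_normOf_relMetric α c p v
  have hq : ContDiff ℝ ∞ (fun v => ∑ i, c i * formVec (basicForm α p) v i) :=
    ContDiff.sum fun i _ => contDiff_const.mul (contDiff_pi.1 (contDiff_formVec (basicForm α p)) i)
  have hs : ContDiffOn ℝ ∞ (fE (normOf (relMetric α c)) p) {v | v ≠ 0} := by
    rw [hF]
    intro v hv
    exact (hq.contDiffAt.sqrt (sum_mul_pos hc (fun i => h.nonneg i v)
      (h.formVec_ne_zero hv)).ne').contDiffWithinAt
  rw [isGeodesicVector_iff (BilinInv.normOf hinv c) hsub hs hX]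
  refine forall_congr' fun Z => ?_
  have hF2 : (fun v => fE (normOf (relMetric α c)) p v ^ 2) =
      fun v => ∑ i, c i * formVec (basicForm α p) v i := by
    ext v
    rw [hF]
    exact Real.sq_sqrt (Finset.sum_nonneg fun i _ => mul_nonneg (hc i).le (h.nonneg i v))
  have hD : HasFDerivAt (fun v => ∑ i, c i * formVec (basicForm α p) v i)
      (∑ i, c i • (2 : ℝ) • LinearMap.toContinuousLinearMap
        (basicForm α p i (dO n d G p X))) (dO n d G p X) :=
    HasFDerivAt.fun_sum fun i _ =>
      ((hasFDerivAt_pi.1 (h.hasFDerivAt_formVec (dO n d G p X))) i).const_mul (c i)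
  rw [hF2, hD.fderiv]
  simp only [sum_apply, smul_apply, LinearMap.coe_toContinuousLinearMap', smul_eq_mul]
  have : ∑ i, c i * (2 * basicForm α p i (dO n d G p X) (dO n d G p (brE n G X Z))) =
      2 * ∑ i, c i * basicForm α p i (dO n d G p X) (dO n d G p (brE n G X Z)) := by
    rw [Finset.mul_sum]
    exact Finset.sum_congr rfl fun i _ => by ring
  rw [this]
  simp

end Metrics

/-! ### Existence and uniqueness of geodesic graphs -/

section Graph
variable {n d s : ℕ}
  {G : Type*} [TopologicalSpace G] [ChartedSpace (EuclideanSpace ℝ (Fin n)) G] [Group G]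
  [LieGroup (𝓡 n) ∞ G]
  {M : Type*} [TopologicalSpace M] [ChartedSpace (EuclideanSpace ℝ (Fin d)) M]
  [IsManifold (𝓡 d) ∞ M] [MulAction G M] [ContMDiffSMul (𝓡 n) (𝓡 d) ∞ G M]
  {p : M} {m : Submodule ℝ (GroupLieAlgebra (𝓡 n) G)} {α : Fin s → BilinField d M}

/-- An element of a subspace of `𝔤` as a vector of the model space. -/
def subE (V : Submodule ℝ (GroupLieAlgebra (𝓡 n) G)) (y : V) : Eu n :=
  (y : GroupLieAlgebra (𝓡 n) G)

omit [LieGroup (𝓡 n) ∞ G] in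
theorem subE_injective (V : Submodule ℝ (GroupLieAlgebra (𝓡 n) G)) :
    Function.Injective (subE V) := Subtype.val_injective

/-- The condition for `X` to be a geodesic vector of the metric `∑ cⁱ αᵢ`. -/
def GeoCond (α : Fin s → BilinField d M) (G : Type*) [TopologicalSpace G]
    [ChartedSpace (EuclideanSpace ℝ (Fin n)) G] [Group G] [MulAction G M] (p : M)
    (c : Fin s → ℝ) (X : Eu n) : Prop :=
  ∀ Z : Eu n, ∑ i, c i * basicForm α p i (dO n d G p X) (dO n d G p (brE n G X Z)) = 0

/-- The geodesic vectors of `F` are those of the metric `∑ φᵢ αᵢ`, whose coefficients depend on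
the vector. -/
structure HasCoeff (G : Type*) [TopologicalSpace G]
    [ChartedSpace (EuclideanSpace ℝ (Fin n)) G] [Group G] [MulAction G M] (p : M)
    (α : Fin s → BilinField d M) (F : FinslerFun d M) (φ : (Fin s → ℝ) → Fin s → ℝ) : Prop where
  pos : ∀ t, (∀ i, 0 ≤ t i) → t ≠ 0 → ∀ i, 0 < φ t i
  iff : ∀ X : Eu n, dO n d G p X ≠ 0 → (IsGeodesicVector (n := n) (G := G) F p X ↔
    GeoCond α G p (φ (formVec (basicForm α p) (dO n d G p X))) X)

theorem hasCoeff_combine [T2Space G] [T2Space M] [MulAction.IsPretransitive G M]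
    (hsub : Function.Surjective (dO n d G p)) {k : ℕ} {L : (Fin k → ℝ) → ℝ}
    {c : Fin k → Fin s → ℝ} (hL : Admissible L) (hc : ∀ j i, 0 < c j i)
    (hinv : ∀ i, BilinInv G (α i)) (h : IsFormFamily (basicForm α p)) :
    HasCoeff (n := n) G p α (combine L fun j => relMetric α (c j)) (combPartial L c) :=
  ⟨fun _ ht ht0 => hL.combPartial_pos hc (normVec_pos hc ht ht0),
    fun _ hX => isGeodesicVector_combine_iff hsub hL hc hinv h hX⟩

theorem hasCoeff_normOf [T2Space G] [T2Space M] [MulAction.IsPretransitive G M]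
    (hsub : Function.Surjective (dO n d G p)) {c : Fin s → ℝ} (hc : ∀ i, 0 < c i)
    (hinv : ∀ i, BilinInv G (α i)) (h : IsFormFamily (basicForm α p)) :
    HasCoeff (n := n) G p α (normOf (relMetric α c)) (fun _ => c) :=
  ⟨fun _ _ _ => hc, fun _ hX => isGeodesicVector_normOf_iff hsub hc hinv h hX⟩

theorem dO_isotropy (η : isotropyAlg n d G p) : dO n d G p (subE _ η) = 0 := η.2

omit [ContMDiffSMul (𝓡 n) (𝓡 d) ∞ G M] [IsManifold (𝓡 d) ∞ M] in
theorem dO_ne_zero (hm : IsReductive d p m) {y : m} (hy : y ≠ 0) : dO n d G p (subE m y) ≠ 0 := by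
  intro h
  have h1 : (y : GroupLieAlgebra (𝓡 n) G) ∈ isotropyAlg n d G p := h
  have h2 := (Submodule.disjoint_def.1 hm.1.disjoint) _ h1 y.2
  exact hy (Subtype.ext h2)

theorem exists_add_of_isCompl {K V : Submodule ℝ (Eu n)} (h : IsCompl K V) (X : Eu n) :
    ∃ a ∈ K, ∃ b ∈ V, a + b = X :=
  Submodule.mem_sup.1 (h.sup_eq_top ▸ Submodule.mem_top (x := X))

theorem exists_dO_eq (hsub : Function.Surjective (dO n d G p)) (hm : IsReductive d p m)
    (v : Eu d) : ∃ y : m, dO n d G p (subE m y) = v := by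
  obtain ⟨X, rfl⟩ := hsub v
  obtain ⟨η, hη, y, hy, hX⟩ := exists_add_of_isCompl (K := (dO n d G p).toLinearMap.ker) hm.1 X
  refine ⟨⟨y, hy⟩, ?_⟩
  have hη0 : dO n d G p η = 0 := hη
  rw [← hX, map_add, hη0, zero_add]
  rfl

/-- `Ad(H)`-equivariance, on the model spaces. -/
def EquivGraph (d : ℕ) {G : Type*} [TopologicalSpace G]
    [ChartedSpace (EuclideanSpace ℝ (Fin n)) G] [Group G] {M : Type*} [TopologicalSpace M]
    [ChartedSpace (EuclideanSpace ℝ (Fin d)) M] [MulAction G M] {p : M}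
    {m : Submodule ℝ (GroupLieAlgebra (𝓡 n) G)} (ξ : m → isotropyAlg n d G p) : Prop :=
  ∀ h : G, h • p = p → ∀ y y' : m, subE m y' = AdE n h (subE m y) →
    subE _ (ξ y') = AdE n h (subE _ (ξ y))

theorem HasCoeff.graph_iff {F : FinslerFun d M} {φ : (Fin s → ℝ) → Fin s → ℝ}
    (hF : HasCoeff (n := n) G p α F φ) (hm : IsReductive d p m) (ξ : m → isotropyAlg n d G p) :
    IsGeodesicGraph F p m ξ ↔ EquivGraph d ξ ∧ ∀ y : m, y ≠ 0 →
      GeoCond α G p (φ (formVec (basicForm α p) (dO n d G p (subE m y))))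
        (subE m y + subE _ (ξ y)) := by
  have hd : ∀ y, dO n d G p (subE m y + subE _ (ξ y)) = dO n d G p (subE m y) := fun y => by
    rw [map_add, dO_isotropy, add_zero]
  constructor
  · intro h
    refine ⟨fun g hg => h.equivariant g hg, fun y hy => ?_⟩
    have h1 := (hF.iff (subE m y + subE _ (ξ y)) (by rw [hd]; exact dO_ne_zero hm hy)).1
      (h.geodesic y hy)
    rwa [hd] at h1
  · rintro ⟨h1, h2⟩
    refine ⟨fun g hg => h1 g hg, fun y hy => ?_⟩
    refine (hF.iff (subE m y + subE _ (ξ y)) (by rw [hd]; exact dO_ne_zero hm hy)).2 ?_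
    rw [hd]
    exact h2 y hy

theorem formVec_AdE (hinv : ∀ i, BilinInv G (α i)) {h : G} (hh : h • p = p) (X : Eu n) :
    formVec (basicForm α p) (dO n d G p (AdE n h X)) =
      formVec (basicForm α p) (dO n d G p X) :=
  funext fun i => (hinv i).apply_AdE_stab hh X X

variable [T2Space G] [T2Space M] [MulAction.IsPretransitive G M]

/-- A geodesic graph of `F` is glued from geodesic graphs of the metrics `∑ cⁱ αᵢ`. -/
theorem HasCoeff.exists_graph {F : FinslerFun d M} {φ : (Fin s → ℝ) → Fin s → ℝ}
    (hF : HasCoeff (n := n) G p α F φ) (hsub : Function.Surjective (dO n d G p))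
    (hm : IsReductive d p m) (hinv : ∀ i, BilinInv G (α i))
    (h : IsFormFamily (basicForm α p))
    (hex : ∀ c : Fin s → ℝ, (∀ i, 0 < c i) → ∃ ξ, IsGeodesicGraph (normOf (relMetric α c)) p m ξ) :
    ∃ ξ, IsGeodesicGraph F p m ξ := by
  classical
  choose Ξ hΞ using hex
  have hgr := fun c hc => ((hasCoeff_normOf hsub hc hinv h).graph_iff hm _).1 (hΞ c hc)
  -- At `y` the metric with coefficients `φ(t(y))` is used. The value at `y = 0` is immaterial; it
  -- only has to be positive.
  set cf : m → Fin s → ℝ := fun y =>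
    if y = 0 then fun _ => 1 else φ (formVec (basicForm α p) (dO n d G p (subE m y))) with hcf
  have hcpos : ∀ y i, 0 < cf y i := by
    intro y i
    by_cases hy : y = 0
    · simp [hcf, hy]
    · simp only [hcf, hy, if_false]
      exact hF.pos _ (fun i => h.nonneg i _) (h.formVec_ne_zero (dO_ne_zero hm hy)) i
  have hΞc : ∀ c hc c' hc' y, c = c' → Ξ c hc y = Ξ c' hc' y := by
    rintro c hc c' hc' y rfl
    rfl
  refine ⟨fun y => Ξ (cf y) (hcpos y) y, (hF.graph_iff hm _).2 ⟨?_, ?_⟩⟩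
  · intro g hg y y' hy
    -- `t(y)` is `Ad(H)`-invariant, so one metric serves a whole orbit and its graph hands down
    -- equivariance.
    have hc : cf y' = cf y := by
      have h0 : y' = 0 ↔ y = 0 := by
        constructor
        · rintro rfl
          have h1 : AdE n g⁻¹ (subE m (0 : m)) = subE m y := by rw [hy, AdE_inv_AdE]
          have h2 : AdE n g⁻¹ (subE m (0 : m)) = 0 := map_zero _
          exact subE_injective m (h1.symm.trans h2)
        · rintro rfl
          exact subE_injective m (hy.trans (map_zero _))
      by_cases hy0 : y = 0
      · simp [hcf, hy0, h0.2 hy0]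
      · have hy0' : y' ≠ 0 := fun h => hy0 (h0.1 h)
        simp only [hcf, hy0, hy0', if_false]
        rw [hy, formVec_AdE hinv hg]
    change subE _ (Ξ (cf y') (hcpos y') y') = _
    rw [hΞc _ (hcpos y') _ (hcpos y) y' hc]
    exact (hgr _ (hcpos y)).1 g hg y y' hy
  · intro y hy
    have h1 := (hgr _ (hcpos y)).2 y hy
    have h2 : cf y = φ (formVec (basicForm α p) (dO n d G p (subE m y))) := by simp [hcf, hy]
    simpa only [h2] using h1

theorem isGeodesicOrbit_of_graph {F : FinslerFun d M} (hsub : Function.Surjective (dO n d G p))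
    (hm : IsReductive d p m) (hex : ∃ ξ, IsGeodesicGraph F p m ξ) :
    IsGeodesicOrbit n G F p := by
  obtain ⟨ξ, hξ⟩ := hex
  have key : ∀ v : Eu d, v ≠ 0 → ∃ X : Eu n, dO n d G p X = v ∧
      IsGeodesicVector (n := n) (G := G) F p X := by
    intro v hv
    obtain ⟨y, rfl⟩ := exists_dO_eq hsub hm v
    refine ⟨subE m y + subE _ (ξ y), by rw [map_add, dO_isotropy, add_zero], hξ.geodesic y ?_⟩
    rintro rfl
    exact hv (map_zero _)
  exact key

/-- Put `η = ζ - ζ'`. Subtracting the two conditions and using that `η` acts by skew endomorphisms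
gives `∑ cᵢ αᵢ([η, y], Z) = 0` for all `Z`; take `Z = [η, y]`. -/
theorem GeoCond.bracket_eq_zero (hinv : ∀ i, BilinInv G (α i))
    (h : IsFormFamily (basicForm α p)) {c : Fin s → ℝ} (hc : ∀ i, 0 < c i) {y ζ ζ' : Eu n}
    (hζ : dO n d G p ζ = 0) (hζ' : dO n d G p ζ' = 0) (h1 : GeoCond α G p c (y + ζ))
    (h2 : GeoCond α G p c (y + ζ')) : dO n d G p (brE n G (ζ - ζ') y) = 0 := by
  have hη : dO n d G p (ζ - ζ') = 0 := by rw [map_sub, hζ, hζ', sub_zero]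
  have h3 : ∀ Z, ∑ i, c i * basicForm α p i (dO n d G p (brE n G (ζ - ζ') y)) (dO n d G p Z) = 0 := by
    intro Z
    have e1 : dO n d G p (y + ζ) = dO n d G p y := by rw [map_add, hζ, add_zero]
    have e2 : dO n d G p (y + ζ') = dO n d G p y := by rw [map_add, hζ', add_zero]
    have h4 := h1 Z
    have h5 := h2 Z
    rw [e1] at h4
    rw [e2] at h5
    have h6 : ∀ i, basicForm α p i (dO n d G p (brE n G (ζ - ζ') y)) (dO n d G p Z) =
        basicForm α p i (dO n d G p y) (dO n d G p (brE n G (y + ζ') Z)) -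
          basicForm α p i (dO n d G p y) (dO n d G p (brE n G (y + ζ) Z)) := by
      intro i
      have h7 := (hinv i).brE_skew hη y Z
      have h8 : brE n G (ζ - ζ') Z = brE n G (y + ζ) Z - brE n G (y + ζ') Z := by
        rw [← brL_apply, ← brL_apply, ← brL_apply, ← LinearMap.sub_apply, ← map_sub]
        congr 2
        abel
      rw [h8, map_sub, map_sub] at h7
      have h9 : ∀ a b, basicForm α p i a b = bE (α i) p a b := fun _ _ => rfl
      rw [h9, h9, h9]
      linarith
    simp only [h6, mul_sub, Finset.sum_sub_distrib, h4, h5, sub_zero]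
  have h4 := h3 (brE n G (ζ - ζ') y)
  by_contra hne
  exact (sum_mul_pos hc (fun i => h.nonneg i _) (h.formVec_ne_zero hne)).ne' h4

/-- The extra term is `αᵢ(y, [η, Z]) = -αᵢ([η, y], Z) = 0`. The condition on `η` does not involve
`c`, so a correction found for one metric is valid for all. -/
theorem GeoCond.add_isotropy (hinv : ∀ i, BilinInv G (α i)) {c : Fin s → ℝ} {X y η : Eu n}
    (hX : dO n d G p X = dO n d G p y)
    (hη : dO n d G p η = 0) (h1 : GeoCond α G p c X)
    (h2 : dO n d G p (brE n G η y) = 0) : GeoCond α G p c (X + η) := by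
  intro Z
  have h3 := h1 Z
  have e1 : dO n d G p (X + η) = dO n d G p X := by rw [map_add, hη, add_zero]
  rw [e1]
  rw [← h3]
  refine Finset.sum_congr rfl fun i _ => ?_
  have h7 := (hinv i).brE_skew hη y Z
  rw [h2, map_zero, LinearMap.zero_apply, zero_add] at h7
  rw [brE_add_left, map_add, map_add, hX]
  have h9 : basicForm α p i (dO n d G p y) (dO n d G p (brE n G η Z)) = 0 := h7
  rw [h9, add_zero]

/-- If the graphs of one metric of the family are unique, so are those of `F`: the difference of
two graphs of `F` could be added to a graph of that metric. -/
theorem HasCoeff.unique_graph {F : FinslerFun d M} {φ : (Fin s → ℝ) → Fin s → ℝ}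
    (hF : HasCoeff (n := n) G p α F φ) (hsub : Function.Surjective (dO n d G p))
    (hm : IsReductive d p m) (hinv : ∀ i, BilinInv G (α i))
    (h : IsFormFamily (basicForm α p)) {c : Fin s → ℝ} (hc : ∀ i, 0 < c i)
    (hu : HasUniqueGeodesicGraph (normOf (relMetric α c)) p m) :
    ∃ U : Set m, IsOpen U ∧ Dense U ∧
      ∀ ξ ξ', IsGeodesicGraph F p m ξ → IsGeodesicGraph F p m ξ' → ∀ y ∈ U, ξ y = ξ' y := by
  classical
  obtain ⟨⟨ξ₁, hξ₁⟩, U, hUo, hUd, hU⟩ := hu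
  refine ⟨U, hUo, hUd, fun ξ ξ' hξ hξ' y hy => ?_⟩
  have hR := hasCoeff_normOf (n := n) hsub hc hinv h
  obtain ⟨hE, hG⟩ := (hF.graph_iff hm _).1 hξ
  obtain ⟨hE', hG'⟩ := (hF.graph_iff hm _).1 hξ'
  obtain ⟨hE₁, hG₁⟩ := (hR.graph_iff hm _).1 hξ₁
  set η : Eu n := subE _ (ξ y) - subE _ (ξ' y) with hη
  have hη0 : dO n d G p η = 0 := by rw [hη, map_sub, dO_isotropy, dO_isotropy, sub_zero]
  have hbr : dO n d G p (brE n G η (subE m y)) = 0 := by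
    by_cases hy0 : y = 0
    · have : subE m y = 0 := by rw [hy0]; rfl
      rw [this, ← brL_apply, map_zero, map_zero]
    · exact GeoCond.bracket_eq_zero hinv h (hF.pos _ (fun i => h.nonneg i _)
        (h.formVec_ne_zero (dO_ne_zero hm hy0))) (dO_isotropy _) (dO_isotropy _)
        (hG y hy0) (hG' y hy0)
  -- Both graphs being equivariant, `η` is fixed by the stabilizer of `y` in `H`; hence `Ad g y ↦ Ad
  -- g η` is well defined on the orbit of `y`.
  have hfix : ∀ g : G, g • p = p → AdE n g (subE m y) = subE m y → AdE n g η = η := by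
    intro g hg hgy
    rw [hη, map_sub, ← hE g hg y y hgy.symm, ← hE' g hg y y hgy.symm]
  have hAdη : ∀ g : G, g • p = p → dO n d G p (AdE n g η) = 0 := fun g hg => by
    rw [← dO_AdE_stab hg, hη0, map_zero]
  set P : m → Prop := fun z => ∃ g : G, g • p = p ∧ subE m z = AdE n g (subE m y) with hP
  -- The graph `ξ₁` of the metric `c`, altered by the transported `η` on the orbit of `y` only. It
  -- is again a graph, so uniqueness at `y` forces `η = 0`.
  set ξ₂ : m → isotropyAlg n d G p := fun z =>
    if hz : P z then ⟨subE _ (ξ₁ z) + AdE n hz.choose η, by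
      change dO n d G p (subE _ (ξ₁ z) + AdE n hz.choose η) = 0
      rw [map_add, dO_isotropy, hAdη _ hz.choose_spec.1, add_zero]⟩ else ξ₁ z with hξ₂
  have hin : ∀ (z : m) (g : G), g • p = p → subE m z = AdE n g (subE m y) →
      subE _ (ξ₂ z) = subE _ (ξ₁ z) + AdE n g η := by
    intro z g hg hgz
    have hz : P z := ⟨g, hg, hgz⟩
    have h1 : subE _ (ξ₂ z) = subE _ (ξ₁ z) + AdE n hz.choose η := by
      simp only [hξ₂, hz, dif_pos]
      rfl
    rw [h1]
    congr 1
    have h2 := hz.choose_spec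
    have h3 : AdE n (g⁻¹ * hz.choose) (subE m y) = subE m y := by
      rw [AdE_mul_apply, ← h2.2, hgz, AdE_inv_AdE]
    have h4 := hfix (g⁻¹ * hz.choose) (by rw [mul_smul, h2.1, inv_smul_eq_iff, hg]) h3
    rw [AdE_mul_apply] at h4
    rw [← AdE_AdE_inv g (AdE n hz.choose η), h4]
  have hout : ∀ z : m, ¬ P z → ξ₂ z = ξ₁ z := fun z hz => by simp only [hξ₂, hz, dif_neg, not_false_iff]
  have hξ₂g : IsGeodesicGraph (normOf (relMetric α c)) p m ξ₂ := by
    refine (hR.graph_iff hm _).2 ⟨?_, ?_⟩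
    · intro g hg z z' hz'
      by_cases hz : P z
      · obtain ⟨g', hg', hgz⟩ := hz
        have h1 : subE m z' = AdE n (g * g') (subE m y) := by rw [hz', hgz, AdE_mul_apply]
        rw [hin z g' hg' hgz, hin z' (g * g') (by rw [mul_smul, hg', hg]) h1, map_add,
          AdE_mul_apply, hE₁ g hg z z' hz']
      · have hz2 : ¬ P z' := by
          rintro ⟨g', hg', hgz⟩
          refine hz ⟨g⁻¹ * g', by rw [mul_smul, hg', inv_smul_eq_iff, hg], ?_⟩
          rw [AdE_mul_apply, ← hgz, hz', AdE_inv_AdE]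
        rw [hout z hz, hout z' hz2]
        exact hE₁ g hg z z' hz'
    · intro z hz0
      by_cases hz : P z
      · obtain ⟨g', hg', hgz⟩ := hz
        rw [hin z g' hg' hgz, ← add_assoc]
        refine GeoCond.add_isotropy hinv (y := subE m z) ?_ (hAdη g' hg') (hG₁ z hz0) ?_
        · rw [map_add, dO_isotropy, add_zero]
        · rw [hgz, ← AdE_brE, ← dO_AdE_stab hg', hbr, map_zero]
      · rw [hout z hz]
        exact hG₁ z hz0
  have h1 := hU _ _ hξ₁ hξ₂g y hy
  have h2 := hin y 1 (one_smul _ _) (by rw [AdE_one]; rfl)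
  rw [← h1, AdE_one] at h2
  have h3 : η = 0 := (left_eq_add (a := subE _ (ξ₁ y)) (b := η)).1 h2
  exact subE_injective _ (sub_eq_zero.1 h3)

end Graph

/-! ### The functions `powerL`: admissibility, and metrics that are not Riemannian -/

section Power
variable {k : ℕ} {q : ℝ}

theorem hasDerivAt_powSum_line {x v : Fin k → ℝ} (q : ℝ) {t : ℝ} (hx : ∀ j, 0 < x j + t * v j) :
    HasDerivAt (fun t : ℝ => ∑ j, (x j + t * v j) ^ q)
      (∑ j, q * (x j + t * v j) ^ (q - 1) * v j) t := by
  refine HasDerivAt.fun_sum fun j _ => ?_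
  have h1 : HasDerivAt (fun t => x j + t * v j) (v j) t := by
    simpa using ((hasDerivAt_id t).mul_const (v j)).const_add (x j)
  refine (h1.rpow_const (p := q) (Or.inl (hx j).ne')).congr_deriv ?_
  ring

theorem contDiffOn_powerL (k : ℕ) (q : ℝ) (hk : 0 < k) :
    ContDiffOn ℝ ∞ (powerL k q) {x | ∀ i, 0 < x i} := by
  have : Nonempty (Fin k) := ⟨⟨0, hk⟩⟩
  intro x hx
  refine ContDiffAt.contDiffWithinAt ?_
  refine ContDiffAt.rpow_const_of_ne ?_ ?_
  · refine ContDiffAt.sum fun j _ => ?_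
    exact ContDiffAt.rpow_const_of_ne (contDiff_apply ℝ ℝ j).contDiffAt (hx j).ne'
  · exact (Finset.sum_pos (fun j _ => Real.rpow_pos_of_pos (hx j) q) Finset.univ_nonempty).ne'

theorem admissible_powerL (hk : 0 < k) (hq : 2 < q) : Admissible (powerL k q) := by
  have : Nonempty (Fin k) := ⟨⟨0, hk⟩⟩
  have hS : ∀ x : Fin k → ℝ, (∀ i, 0 < x i) → 0 < ∑ j, x j ^ q := fun x hx =>
    Finset.sum_pos (fun j _ => Real.rpow_pos_of_pos (hx j) q) Finset.univ_nonempty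
  have hev : ∀ x v : Fin k → ℝ, (∀ i, 0 < x i) → ∀ᶠ t : ℝ in 𝓝 0, ∀ j, 0 < x j + t * v j := by
    intro x v hx
    refine eventually_all.2 fun j => ?_
    have hcont : ContinuousAt (fun t : ℝ => x j + t * v j) 0 := by fun_prop
    exact hcont.eventually (lt_mem_nhds (by simpa using hx j))
  have hline : ∀ (x v : Fin k → ℝ) (t : ℝ), (∀ j, 0 < x j + t * v j) →
      HasDerivAt (fun t : ℝ => powerL k q (x + t • v))
        ((∑ j, q * (x j + t * v j) ^ (q - 1) * v j) * (2 / q) *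
          (∑ j, (x j + t * v j) ^ q) ^ (2 / q - 1)) t := by
    intro x v t ht
    exact (hasDerivAt_powSum_line q ht).rpow_const (p := 2 / q)
      (Or.inl (hS (fun j => x j + t * v j) ht).ne')
  have hpart : ∀ x : Fin k → ℝ, (∀ i, 0 < x i) → ∀ i, 0 < fderiv ℝ (powerL k q) x (Pi.single i 1) := by
    intro x hx i
    have h1 : HasFDerivAt (powerL k q) (fderiv ℝ (powerL k q) x) x :=
      (((contDiffOn_powerL k q hk).contDiffAt ((isOpen_pos k).mem_nhds hx)).differentiableAt
        (by simp)).hasFDerivAt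
    have h2 : HasDerivAt (fun t : ℝ => x + t • (Pi.single i 1 : Fin k → ℝ)) (Pi.single i 1) 0 := by
      simpa using ((hasDerivAt_id (0 : ℝ)).smul_const (Pi.single i 1 : Fin k → ℝ)).const_add x
    have h3 := HasFDerivAt.comp_hasDerivAt (f := fun t : ℝ => x + t • (Pi.single i 1 : Fin k → ℝ))
      (0 : ℝ) (by simpa using h1) h2
    have h4 := hline x (Pi.single i 1) 0 (by simpa using hx)
    rw [HasDerivAt.unique h3 h4]
    simp only [zero_mul, add_zero]
    refine mul_pos (mul_pos ?_ (by positivity)) (Real.rpow_pos_of_pos (hS x hx) _)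
    rw [Finset.sum_eq_single i (fun j _ hj => by simp [hj]) (by simp)]
    have := Real.rpow_pos_of_pos (hx i) (q - 1)
    simp only [Pi.single_eq_same, mul_one]
    positivity
  refine ⟨?_, contDiffOn_powerL k q hk, ?_, ?_, ?_, ?_, ?_⟩
  · refine Continuous.continuousOn ?_
    refine (Real.continuous_rpow_const (by positivity)).comp ?_
    exact continuous_finsetSum _ fun j _ =>
      (Real.continuous_rpow_const (by linarith)).comp (continuous_apply j)
  · exact fun x hx => Real.rpow_pos_of_pos (hS x hx) _
  · intro r x hr hx
    have h1 : ∑ j, (r • x) j ^ q = r ^ q * ∑ j, x j ^ q := by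
      rw [Finset.mul_sum]
      exact Finset.sum_congr rfl fun j _ => Real.mul_rpow hr.le (hx j)
    unfold powerL
    rw [h1, Real.mul_rpow (by positivity) (Finset.sum_nonneg fun j _ => Real.rpow_nonneg (hx j) q),
      ← Real.rpow_mul hr.le, mul_div_cancel₀ _ (by positivity : q ≠ 0)]
    norm_num
  · exact fun x hx i => (hpart x hx i).le
  · intro x hx v
    have h1 : deriv (fun t : ℝ => powerL k q (x + t • v)) =ᶠ[𝓝 0] fun t =>
        (∑ j, q * (x j + t * v j) ^ (q - 1) * v j) * (2 / q) *
          (∑ j, (x j + t * v j) ^ q) ^ (2 / q - 1) := by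
      filter_upwards [hev x v hx] with t ht using (hline x v t ht).deriv
    have hx0 : ∀ j, 0 < x j + 0 * v j := by simpa using hx
    have h2 : HasDerivAt (fun t : ℝ => ∑ j, q * (x j + t * v j) ^ (q - 1) * v j)
        (∑ j, q * ((q - 1) * x j ^ (q - 1 - 1) * v j) * v j) 0 := by
      refine HasDerivAt.fun_sum fun j _ => ?_
      have h1 : HasDerivAt (fun t => x j + t * v j) (v j) 0 := by
        simpa using ((hasDerivAt_id (0 : ℝ)).mul_const (v j)).const_add (x j)
      refine (((h1.rpow_const (p := q - 1) (Or.inl (hx0 j).ne')).const_mul q).mul_const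
        (v j)).congr_deriv ?_
      simp only [zero_mul, add_zero]
      ring
    have h3 := (hasDerivAt_powSum_line q hx0).rpow_const (p := 2 / q - 1) (Or.inl (hS _ hx0).ne')
    have h4 := (h2.mul_const (2 / q)).mul h3
    rw [iteratedDeriv_succ, iteratedDeriv_one, h1.deriv_eq]
    refine (h4.deriv).symm ▸ ?_
    simp only [zero_mul, add_zero]
    set S := ∑ j, x j ^ q with hSd
    have hSp : 0 < S := hS x hx
    set A := ∑ j, x j ^ (q - 1) * v j with hA
    set B := ∑ j, x j ^ (q - 1 - 1) * v j ^ 2 with hB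
    have e1 : ∑ j, q * ((q - 1) * x j ^ (q - 1 - 1) * v j) * v j = q * (q - 1) * B := by
      rw [hB, Finset.mul_sum]
      exact Finset.sum_congr rfl fun j _ => by ring
    have e2 : ∑ j, q * x j ^ (q - 1) * v j = q * A := by
      rw [hA, Finset.mul_sum]
      exact Finset.sum_congr rfl fun j _ => by ring
    rw [e1, e2]
    -- Cauchy–Schwarz for the splitting `x^(q-1) = x^(q/2) x^(q/2-1)`. The second derivative is `2 T
    -- ((q-1) S B - (q-2) A²)`, which is at least `2 T A²`.
    have hCS : A ^ 2 ≤ S * B := by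
      have := Finset.sum_mul_sq_le_sq_mul_sq Finset.univ (fun j => x j ^ (q / 2))
        (fun j => x j ^ (q / 2 - 1) * v j)
      have f1 : ∀ j, x j ^ (q / 2) * (x j ^ (q / 2 - 1) * v j) = x j ^ (q - 1) * v j := fun j => by
        rw [← mul_assoc, ← Real.rpow_add (hx j)]
        ring_nf
      have f2 : ∀ j, (x j ^ (q / 2)) ^ 2 = x j ^ q := fun j => by
        rw [← Real.rpow_natCast, ← Real.rpow_mul (hx j).le]
        norm_num
      have f3 : ∀ j, (x j ^ (q / 2 - 1) * v j) ^ 2 = x j ^ (q - 1 - 1) * v j ^ 2 := fun j => by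
        rw [mul_pow, ← Real.rpow_natCast (x j ^ (q / 2 - 1)), ← Real.rpow_mul (hx j).le]
        congr 2
        push_cast
        ring
      simpa only [f1, f2, f3] using this
    have e3 : S ^ (2 / q - 1) = S * S ^ (2 / q - 1 - 1) := by
      rw [← Real.rpow_one_add' hSp.le]
      · congr 1; ring
      · have : (0 : ℝ) < 2 / q := by positivity
        have h5 : 2 / q < 1 := (div_lt_one (by linarith)).2 hq
        intro h
        linarith
    rw [e3]
    set T := S ^ (2 / q - 1 - 1) with hT
    have hTp : 0 < T := Real.rpow_pos_of_pos hSp _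
    have e4 : q * (q - 1) * B * (2 / q) * (S * T) + q * A * (2 / q) * (q * A * (2 / q - 1) * T) =
        2 * T * ((q - 1) * (S * B) + (2 - q) * A ^ 2) := by
      field_simp
    rw [e4]
    refine mul_nonneg (by positivity) ?_
    nlinarith [sq_nonneg A, mul_le_mul_of_nonneg_left hCS (by linarith : (0 : ℝ) ≤ q - 1)]
  · exact fun x hx => Finset.sum_pos (fun i _ => hpart x hx i) Finset.univ_nonempty

/-- Equality in the Minkowski inequality. -/
theorem powerL_not_additive {r : ℝ} (hr : 1 < r) {C C' : Fin k → ℝ} (hC : ∀ j, 0 < C j)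
    (hC' : ∀ j, 0 < C' j) {j₁ j₂ : Fin k} (hne : C j₁ * C' j₂ ≠ C j₂ * C' j₁) (A B : ℝ) :
    ¬ ∀ u w : ℝ, 0 ≤ u → 0 ≤ w → (∑ j, (u * C j + w * C' j) ^ r) ^ (1 / r) = u * A + w * B := by
  intro h
  have hk : Nonempty (Fin k) := ⟨j₁⟩
  have hr0 : 0 < r := by linarith
  have hpow : ∀ D : Fin k → ℝ, (∀ j, 0 < D j) → ∀ a, (∑ j, D j ^ r) ^ (1 / r) = a →
      0 < a ∧ ∑ j, D j ^ r = a ^ r := by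
    rintro D hD a rfl
    have hS : 0 < ∑ j, D j ^ r :=
      Finset.sum_pos (fun j _ => Real.rpow_pos_of_pos (hD j) r) Finset.univ_nonempty
    refine ⟨Real.rpow_pos_of_pos hS _, ?_⟩
    rw [← Real.rpow_mul hS.le, one_div_mul_cancel hr0.ne', Real.rpow_one]
  obtain ⟨hA, hA'⟩ := hpow C hC A (by simpa using h 1 0 zero_le_one le_rfl)
  obtain ⟨hB, hB'⟩ := hpow C' hC' B (by simpa using h 0 1 le_rfl zero_le_one)
  -- `C/A` and `C'/B` lie on the unit sphere of the `ℓʳ`-norm, and additivity puts their midpoint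
  -- there too. Strict convexity of `x ↦ xʳ` then makes them equal coordinate by coordinate.
  have hsum : ∑ j, ((2 : ℝ)⁻¹ * (C j / A) + 2⁻¹ * (C' j / B)) ^ r = 1 := by
    have h1 := hpow (fun j => (2 * A)⁻¹ * C j + (2 * B)⁻¹ * C' j)
      (fun j => by have := hC j; have := hC' j; positivity) 1
      (by rw [h _ _ (by positivity) (by positivity)]; field_simp; norm_num)
    rw [Real.one_rpow] at h1
    rw [← h1.2]
    refine Finset.sum_congr rfl fun j _ => ?_
    congr 1
    field_simp
  have hdiv : ∀ D : Fin k → ℝ, (∀ j, 0 < D j) → ∀ a, 0 < a → ∑ j, D j ^ r = a ^ r →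
      ∑ j, (D j / a) ^ r = 1 := by
    intro D hD a ha hDa
    have h1 : ∀ j, (D j / a) ^ r = D j ^ r / a ^ r := fun j => Real.div_rpow (hD j).le ha.le r
    simp only [h1]
    rw [← Finset.sum_div, hDa, div_self (Real.rpow_pos_of_pos ha r).ne']
  have hP := hdiv C hC A hA hA'
  have hP' := hdiv C' hC' B hB hB'
  have hconv := strictConvexOn_rpow hr
  have hle : ∀ j, ((2 : ℝ)⁻¹ * (C j / A) + 2⁻¹ * (C' j / B)) ^ r ≤
      2⁻¹ * (C j / A) ^ r + 2⁻¹ * (C' j / B) ^ r := by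
    intro j
    have := hconv.convexOn.2 (div_pos (hC j) hA).le
      (div_pos (hC' j) hB).le (by norm_num : (0 : ℝ) ≤ 2⁻¹) (by norm_num : (0 : ℝ) ≤ 2⁻¹) (by norm_num)
    simpa using this
  have heq : ∑ j, ((2 : ℝ)⁻¹ * (C j / A) + 2⁻¹ * (C' j / B)) ^ r =
      ∑ j, (2⁻¹ * (C j / A) ^ r + 2⁻¹ * (C' j / B) ^ r) := by
    rw [hsum, Finset.sum_add_distrib, ← Finset.mul_sum, ← Finset.mul_sum, hP, hP']
    norm_num
  have hall := (Finset.sum_eq_sum_iff_of_le (fun j _ => hle j)).1 heq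
  have hpt : ∀ j, C j / A = C' j / B := by
    intro j
    by_contra hj
    have := hconv.2 (div_pos (hC j) hA).le
      (div_pos (hC' j) hB).le hj (by norm_num : (0 : ℝ) < 2⁻¹) (by norm_num : (0 : ℝ) < 2⁻¹) (by norm_num)
    simp only [smul_eq_mul] at this
    exact this.ne (hall j (Finset.mem_univ j))
  have h1 := hpt j₁
  have h2 := hpt j₂
  rw [div_eq_div_iff hA.ne' hB.ne'] at h1 h2
  apply hne
  have h3 : (C j₁ * C' j₂ - C j₂ * C' j₁) * (A * B) = 0 := by
    linear_combination (C' j₂ * A) * h1 - (C' j₁ * A) * h2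
  have h4 := (mul_eq_zero.1 h3).resolve_right (by positivity)
  linarith

/-- On a plane spanned by `e` tangent to `𝔪ᵢ` and `e'` tangent to `𝔪ᵢ'`, the value `F²(a e + a' e')`
is the `ℓ^(q/2)`-norm of the vector with entries `a² C_j + a'² C'_j`. If `F²` were bilinear, this
norm would be additive in `(a², a'²)`, against `powerL_not_additive`. -/
theorem not_isRiemannianAt_power {n d s : ℕ} {G : Type*} [TopologicalSpace G]
    [ChartedSpace (EuclideanSpace ℝ (Fin n)) G] [Group G] [LieGroup (𝓡 n) ∞ G]
    {M : Type*} [TopologicalSpace M] [ChartedSpace (EuclideanSpace ℝ (Fin d)) M] [IsManifold (𝓡 d) ∞ M] [MulAction G M]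
    [ContMDiffSMul (𝓡 n) (𝓡 d) ∞ G M] {p : M} {m : Submodule ℝ (GroupLieAlgebra (𝓡 n) G)}
    {ms : Fin s → Submodule ℝ (GroupLieAlgebra (𝓡 n) G)}
    {α : Fin s → BilinField d M} (hms : IsIrredDecomposition p m ms) (hα : IsBasicForms p ms α)
    (hq : 2 < q) {c : Fin k → Fin s → ℝ} (hc : ∀ j i, 0 < c j i)
    (hne : ∃ j j' i i', c j i * c j' i' ≠ c j' i * c j i') :
    ¬ IsRiemannianAt (combine (powerL k q) fun j => relMetric α (c j)) p := by
  obtain ⟨j₁, j₂, i, i', hne⟩ := hne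
  have hii : i ≠ i' := by
    rintro rfl
    exact hne (mul_comm _ _)
  rintro ⟨b, hb⟩
  obtain ⟨x, hx, hx0⟩ := Submodule.exists_mem_ne_zero_of_ne_bot (hms.1 i).1
  obtain ⟨x', hx', hx0'⟩ := Submodule.exists_mem_ne_zero_of_ne_bot (hms.1 i').1
  obtain ⟨e, he⟩ : ∃ e : Eu d, e = dO n d G p x := ⟨_, rfl⟩
  obtain ⟨e', he'⟩ : ∃ e' : Eu d, e' = dO n d G p x' := ⟨_, rfl⟩
  set D := basicForm α p i e e with hD
  set D' := basicForm α p i' e' e' with hD'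
  have hDp : 0 < D := by rw [hD, he]; exact hα.basicForm_pos i hx hx0
  have hDp' : 0 < D' := by rw [hD', he']; exact hα.basicForm_pos i' hx' hx0'
  have hform : ∀ a a' : ℝ, ∀ l, formVec (basicForm α p) (a • e + a' • e') l =
      (if l = i then a ^ 2 * D else 0) + (if l = i' then a' ^ 2 * D' else 0) := by
    intro a a' l
    have z1 : ∀ l, l ≠ i → ∀ w, basicForm α p l e w = 0 := fun l hl w => by
      rw [he]; exact hα.basicForm_zero hl hx w
    have z2 : ∀ l, l ≠ i' → ∀ w, basicForm α p l e' w = 0 := fun l hl w => by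
      rw [he']; exact hα.basicForm_zero hl hx' w
    have sy := hα.basicForm_symm l
    by_cases h1 : l = i
    · subst h1
      have h2 := z2 l hii
      simp only [formVec, map_add, map_smul, LinearMap.add_apply, LinearMap.smul_apply, smul_eq_mul,
        h2, sy e e', if_true, hii, if_false]
      rw [hD]; ring
    · by_cases h3 : l = i'
      · subst h3
        have h2 := z1 l h1
        simp only [formVec, map_add, map_smul, LinearMap.add_apply, LinearMap.smul_apply,
          smul_eq_mul, h2, sy e' e, if_true, h1, if_false]
        rw [hD']; ring
      · simp only [formVec, map_add, map_smul, LinearMap.add_apply, LinearMap.smul_apply,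
          smul_eq_mul, z1 l h1, z2 l h3, h1, h3, if_false]
        ring
  have hN : ∀ a a' : ℝ, ∀ j, ∑ l, c j l * formVec (basicForm α p) (a • e + a' • e') l =
      a ^ 2 * (c j i * D) + a' ^ 2 * (c j i' * D') := by
    intro a a' j
    simp only [hform, mul_add, Finset.sum_add_distrib, mul_ite, mul_zero, Finset.sum_ite_eq',
      Finset.mem_univ, if_true]
    ring
  obtain ⟨b', hb'⟩ : ∃ b' : Eu d →ₗ[ℝ] Eu d →ₗ[ℝ] ℝ,
      ∀ v, fE (combine (powerL k q) fun j => relMetric α (c j)) p v ^ 2 = b' v v := ⟨b, hb⟩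
  have hval : ∀ a a' : ℝ, (∑ j, (a ^ 2 * (c j i * D) + a' ^ 2 * (c j i' * D')) ^ (q / 2)) ^ (1 / (q / 2)) =
      b' (a • e + a' • e') (a • e + a' • e') := by
    intro a a'
    rw [← hb', fE_combine, Real.sq_sqrt]
    · unfold powerL normVec
      simp only [hN]
      have : ∀ j, √(a ^ 2 * (c j i * D) + a' ^ 2 * (c j i' * D')) ^ q =
          (a ^ 2 * (c j i * D) + a' ^ 2 * (c j i' * D')) ^ (q / 2) := fun j => by
        have := hc j i
        have := hc j i'
        rw [Real.sqrt_eq_rpow, ← Real.rpow_mul (by positivity)]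
        congr 1
        ring
      simp only [this]
      congr 1
      field_simp
    · exact Real.rpow_nonneg (Finset.sum_nonneg fun j _ =>
        Real.rpow_nonneg (Real.sqrt_nonneg _) _) _
  -- `F²` is unchanged by `e' ↦ -e'`, so a bilinear form representing it has no mixed term.
  have hcross : b' e e' + b' e' e = 0 := by
    have h1 := hval 1 1
    have h2 := hval 1 (-1)
    simp only [neg_sq, one_pow] at h1 h2
    rw [h1] at h2
    simp at h2
    linarith
  refine powerL_not_additive (r := q / 2) (by linarith) (C := fun j => c j i * D)
    (C' := fun j => c j i' * D') (fun j => mul_pos (hc j i) hDp) (fun j => mul_pos (hc j i') hDp')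
    (j₁ := j₁) (j₂ := j₂) ?_ (b' e e) (b' e' e') ?_
  · intro h
    apply hne
    have : (c j₁ i * c j₂ i' - c j₂ i * c j₁ i') * (D * D') = 0 := by linear_combination h
    have := (mul_eq_zero.1 this).resolve_right (by positivity)
    linarith
  · intro u w hu hw
    have h1 := hval √u √w
    rw [Real.sq_sqrt hu, Real.sq_sqrt hw] at h1
    rw [h1]
    simp only [map_add, map_smul, LinearMap.add_apply, LinearMap.smul_apply, smul_eq_mul]
    linear_combination (√u * √w) * hcross + b' e e * (Real.mul_self_sqrt hu) +
      b' e' e' * (Real.mul_self_sqrt hw)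

end Power

/-! ### Algebra of a bracket naturally reductive for all weights -/

section Algebra
variable {s : ℕ} {E : Type*} [NormedAddCommGroup E] [NormedSpace ℝ E]
  {a : Fin s → E →ₗ[ℝ] E →ₗ[ℝ] ℝ} {T : Fin s → Submodule ℝ E}

/-- The space is the sum of the `Tᵢ`, and `aᵢ` vanishes on `Tⱼ` for `j ≠ i`. -/
structure IsOrthoSum (a : Fin s → E →ₗ[ℝ] E →ₗ[ℝ] ℝ) (T : Fin s → Submodule ℝ E) : Prop where
  zero : ∀ i j, i ≠ j → ∀ v ∈ T j, ∀ w, a i v w = 0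
  exists_sum : ∀ v, ∃ u : Fin s → E, (∀ i, u i ∈ T i) ∧ ∑ i, u i = v
  exists_ne : ∀ i, ∃ v ∈ T i, v ≠ 0

theorem IsOrthoSum.zero' (hT : IsOrthoSum a T) (ha : IsFormFamily a) {i j : Fin s} (hij : i ≠ j)
    {v : E} (hv : v ∈ T j) (w : E) : a i w v = 0 := by
  rw [ha.symm, hT.zero i j hij v hv]

theorem IsOrthoSum.apply_sum (hT : IsOrthoSum a T) {u : Fin s → E} (hu : ∀ i, u i ∈ T i)
    (i : Fin s) (w : E) : a i (∑ j, u j) w = a i (u i) w := by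
  rw [map_sum, LinearMap.sum_apply, Finset.sum_eq_single i]
  · exact fun j _ hj => hT.zero i j hj.symm _ (hu j) w
  · simp

theorem IsOrthoSum.formVec_sum (hT : IsOrthoSum a T) (ha : IsFormFamily a) {u : Fin s → E}
    (hu : ∀ i, u i ∈ T i) (i : Fin s) : formVec a (∑ j, u j) i = a i (u i) (u i) := by
  rw [formVec, hT.apply_sum hu, ha.symm, hT.apply_sum hu]

theorem IsOrthoSum.sum_mul_apply (hT : IsOrthoSum a T) {j : Fin s} {v : E} (hv : v ∈ T j)
    (c : Fin s → ℝ) (w : E) : ∑ i, c i * a i v w = c j * a j v w := by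
  rw [Finset.sum_eq_single j]
  · intro i _ hi
    rw [hT.zero i j hi v hv, mul_zero]
  · simp

theorem IsOrthoSum.sum_mul_apply' (hT : IsOrthoSum a T) (ha : IsFormFamily a) {j : Fin s} {v : E}
    (hv : v ∈ T j) (c : Fin s → ℝ) (w : E) : ∑ i, c i * a i w v = c j * a j w v := by
  simp only [fun i => ha.symm i w v]
  exact hT.sum_mul_apply hv c w

theorem IsFormFamily.pos_of_mem (ha : IsFormFamily a) (hT : IsOrthoSum a T) {i : Fin s} {v : E}
    (hv : v ∈ T i) (hv0 : v ≠ 0) : 0 < a i v v := by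
  refine (ha.nonneg i v).lt_of_ne' fun h => hv0 (ha.definite v fun j => ?_)
  by_cases hj : j = i
  · rw [hj, h]
  · exact hT.zero j i hj v hv v

/-- The bracket `b` satisfies the conditions of natural reductivity for all metrics `∑ cᵢ aᵢ`, up to
corrections `R` that come from the choice of the reductive complement. -/
def NatRed (a : Fin s → E →ₗ[ℝ] E →ₗ[ℝ] ℝ) (T : Fin s → Submodule ℝ E) (b : E →ₗ[ℝ] E →ₗ[ℝ] E) :
    Prop :=
  ∀ c : Fin s → ℝ, (∀ i, 0 < c i) → ∃ R : E → E → E, (∀ x k, ∀ z ∈ T k, R x z ∈ T k) ∧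
    ∀ x y z, ∑ i, c i * (a i (b z x - R x z) y + a i x (b z y - R y z)) = 0

variable {b : E →ₗ[ℝ] E →ₗ[ℝ] E}

/-- As `z ∈ T k`, the corrections lie in `T k`, where `a l` and `a j` vanish. What remains involves
the one bracket `b`, whatever the weights. -/
theorem NatRed.apply (hb : NatRed a T b) (hT : IsOrthoSum a T) (ha : IsFormFamily a)
    {c : Fin s → ℝ} (hc : ∀ i, 0 < c i) {j k l : Fin s} (hjk : j ≠ k) (hlk : l ≠ k) {x y z : E}
    (hx : x ∈ T j) (hy : y ∈ T l) (hz : z ∈ T k) :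
    c l * a l (b z x) y + c j * a j x (b z y) = 0 := by
  obtain ⟨R, hR, h⟩ := hb c hc
  have h1 := h x y z
  simp only [mul_add, Finset.sum_add_distrib, hT.sum_mul_apply' ha hy, hT.sum_mul_apply hx] at h1
  rw [map_sub, LinearMap.sub_apply, map_sub, hT.zero l k hlk _ (hR x k z hz),
    hT.zero' ha hjk (hR y k z hz), sub_zero, sub_zero] at h1
  exact h1

theorem NatRed.skew (hb : NatRed a T b) (hT : IsOrthoSum a T) (ha : IsFormFamily a)
    {j k : Fin s} (hjk : j ≠ k) {x y z : E}
    (hx : x ∈ T j) (hy : y ∈ T j) (hz : z ∈ T k) : a j (b z x) y + a j x (b z y) = 0 := by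
  simpa using hb.apply hT ha (c := fun _ => 1) (fun _ => one_pos) hjk hjk hx hy hz

/-- The two terms of `NatRed.apply` do not depend on `c` except for their weights, so changing the
weight of `l` alone separates them. -/
theorem NatRed.distinct (hb : NatRed a T b) (hT : IsOrthoSum a T) (ha : IsFormFamily a)
    {j k l : Fin s} (hjk : j ≠ k) (hlk : l ≠ k) (hlj : l ≠ j) {x y z : E}
    (hx : x ∈ T j) (hy : y ∈ T l) (hz : z ∈ T k) : a l (b z x) y = 0 := by
  have h1 := hb.apply hT ha (c := fun _ => 1) (fun _ => one_pos) hjk hlk hx hy hz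
  have h2 := hb.apply hT ha (c := fun i => if i = l then 2 else 1)
    (fun i => by split_ifs <;> norm_num) hjk hlk hx hy hz
  simp only [if_true, hlj.symm, if_false] at h2
  linarith

/-- The quotient `φ_l / φ_k` is constant. -/
def ConstRatio (φ : (Fin s → ℝ) → Fin s → ℝ) (l k : Fin s) : Prop :=
  ∀ t t' : Fin s → ℝ, (∀ i, 0 < t i) → (∀ i, 0 < t' i) → φ t l * φ t' k = φ t' l * φ t k

/-- Changing the sign of the component in `T l` of a vector preserves `t`, hence the coefficients.
The difference of the two geodesic conditions is `φ_l(t) a_l(v, b u z) + φ_k(t) a_k(u, b v z) = 0`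
up to a factor; two values of `t` with different ratios give an invertible linear system for these
two numbers. -/
theorem NatRed.eq_zero_of_not_constRatio (hb : NatRed a T b) (hT : IsOrthoSum a T)
    (ha : IsFormFamily a) (hbs : ∀ x y, b x y = -b y x) {φ : (Fin s → ℝ) → Fin s → ℝ}
    (hφ : ∀ y z, y ≠ 0 → ∑ i, φ (formVec a y) i * a i y (b y z) = 0)
    {l k : Fin s} (hlk : l ≠ k) (hne : ¬ ConstRatio φ l k) {u z v : E} (hu : u ∈ T k)
    (hz : z ∈ T k) (hv : v ∈ T l) : a l (b u z) v = 0 := by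
  by_cases hu0 : u = 0
  · simp [hu0]
  by_cases hv0 : v = 0
  · simp [hv0]
  have key : ∀ t : Fin s → ℝ, (∀ i, 0 < t i) →
      φ t l * a l v (b u z) + φ t k * a k u (b v z) = 0 := by
    intro t ht
    -- A vector with prescribed `t` is built from components in `T k` and `T l` that are multiples
    -- of `u` and `v`; the other components are arbitrary nonzero vectors, rescaled.
    choose e he using fun i => hT.exists_ne i
    set e' : Fin s → E := fun i => if i = k then u else if i = l then v else e i with he'
    have hemem : ∀ i, e' i ∈ T i := by
      intro i
      simp only [he']
      split_ifs with h1 h2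
      · rw [h1]; exact hu
      · rw [h2]; exact hv
      · exact (he i).1
    have hene : ∀ i, e' i ≠ 0 := by
      intro i
      simp only [he']
      split_ifs with h1 h2
      · exact hu0
      · exact hv0
      · exact (he i).2
    have hek : e' k = u := by simp [he']
    have hel : e' l = v := by simp [he', hlk]
    have hep : ∀ i, 0 < a i (e' i) (e' i) := fun i => ha.pos_of_mem hT (hemem i) (hene i)
    set r : Fin s → ℝ := fun i => √(t i / a i (e' i) (e' i)) with hr
    have hrp : ∀ i, 0 < r i := fun i => Real.sqrt_pos.2 (div_pos (ht i) (hep i))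
    have hr2 : ∀ i, r i * (r i * a i (e' i) (e' i)) = t i := fun i => by
      rw [← mul_assoc, Real.mul_self_sqrt (div_pos (ht i) (hep i)).le,
        div_mul_cancel₀ _ (hep i).ne']
    set w : Fin s → E := fun i => if i = l then 0 else r i • e' i with hw
    have hwmem : ∀ i, w i ∈ T i := by
      intro i
      simp only [hw]
      split_ifs
      · exact zero_mem _
      · exact (T i).smul_mem _ (hemem i)
    have hwk : w k = r k • u := by simp [hw, hlk.symm, hek]
    have hwl : w l = 0 := by simp [hw]
    set W := ∑ i, w i with hW
    have hvec : ∀ ε : ℝ, ε * ε = 1 → formVec a (W + (ε * r l) • v) = t := by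
      intro ε hε
      have h1 : W + (ε * r l) • v = ∑ i, (w i + if i = l then (ε * r l) • v else 0) := by
        rw [Finset.sum_add_distrib]
        simp [hW]
      ext i
      rw [h1, hT.formVec_sum ha (fun i => by
        refine add_mem (hwmem i) ?_
        split_ifs with h
        · rw [h]; exact (T l).smul_mem _ hv
        · exact zero_mem _)]
      by_cases hi : i = l
      · subst hi
        simp only [hwl, if_true, zero_add, map_smul, LinearMap.smul_apply, smul_eq_mul]
        rw [← hr2 i, hel]
        linear_combination (r i * r i * a i v v) * hε
      · simp only [hi, if_false, add_zero, hw, map_smul, LinearMap.smul_apply, smul_eq_mul, hr2]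
    have hne0 : ∀ ε : ℝ, ε * ε = 1 → W + (ε * r l) • v ≠ 0 := by
      intro ε hε h0
      have h1 := congrFun (hvec ε hε) l
      rw [h0] at h1
      simp [formVec] at h1
      exact (ht l).ne h1
    have hp := hφ _ z (hne0 1 (by norm_num))
    have hm := hφ _ z (hne0 (-1) (by norm_num))
    rw [hvec _ (by norm_num)] at hp hm
    have hdiff : ∑ i, φ t i * (a i W (b v z) + a i v (b W z)) = 0 := by
      have h1 : ∑ i, φ t i * (2 * r l * (a i W (b v z) + a i v (b W z))) = 0 := by
        rw [← sub_eq_zero.2 (hp.trans hm.symm), ← Finset.sum_sub_distrib]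
        refine Finset.sum_congr rfl fun i _ => ?_
        simp only [map_add, map_smul, LinearMap.add_apply, LinearMap.smul_apply, smul_eq_mul]
        ring
      have h2 : ∑ i, φ t i * (2 * r l * (a i W (b v z) + a i v (b W z))) =
          2 * r l * ∑ i, φ t i * (a i W (b v z) + a i v (b W z)) := by
        rw [Finset.mul_sum]
        exact Finset.sum_congr rfl fun i _ => by ring
      rw [h2] at h1
      exact (mul_eq_zero.1 h1).resolve_left (mul_pos two_pos (hrp l)).ne'
    simp only [mul_add, Finset.sum_add_distrib, hT.sum_mul_apply hv] at hdiff
    -- The components of `W` in the summands other than `T k` and `T l` contribute nothing by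
    -- `NatRed.distinct`, and the one in `T l` is zero.
    have h3 : a l v (b W z) = r k * a l v (b u z) := by
      rw [hW, map_sum, LinearMap.sum_apply, map_sum, Finset.sum_eq_single k]
      · rw [hwk]; simp
      · intro j _ hj
        by_cases hjl : j = l
        · subst hjl; simp [hwl]
        · rw [hbs, map_neg, ha.symm, hb.distinct hT ha hj hlk (Ne.symm hjl) (hwmem j) hv hz, neg_zero]
      · simp
    have h4 : ∑ i, φ t i * a i W (b v z) = φ t k * (r k * a k u (b v z)) := by
      rw [Finset.sum_eq_single k]
      · rw [hW, hT.apply_sum hwmem, hwk]; simp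
      · intro j _ hj
        rw [hW, hT.apply_sum hwmem]
        by_cases hjl : j = l
        · subst hjl; simp [hwl]
        · rw [hbs, map_neg, ha.symm, hb.distinct hT ha hlk hj hjl hv (hwmem j) hz, neg_zero, mul_zero]
      · simp
    rw [h3, h4] at hdiff
    have h5 : r k * (φ t l * a l v (b u z) + φ t k * a k u (b v z)) = 0 := by
      linear_combination hdiff
    exact (mul_eq_zero.1 h5).resolve_left (hrp k).ne'
  simp only [ConstRatio] at hne
  push Not at hne
  obtain ⟨t, t', ht, ht', hne⟩ := hne
  have h1 := key t ht
  have h2 := key t' ht'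
  have h3 : (φ t l * φ t' k - φ t' l * φ t k) * a l v (b u z) = 0 := by
    linear_combination φ t' k * h1 - φ t k * h2
  rw [ha.symm]
  exact (mul_eq_zero.1 h3).resolve_left (sub_ne_zero.2 hne)

/-- The summands outside a set `A` of indices act by skew endomorphisms on the forms with index in
`A`, provided that the coefficients with indices in and outside `A` are not proportional. -/
theorem NatRed.killing (hb : NatRed a T b) (hT : IsOrthoSum a T)
    (ha : IsFormFamily a) (hbs : ∀ x y, b x y = -b y x) {φ : (Fin s → ℝ) → Fin s → ℝ}
    (hφ : ∀ y z, y ≠ 0 → ∑ i, φ (formVec a y) i * a i y (b y z) = 0) {A : Finset (Fin s)}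
    (hA : ∀ l ∈ A, ∀ k ∉ A, ¬ ConstRatio φ l k) {f : E} (hf : ∀ i ∈ A, a i f f = 0) (c : Fin s → ℝ)
    (x y : E) : ∑ i ∈ A, c i * (a i (b f x) y + a i x (b f y)) = 0 := by
  obtain ⟨u, hu, rfl⟩ := hT.exists_sum f
  obtain ⟨x, hx, rfl⟩ := hT.exists_sum x
  obtain ⟨y, hy, rfl⟩ := hT.exists_sum y
  have huA : ∀ k ∈ A, u k = 0 := by
    intro k hk
    by_contra h
    have h1 := hf k hk
    rw [hT.apply_sum hu, ha.symm, hT.apply_sum hu] at h1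
    exact (ha.pos_of_mem hT (hu k) h).ne' h1
  have h0 : ∀ i ∈ A, ∀ k j l, a i (b (u k) (x j)) (y l) + a i (x j) (b (u k) (y l)) = 0 := by
    intro i hi k j l
    by_cases hk : k ∈ A
    · simp [huA k hk]
    have hik : i ≠ k := fun h => hk (h ▸ hi)
    have hnot := hA i hi k hk
    -- For `k ∉ A` and `i ∈ A`, bracketing with `T k` sends no `T j` with `j ≠ i` into the `i`-th
    -- component: for `j = k` because the ratio varies, otherwise by `NatRed.distinct`. Only `i = j
    -- = l` is left, where `NatRed.skew` applies.
    have claim : ∀ {j l : Fin s} {x y : E}, x ∈ T j → y ∈ T l → i = l → i ≠ j →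
        a i (b (u k) x) y = 0 := by
      intro j l x y hx hy hil hij
      subst hil
      by_cases hjk : j = k
      · subst hjk
        exact hb.eq_zero_of_not_constRatio hT ha hbs hφ hik hnot (hu j) hx hy
      · exact hb.distinct hT ha hjk hik hij hx hy (hu k)
    by_cases hil : i = l
    · by_cases hij : i = j
      · subst hil; subst hij
        exact hb.skew hT ha hik (hx i) (hy i) (hu k)
      · rw [claim (hx j) (hy l) hil hij, hT.zero i j hij _ (hx j), add_zero]
    · rw [hT.zero' ha hil (hy l), zero_add]
      by_cases hij : i = j
      · rw [ha.symm]
        exact claim (hy l) (hx j) hij hil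
      · exact hT.zero i j hij _ (hx j) _
  refine Finset.sum_eq_zero fun i hi => ?_
  have h1 : ∀ k j, a i (b (u k) (x j)) (∑ l, y l) + a i (x j) (b (u k) (∑ l, y l)) = 0 := by
    intro k j
    simp only [map_sum, ← Finset.sum_add_distrib]
    exact Finset.sum_eq_zero fun l _ => h0 i hi k j l
  have h2 : ∀ k, a i (b (u k) (∑ j, x j)) (∑ l, y l) + a i (∑ j, x j) (b (u k) (∑ l, y l)) = 0 := by
    intro k
    rw [map_sum (b (u k)) x, map_sum (a i), map_sum (a i), LinearMap.sum_apply,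
      LinearMap.sum_apply, ← Finset.sum_add_distrib]
    exact Finset.sum_eq_zero fun j _ => h1 k j
  have h3 : a i (b (∑ k, u k) (∑ j, x j)) (∑ l, y l) +
      a i (∑ j, x j) (b (∑ k, u k) (∑ l, y l)) = 0 := by
    rw [map_sum b u, LinearMap.sum_apply, LinearMap.sum_apply, map_sum (a i), LinearMap.sum_apply,
      map_sum (a i (∑ j, x j)), ← Finset.sum_add_distrib]
    exact Finset.sum_eq_zero fun k _ => h2 k
  rw [h3, mul_zero]

theorem ConstRatio.symm {φ : (Fin s → ℝ) → Fin s → ℝ} {l k : Fin s} (h : ConstRatio φ l k) :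
    ConstRatio φ k l := fun t t' ht ht' => by
  linarith [h t' t ht' ht]

theorem ConstRatio.trans {φ : (Fin s → ℝ) → Fin s → ℝ} (hφ : ∀ t, (∀ i, 0 < t i) → ∀ i, 0 < φ t i)
    {i l k : Fin s} (h : ConstRatio φ i l) (h' : ConstRatio φ l k) : ConstRatio φ i k := by
  intro t t' ht ht'
  have h1 := h t t' ht ht'
  have h2 := h' t t' ht ht'
  have h3 : (φ t i * φ t' k - φ t' i * φ t k) * φ t l = 0 := by
    have h4 : φ t' l ≠ 0 := (hφ t' ht' l).ne'
    have h5 : ((φ t i * φ t' k - φ t' i * φ t k) * φ t l) * φ t' l = 0 := by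
      linear_combination (φ t' k * φ t l) * h1 + (φ t' i * φ t l) * h2
    exact (mul_eq_zero.1 h5).resolve_right h4
  linarith [(mul_eq_zero.1 h3).resolve_right (hφ t ht l).ne']

end Algebra

/-! ### Constant ratios: `L` is linear in the basic forms -/

section Constant
variable {s k : ℕ} {L : (Fin k → ℝ) → ℝ} {c : Fin k → Fin s → ℝ}

/-- If the coefficients `φᵢ` are proportional to constants, then `L` is a linear function of the
basic forms. -/
theorem Admissible.eq_linear (hL : Admissible L) (hc : ∀ j i, 0 < c j i) (hs : 0 < s)
    (hcon : ∀ i l, ConstRatio (combPartial L c) i l) :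
    ∃ r : Fin s → ℝ, ∀ t, (∀ i, 0 ≤ t i) → L (normVec c t) = ∑ i, r i * t i := by
  have : Nonempty (Fin s) := ⟨⟨0, hs⟩⟩
  set e : Fin s → ℝ := fun _ => 1 with he
  have hne : ∀ t : Fin s → ℝ, (∀ i, 0 < t i) → t ≠ 0 := by
    rintro t ht rfl
    exact (ht ⟨0, hs⟩).ne rfl
  have hn : ∀ t : Fin s → ℝ, (∀ i, 0 < t i) → ∀ j, 0 < normVec c t j := fun t ht =>
    normVec_pos hc (fun i => (ht i).le) (hne t ht)
  have hpos : ∀ t : Fin s → ℝ, (∀ i, 0 < t i) → ∀ i, 0 < combPartial L c t i := fun t ht =>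
    hL.combPartial_pos hc (hn t ht)
  set r := combPartial L c e with hr
  have hrp : ∀ i, 0 < r i := hpos e fun _ => one_pos
  set ℓ : (Fin s → ℝ) → ℝ := fun t => ∑ i, r i * t i with hℓ
  have hℓp : ∀ t : Fin s → ℝ, (∀ i, 0 < t i) → 0 < ℓ t := fun t ht =>
    sum_mul_pos hrp (fun i => (ht i).le) (hne t ht)
  -- on the level sets of `ℓ` the function is constant
  have hlevel : ∀ t t' : Fin s → ℝ, (∀ i, 0 < t i) → (∀ i, 0 < t' i) → ℓ t = ℓ t' →
      L (normVec c t) = L (normVec c t') := by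
    intro t t' ht ht' htt
    have hseg : ∀ x ∈ Set.Icc (0 : ℝ) 1, ∀ i, 0 < (t + x • (t' - t)) i := by
      intro x hx i
      have : (t + x • (t' - t)) i = (1 - x) * t i + x * t' i := by
        simp only [Pi.add_apply, Pi.smul_apply, Pi.sub_apply, smul_eq_mul]
        ring
      rw [this]
      rcases hx.1.eq_or_lt with rfl | h0
      · simpa using ht i
      · have := mul_pos h0 (ht' i)
        have := mul_nonneg (sub_nonneg.2 hx.2) (ht i).le
        linarith
    have hder : ∀ x ∈ Set.Icc (0 : ℝ) 1,
        HasDerivAt (fun x : ℝ => L (normVec c (t + x • (t' - t)))) 0 x := by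
      intro x hx
      have h1 : HasDerivAt (fun x : ℝ => t + x • (t' - t)) (t' - t) x := by
        simpa using ((hasDerivAt_id x).smul_const (t' - t)).const_add t
      have h2 := (hL.hasFDerivAt_comp (hn _ (hseg x hx))).comp_hasDerivAt x h1
      refine h2.congr_deriv ?_
      simp only [sum_apply, smul_apply, ContinuousLinearMap.proj_apply, smul_eq_mul]
      set φ := combPartial L c (t + x • (t' - t)) with hφ
      obtain ⟨i₀⟩ := this
      -- Constant ratios make `φ` proportional to `r`, so the derivative along the segment is a
      -- multiple of `ℓ t' - ℓ t = 0`.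
      have h3 : ∀ i, φ i * r i₀ = φ i₀ * r i := fun i => by
        have := hcon i i₀ _ e (hseg x hx) (fun _ => one_pos)
        rw [← hφ, ← hr] at this
        linarith
      have h4 : r i₀ * ∑ i, φ i * (t' - t) i = φ i₀ * (ℓ t' - ℓ t) := by
        simp only [hℓ, ← Finset.sum_sub_distrib, Finset.mul_sum]
        refine Finset.sum_congr rfl fun i _ => ?_
        simp only [Pi.sub_apply]
        linear_combination (t' i - t i) * h3 i
      rw [htt, sub_self, mul_zero] at h4
      exact (mul_eq_zero.1 h4).resolve_left (hrp i₀).ne'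
    have h5 := constant_of_has_deriv_right_zero
      (fun x hx => (hder x hx).continuousAt.continuousWithinAt)
      (fun x hx => (hder x (Set.Ico_subset_Icc_self hx)).hasDerivWithinAt) 1
      (Set.right_mem_Icc.2 zero_le_one)
    simpa using h5.symm
  -- The `tᵢ` are squares of norms, so degree two in the norms is degree one in `t`; every level set
  -- of `ℓ` is reached by rescaling `e`.
  have hscale : ∀ (x : ℝ), 0 < x → ∀ t, L (normVec c (x • t)) = x * L (normVec c t) := by
    intro x hx t
    have h1 : normVec c (x • t) = √x • normVec c t := by
      ext j
      simp only [normVec, Pi.smul_apply, smul_eq_mul]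
      have : ∑ i, c j i * (x * t i) = x * ∑ i, c j i * t i := by
        rw [Finset.mul_sum]
        exact Finset.sum_congr rfl fun i _ => by ring
      rw [this, Real.sqrt_mul hx.le]
    rw [h1, hL.homog _ (normVec c t) (Real.sqrt_pos.2 hx) (fun _ => Real.sqrt_nonneg _),
      Real.sq_sqrt hx.le]
  set C := L (normVec c e) / ℓ e with hC
  have hopen : ∀ t : Fin s → ℝ, (∀ i, 0 < t i) → L (normVec c t) = C * ℓ t := by
    intro t ht
    have he0 := hℓp e fun _ => one_pos
    have h1 : 0 < ℓ t / ℓ e := div_pos (hℓp t ht) he0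
    have h2 : ℓ t = ℓ ((ℓ t / ℓ e) • e) := by
      have : ℓ ((ℓ t / ℓ e) • e) = (ℓ t / ℓ e) * ℓ e := by
        simp only [hℓ, Finset.mul_sum, Pi.smul_apply, smul_eq_mul]
        exact Finset.sum_congr rfl fun i _ => by ring
      rw [this, div_mul_cancel₀ _ he0.ne']
    rw [hlevel t _ ht (fun i => by simpa [he] using h1) h2, hscale _ h1, hC]
    field_simp
  refine ⟨fun i => C * r i, fun t ht => ?_⟩
  -- The formula is known for positive `t`; vectors with vanishing components are reached by
  -- continuity.
  have hcont : ContinuousOn (fun t => L (normVec c t)) {t | ∀ i, 0 ≤ t i} :=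
    hL.cont.comp (continuous_normVec c).continuousOn fun _ _ _ => Real.sqrt_nonneg _
  have hmem : ∀ x : ℝ, 0 ≤ x → (t + x • e) ∈ {t : Fin s → ℝ | ∀ i, 0 ≤ t i} := by
    intro x hx i
    simpa [he] using add_nonneg (ht i) hx
  have hlim : Tendsto (fun x : ℝ => t + x • e) (𝓝[>] 0) (𝓝[{t | ∀ i, 0 ≤ t i}] t) := by
    refine tendsto_nhdsWithin_iff.2 ⟨?_, ?_⟩
    · have : Continuous (fun x : ℝ => t + x • e) := by fun_prop
      simpa using (this.tendsto 0).mono_left nhdsWithin_le_nhds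
    · filter_upwards [self_mem_nhdsWithin] with x hx using hmem x (le_of_lt hx)
  have h1 : Tendsto (fun x : ℝ => L (normVec c (t + x • e))) (𝓝[>] 0) (𝓝 (L (normVec c t))) :=
    (hcont t ht).tendsto.comp hlim
  have hℓc : Continuous ℓ := by fun_prop
  have h2 : Tendsto (fun x : ℝ => C * ℓ (t + x • e)) (𝓝[>] 0) (𝓝 (C * ℓ t)) :=
    ((hℓc.tendsto t).const_mul C).comp (hlim.mono_right nhdsWithin_le_nhds)
  have h3 : L (normVec c t) = C * ℓ t := by
    refine tendsto_nhds_unique h1 (h2.congr' ?_)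
    filter_upwards [self_mem_nhdsWithin] with x hx
    refine (hopen _ fun i => ?_).symm
    have : (0 : ℝ) < x := hx
    simpa [he] using add_pos_of_nonneg_of_pos (ht i) this
  rw [h3, hℓ, Finset.mul_sum]
  exact Finset.sum_congr rfl fun i _ => by ring

end Constant

/-! ### Degenerate invariant forms as pullbacks along their radical -/

section Pullback
variable {n d : ℕ}
  {G : Type*} [TopologicalSpace G] [ChartedSpace (EuclideanSpace ℝ (Fin n)) G] [Group G]
  [LieGroup (𝓡 n) ∞ G]

theorem HasLD.comp {E E' : Type*} [NormedAddCommGroup E] [NormedSpace ℝ E] [NormedAddCommGroup E']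
    [NormedSpace ℝ E'] {g : E' → G} {f : E → E'} {x : E} {y : E'} {L : E' →L[ℝ] Eu n}
    {L' : E →L[ℝ] E'} (hg : HasLD n 𝓘(ℝ, E') g y L) (hf : HasFDerivAt f L' x) (hy : f x = y) :
    HasLD n 𝓘(ℝ, E) (fun z => g (f z)) x (L.comp L') := by
  subst hy
  exact HasD.comp (f := f) (g := fun z => (g (f x))⁻¹ * g z) hg (hasD_iff_hasFDerivAt.2 hf) rfl

/-- `B` is preserved by `Ad k`. -/
def AdPreserves (B : Eu n →ₗ[ℝ] Eu n →ₗ[ℝ] ℝ) (k : G) : Prop :=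
  ∀ x y, B (AdE n k x) (AdE n k y) = B x y

theorem AdPreserves.inv {B : Eu n →ₗ[ℝ] Eu n →ₗ[ℝ] ℝ} {k : G} (h : AdPreserves B k) :
    AdPreserves B k⁻¹ := fun x y => by
  rw [← h, AdE_AdE_inv, AdE_AdE_inv]

theorem AdPreserves.mul {B : Eu n →ₗ[ℝ] Eu n →ₗ[ℝ] ℝ} {k k' : G} (h : AdPreserves B k)
    (h' : AdPreserves B k') : AdPreserves B (k * k') := fun x y => by
  rw [AdE_mul_apply, AdE_mul_apply, h, h']

theorem AdPreserves.one (B : Eu n →ₗ[ℝ] Eu n →ₗ[ℝ] ℝ) : AdPreserves B (1 : G) := fun x y => by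
  rw [AdE_one]; rfl

theorem AdPreserves.apply_left {B : Eu n →ₗ[ℝ] Eu n →ₗ[ℝ] ℝ} {k : G} (h : AdPreserves B k)
    {f : Eu n} (hf : ∀ y, B f y = 0) (y : Eu n) : B (AdE n k f) y = 0 := by
  rw [← AdE_AdE_inv k y, h, hf]

variable [T2Space G]

theorem IsOneParam.AdE_self {γ : ℝ → G} {f : Eu n} (h : IsOneParam γ f) (t : ℝ) :
    AdE n (γ t) f = f := by
  have h1 : ∀ t, HasDerivAt (fun s => AdE n (γ s) f) 0 t := fun t => by
    have h2 := h.hasDerivAt_AdE f t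
    have h3 : brE n G f f = 0 := lie_self (L := GroupLieAlgebra (𝓡 n) G) f
    rw [h3, _root_.map_zero] at h2
    exact h2
  have h4 := is_const_of_deriv_eq_zero (f := fun s => AdE n (γ s) f)
    (fun t => (h1 t).differentiableAt) (fun t => (h1 t).deriv) t 0
  rw [h4, h.map_zero, AdE_one]
  rfl

/-- Since `Ad (γ t)` fixes `f`, the derivative of `B(Ad γ x, Ad γ y)` is `B([f, Ad γ x], Ad γ y) +
B(Ad γ x, [f, Ad γ y]) = 0`. -/
theorem IsOneParam.adPreserves {γ : ℝ → G} {f : Eu n} (h : IsOneParam γ f)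
    {B : Eu n →ₗ[ℝ] Eu n →ₗ[ℝ] ℝ}
    (hK : ∀ x y, B (brE n G f x) y + B x (brE n G f y) = 0) (t : ℝ) : AdPreserves B (γ t) := by
  intro x y
  have h1 : ∀ t, HasDerivAt (fun s => B (AdE n (γ s) x) (AdE n (γ s) y)) 0 t := fun t => by
    refine (hasDerivAt_bilin B (h.hasDerivAt_AdE x t) (h.hasDerivAt_AdE y t)).congr_deriv ?_
    rw [AdE_brE, AdE_brE, h.AdE_self, hK]
  have h4 := is_const_of_deriv_eq_zero (f := fun s => B (AdE n (γ s) x) (AdE n (γ s) y))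
    (fun t => (h1 t).differentiableAt) (fun t => (h1 t).deriv) t 0
  rw [h4, h.map_zero]
  exact AdPreserves.one B x y

/-- A smooth map into the group preserving `B`, with logarithmic derivatives in the radical of `B`,
and with logarithmic derivative `L₀` at the origin. -/
structure IsRadMap (B : Eu n →ₗ[ℝ] Eu n →ₗ[ℝ] ℝ) {E : Type*} [NormedAddCommGroup E]
    [NormedSpace ℝ E] (k : E → G) (L₀ : E →L[ℝ] Eu n) : Prop where
  smooth : ContMDiff 𝓘(ℝ, E) (𝓡 n) ∞ k
  map_zero : k 0 = 1
  deriv_zero : HasLD n 𝓘(ℝ, E) k 0 L₀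
  preserves : ∀ v, AdPreserves B (k v)
  rad : ∀ v L, HasLD n 𝓘(ℝ, E) k v L → ∀ w y, B (L w) y = 0

section
variable {B : Eu n →ₗ[ℝ] Eu n →ₗ[ℝ] ℝ} {E : Type*} [NormedAddCommGroup E] [NormedSpace ℝ E]

theorem IsRadMap.one : IsRadMap B (fun _ : E => (1 : G)) 0 := by
  have hld : ∀ v : E, HasLD n 𝓘(ℝ, E) (fun _ : E => (1 : G)) v 0 := fun v =>
    (hasD_const v (1 : G)).congr (.of_forall fun y => by simp)
  refine ⟨contMDiff_const, rfl, hld 0, fun _ => AdPreserves.one B, fun v L hL w y => ?_⟩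
  rw [hL.unique (hld v)]
  simp

theorem IsRadMap.mul {k k' : E → G} {L₀ L₀' : E →L[ℝ] Eu n} (h : IsRadMap B k L₀)
    (h' : IsRadMap B k' L₀') : IsRadMap B (fun v => k v * k' v) (L₀ + L₀') := by
  refine ⟨h.smooth.mul h'.smooth, by rw [h.map_zero, h'.map_zero, one_mul], ?_,
    fun v => (h.preserves v).mul (h'.preserves v), fun v L hL w y => ?_⟩
  · have h1 := h.deriv_zero.mul h'.deriv_zero
    rw [h'.map_zero, inv_one, AdE_one, ContinuousLinearMap.id_comp] at h1
    exact h1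
  · obtain ⟨D, hD⟩ := exists_hasLD (n := n) (h.smooth.mdifferentiable (by simp) v)
    obtain ⟨D', hD'⟩ := exists_hasLD (n := n) (h'.smooth.mdifferentiable (by simp) v)
    rw [hL.unique (hD.mul hD')]
    have h1 := (h'.preserves v).inv.apply_left (fun y => h.rad v D hD w y) y
    have h2 := h'.rad v D' hD' w y
    have h3 : ((AdE n (k' v)⁻¹).comp D + D') w = AdE n (k' v)⁻¹ (D w) + D' w := rfl
    rw [h3, map_add, LinearMap.add_apply, h1, h2, add_zero]

theorem exists_isRadMap_single {f : Eu n} (hf : ∀ y, B f y = 0)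
    (hK : ∀ x y, B (brE n G f x) y + B x (brE n G f y) = 0) (ℓ : E →L[ℝ] ℝ) :
    ∃ k : E → G, IsRadMap B k (ℓ.smulRight f) := by
  obtain ⟨γ, hγ⟩ := exists_isOneParam (G := G) f
  have hld : ∀ v, HasLD n 𝓘(ℝ, E) (fun v => γ (ℓ v)) v (ℓ.smulRight f) := by
    intro v
    have h1 := HasLD.comp (hγ.hasLD (ℓ v)) (ℓ.hasFDerivAt (x := v)) rfl
    have h2 : ((1 : ℝ →L[ℝ] ℝ).smulRight f).comp ℓ = ℓ.smulRight f := by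
      ext1; simp
    rw [h2] at h1
    exact h1
  refine ⟨fun v => γ (ℓ v), hγ.1.comp ℓ.contDiff.contMDiff, by simp [hγ.map_zero], hld 0,
    fun v => hγ.adPreserves hK _, fun v L hL w y => ?_⟩
  rw [hL.unique (hld v)]
  simp [hf]

/-- Take the product of the one-parameter groups of the `f j`, in some order. The `f j` need not
span a subalgebra, but each factor preserves `B` and so its radical; hence the logarithmic
derivatives of the product stay in the radical. -/
theorem exists_isRadMap {ι : Type*} (S : Finset ι) {f : ι → Eu n} (hf : ∀ j y, B (f j) y = 0)
    (hK : ∀ j x y, B (brE n G (f j) x) y + B x (brE n G (f j) y) = 0) (ℓ : ι → E →L[ℝ] ℝ) :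
    ∃ k : E → G, IsRadMap B k (∑ j ∈ S, (ℓ j).smulRight (f j)) := by
  classical
  induction S using Finset.induction_on with
  | empty => exact ⟨_, by simpa using IsRadMap.one⟩
  | insert j S hj ih =>
    obtain ⟨k, hk⟩ := ih
    obtain ⟨k', hk'⟩ := exists_isRadMap_single (hf j) (hK j) (ℓ j)
    exact ⟨_, by
      rw [Finset.sum_insert hj]
      exact hk'.mul hk⟩

end

variable {M : Type*} [TopologicalSpace M] [ChartedSpace (EuclideanSpace ℝ (Fin d)) M]
  [IsManifold (𝓡 d) ∞ M] [MulAction G M] [ContMDiffSMul (𝓡 n) (𝓡 d) ∞ G M]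

/-- An invariant symmetric form whose radical acts by skew endomorphisms is, near `p`, the pullback
of a field of forms under a submersion along the radical. -/
theorem exists_pullback {a b : ℕ} {β : BilinField d M} (hβ : BilinInv G β) {p : M}
    (hsymm : ∀ v w, bE β p v w = bE β p w v) (Θ : (Eu a × Eu b) ≃L[ℝ] Eu d)
    (ι : Eu a →L[ℝ] Eu n) (f : Fin b → Eu n) (hι : ∀ x, dO n d G p (ι x) = Θ (x, 0))
    (hf : ∀ j, dO n d G p (f j) = Θ (0, EuclideanSpace.single j 1))
    (hrad : ∀ j v, bE β p (dO n d G p (f j)) v = 0)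
    (hK : ∀ j x y, bE β p (dO n d G p (brE n G (f j) x)) (dO n d G p y) +
      bE β p (dO n d G p x) (dO n d G p (brE n G (f j) y)) = 0) :
    ∃ (U : Set M) (u : M → Eu a) (g₁ : Eu a → Eu a →ₗ[ℝ] Eu a →ₗ[ℝ] ℝ), IsOpen U ∧ p ∈ U ∧
      ContMDiffOn (𝓡 d) 𝓘(ℝ, Eu a) ∞ u U ∧
      HasD (𝓡 d) 𝓘(ℝ, Eu a) u p ((ContinuousLinearMap.fst ℝ (Eu a) (Eu b)).comp
        (Θ.symm : Eu d →L[ℝ] Eu a × Eu b)) ∧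
      ∀ q ∈ U, ∀ D, HasD (𝓡 d) 𝓘(ℝ, Eu a) u q D → ∀ v w,
        bE β q v w = g₁ (u q) (D v) (D w) := by
  classical
  set B : Eu n →ₗ[ℝ] Eu n →ₗ[ℝ] ℝ :=
    (bE β p).compl₁₂ (dO n d G p).toLinearMap (dO n d G p).toLinearMap with hB
  have hBa : ∀ x y, B x y = bE β p (dO n d G p x) (dO n d G p y) := fun x y => rfl
  have hBs : ∀ x y, B x y = B y x := fun x y => hsymm _ _
  obtain ⟨k, hk⟩ := exists_isRadMap (G := G) (B := B) Finset.univ (f := f) (fun j y => hrad j _) hK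
    (fun j => EuclideanSpace.proj j : Fin b → Eu b →L[ℝ] ℝ)
  set g : Eu a → G := affineMap n G ι with hg
  -- `g` moves transversally to the radical and `k` along it. `G` preserves `β`, and `k` preserves
  -- `B` with logarithmic derivatives in its radical, so in the coordinates given by `Ψ` the form
  -- will depend on the first factor alone.
  set h : Eu a × Eu b → G := fun z => g z.1 * k z.2 with hh
  set Ψ : Eu a × Eu b → M := fun z => h z • p with hΨ
  have hg0 : g 0 = 1 := affineMap_zero ι
  have hgs : ∀ z : Eu a × Eu b, z.1 ∈ affineDom n G ι →
      ContMDiffAt 𝓘(ℝ, Eu a × Eu b) (𝓡 n) ∞ (fun z : Eu a × Eu b => g z.1) z := fun z hz =>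
    ContMDiffAt.comp (g := g) (f := fun z : Eu a × Eu b => z.1) z (contMDiffAt_affineMap ι hz)
      contDiff_fst.contMDiff.contMDiffAt
  have hks : ContMDiff 𝓘(ℝ, Eu a × Eu b) (𝓡 n) ∞ (fun z : Eu a × Eu b => k z.2) :=
    hk.smooth.comp (f := fun z : Eu a × Eu b => z.2) contDiff_snd.contMDiff
  have hΨs : ∀ z : Eu a × Eu b, z.1 ∈ affineDom n G ι →
      ContMDiffAt 𝓘(ℝ, Eu a × Eu b) (𝓡 d) ∞ Ψ z := fun z hz =>
    ((hgs z hz).mul hks.contMDiffAt).smul contMDiffAt_const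
  -- the differential of `Ψ`
  have hΨD : ∀ (z : Eu a × Eu b) (Lg : Eu a →L[ℝ] Eu n) (Lk : Eu b →L[ℝ] Eu n),
      HasLD n 𝓘(ℝ, Eu a) g z.1 Lg → HasLD n 𝓘(ℝ, Eu b) k z.2 Lk →
      HasD 𝓘(ℝ, Eu a × Eu b) (𝓡 d) Ψ z ((dT d (h z) p).comp ((dO n d G p).comp
        ((AdE n (k z.2)⁻¹).comp (Lg.comp (ContinuousLinearMap.fst ℝ (Eu a) (Eu b))) +
          Lk.comp (ContinuousLinearMap.snd ℝ (Eu a) (Eu b))))) := by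
    intro z Lg Lk hLg hLk
    have h1 : HasLD n 𝓘(ℝ, Eu a × Eu b) (fun z : Eu a × Eu b => g z.1) z
        (Lg.comp (ContinuousLinearMap.fst ℝ (Eu a) (Eu b))) :=
      HasLD.comp hLg hasFDerivAt_fst rfl
    have h2 : HasLD n 𝓘(ℝ, Eu a × Eu b) (fun z : Eu a × Eu b => k z.2) z
        (Lk.comp (ContinuousLinearMap.snd ℝ (Eu a) (Eu b))) :=
      HasLD.comp hLk hasFDerivAt_snd rfl
    exact (h1.mul h2).smul p
  have hΨ0 : Ψ 0 = p := by
    change (g 0 * k 0) • p = p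
    rw [hg0, hk.map_zero, one_mul, one_smul]
  have hgD0 : HasLD n 𝓘(ℝ, Eu a) g 0 ι :=
    (hasD_affineMap (G := G) ι).congr (.of_forall fun y => by
      change (g 0)⁻¹ * g y = g y
      rw [hg0, inv_one, one_mul])
  have hΨD0 : HasD 𝓘(ℝ, Eu a × Eu b) (𝓡 d) Ψ 0 (Θ : Eu a × Eu b →L[ℝ] Eu d) := by
    have h1 := hΨD 0 ι _ hgD0 hk.deriv_zero
    have h2 : ∀ z : Eu a × Eu b, Θ z = dO n d G p (ι z.1 + ∑ j, z.2 j • f j) := by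
      intro z
      rw [map_add, map_sum, hι]
      simp only [map_smul, hf]
      rw [← Finset.sum_congr rfl fun j _ => (Θ.map_smul (z.2 j) (0, EuclideanSpace.single j 1)),
        ← map_sum, ← map_add]
      congr 1
      ext i
      · simp [Prod.fst_sum]
      · simp [Prod.snd_sum, Pi.single_apply]
    have h3 : (Θ : Eu a × Eu b →L[ℝ] Eu d) = (dT d (h 0) p).comp ((dO n d G p).comp
        ((AdE n (k (0 : Eu a × Eu b).2)⁻¹).comp
          (ι.comp (ContinuousLinearMap.fst ℝ (Eu a) (Eu b))) +
          (∑ j, (EuclideanSpace.proj j : Eu b →L[ℝ] ℝ).smulRight (f j)).comp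
            (ContinuousLinearMap.snd ℝ (Eu a) (Eu b)))) := by
      have h4 : h 0 = 1 := by
        change g 0 * k 0 = 1
        rw [hg0, hk.map_zero, one_mul]
      have h5 : k (0 : Eu a × Eu b).2 = 1 := hk.map_zero
      rw [h4, h5, inv_one, AdE_one, dT_one]
      refine ContinuousLinearMap.ext fun z => ?_
      refine (h2 z).trans ?_
      simp [sum_apply]
    rw [h3]
    exact h1
  set c := chartAt (Eu d) p with hc
  have hdom : IsOpen {z : Eu a × Eu b | z.1 ∈ affineDom n G ι} :=
    (isOpen_affineDom ι).preimage continuous_fst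
  have hUopen : IsOpen ({z : Eu a × Eu b | z.1 ∈ affineDom n G ι} ∩ Ψ ⁻¹' c.source) :=
    ContinuousOn.isOpen_inter_preimage
      (fun z hz => (hΨs z hz).continuousAt.continuousWithinAt) hdom c.open_source
  have hsm : ContDiffOn ℝ ∞ (fun z => c (Ψ z))
      ({z : Eu a × Eu b | z.1 ∈ affineDom n G ι} ∩ Ψ ⁻¹' c.source) := fun z hz =>
    (ContMDiffAt.comp (g := c) (f := Ψ) z (contMDiffAt_chart hz.2)
      (hΨs z hz.1)).contDiffAt.contDiffWithinAt
  have h0 : (0 : Eu a × Eu b) ∈ {z : Eu a × Eu b | z.1 ∈ affineDom n G ι} ∩ Ψ ⁻¹' c.source :=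
    ⟨zero_mem_affineDom ι, by
      change Ψ 0 ∈ c.source
      rw [hΨ0]
      exact mem_chart_source _ p⟩
  obtain ⟨φ, hφ0, hφU, hφ, hφs⟩ := exists_openPartialHomeomorph hUopen hsm h0
    (hasD_iff_hasFDerivAt.1 (hΨD0.chart hΨ0))
  set U := c.source ∩ c ⁻¹' φ.target with hU
  have hUo : IsOpen U := c.isOpen_inter_preimage φ.open_target
  set Z : M → Eu a × Eu b := fun q => φ.symm (c q) with hZ
  have hZs : ∀ q ∈ U, ContMDiffAt (𝓡 d) 𝓘(ℝ, Eu a × Eu b) ∞ Z q := fun q hq =>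
    ContMDiffAt.comp (g := φ.symm) (f := c) q
      (hφs.contDiffAt (φ.open_target.mem_nhds hq.2)).contMDiffAt (contMDiffAt_chart hq.1)
  have hZsrc : ∀ q ∈ U, Z q ∈ φ.source := fun q hq => φ.map_target hq.2
  have hΨZ : ∀ q ∈ U, Ψ (Z q) = q := by
    intro q hq
    have h1 := φ.right_inv hq.2
    rw [hφ] at h1
    exact c.injOn (hφU (hZsrc q hq)).2 hq.1 h1
  have hZΨ : ∀ z ∈ φ.source, Z (Ψ z) = z := by
    intro z hz
    have h1 := φ.left_inv hz
    rwa [hφ] at h1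
  have hpU : p ∈ U := ⟨mem_chart_source _ p, by
    rw [Set.mem_preimage, ← hΨ0, ← hφ]
    exact φ.map_source hφ0⟩
  have hZp : Z p = 0 := by
    rw [← hΨ0]
    exact hZΨ 0 hφ0
  -- the differentials of `Z` and `Ψ` are inverse to each other
  have hinv : ∀ q ∈ U, ∀ P D, HasD 𝓘(ℝ, Eu a × Eu b) (𝓡 d) Ψ (Z q) P →
      HasD (𝓡 d) 𝓘(ℝ, Eu a × Eu b) Z q D → (∀ v, P (D v) = v) ∧ ∀ z, D (P z) = z := by
    intro q hq P D hP hD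
    constructor
    · intro v
      have h1 := (hP.comp hD rfl).unique ((hasD_id (I := 𝓡 d) q).congr (by
        filter_upwards [hUo.mem_nhds hq] with y hy using hΨZ y hy))
      exact congrArg (fun L => L v) h1
    · intro z
      have h1 := (hD.comp hP (hΨZ q hq)).unique ((hasD_id (I := 𝓘(ℝ, Eu a × Eu b)) (Z q)).congr (by
        filter_upwards [φ.open_source.mem_nhds (hZsrc q hq)] with y hy using hZΨ y hy))
      exact congrArg (fun L => L z) h1
  have hZD : ∀ q ∈ U, ∃ D, HasD (𝓡 d) 𝓘(ℝ, Eu a × Eu b) Z q D := fun q hq =>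
    ⟨_, hasD_of_mdifferentiableAt ((hZs q hq).mdifferentiableAt (by simp))⟩
  have hfst : ∀ q D, HasD (𝓡 d) 𝓘(ℝ, Eu a × Eu b) Z q D →
      HasD (𝓡 d) 𝓘(ℝ, Eu a) (fun q => (Z q).1) q
        ((ContinuousLinearMap.fst ℝ (Eu a) (Eu b)).comp D) := fun q D hD =>
    HasD.comp (g := fun z : Eu a × Eu b => z.1) (hasD_iff_hasFDerivAt.2 hasFDerivAt_fst) hD rfl
  -- The logarithmic derivative of `g`, from which `g₁` is made; the value `0` where none exists is
  -- never used.
  set Λ : Eu a → Eu a →L[ℝ] Eu n := fun x =>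
    if h : ∃ L, HasLD n 𝓘(ℝ, Eu a) g x L then h.choose else 0 with hΛ
  have hΛs : ∀ x ∈ affineDom n G ι, HasLD n 𝓘(ℝ, Eu a) g x (Λ x) := by
    intro x hx
    have h1 : ∃ L, HasLD n 𝓘(ℝ, Eu a) g x L :=
      exists_hasLD ((contMDiffAt_affineMap ι hx).mdifferentiableAt (by simp))
    simp only [hΛ, h1, dif_pos]
    exact h1.choose_spec
  refine ⟨U, fun q => (Z q).1, fun x => B.compl₁₂ (Λ x).toLinearMap (Λ x).toLinearMap, hUo, hpU,
    fun q hq => ?_, ?_, fun q hq D hD v w => ?_⟩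
  · exact (ContMDiffAt.comp (g := fun z : Eu a × Eu b => z.1) (f := Z) q
      contDiff_fst.contMDiff.contMDiffAt (hZs q hq)).contMDiffWithinAt
  · obtain ⟨D, hD⟩ := hZD p hpU
    have h1 : D = (Θ.symm : Eu d →L[ℝ] Eu a × Eu b) := by
      ext1 v
      have h2 := (hinv p hpU _ D (by rw [hZp]; exact hΨD0) hD).1 v
      exact (Θ.symm_apply_eq.2 h2.symm).symm
    rw [← h1]
    exact hfst p D hD
  · obtain ⟨D', hD'⟩ := hZD q hq
    have hz := (hφU (hZsrc q hq)).1
    obtain ⟨Lk, hLk⟩ := exists_hasLD (n := n) (hk.smooth.mdifferentiable (by simp) (Z q).2)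
    have hP := hΨD (Z q) _ Lk (hΛs _ hz) hLk
    have h1 := (hinv q hq _ D' hP hD').1
    have h2 : ∀ v, D v = (D' v).1 := fun v => by
      rw [hD.unique (hfst q D' hD')]; rfl
    set x := D' v with hx
    set y := D' w with hy
    have hval : ∀ z, ((AdE n (k (Z q).2)⁻¹).comp ((Λ (Z q).1).comp
        (ContinuousLinearMap.fst ℝ (Eu a) (Eu b))) +
          Lk.comp (ContinuousLinearMap.snd ℝ (Eu a) (Eu b))) z =
        AdE n (k (Z q).2)⁻¹ (Λ (Z q).1 z.1) + Lk z.2 := fun z => rfl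
    have hr : ∀ z y, B (Lk z) y = 0 := hk.rad _ Lk hLk
    have hr' : ∀ z y, B y (Lk z) = 0 := fun z y => by rw [hBs, hr]
    -- By invariance, `β` is `B` evaluated on the vectors `Ad k⁻¹ (Λ x) + Lk y`; the second term is
    -- in the radical, and `Ad k⁻¹` preserves `B`.
    have h3 : bE β (h (Z q) • p) v w = B (Λ (Z q).1 x.1) (Λ (Z q).1 y.1) := by
      rw [← h1 v, ← h1 w]
      simp only [ContinuousLinearMap.comp_apply]
      rw [hβ, ← hBa]
      have e1 := hval x
      have e2 := hval y
      simp only at e1 e2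
      rw [← hx, ← hy]
      refine (congrArg₂ (fun s t => B s t) e1 e2).trans ?_
      simp only [map_add, LinearMap.add_apply, hr, hr', add_zero]
      exact (hk.preserves _).inv _ _
    have h4 : h (Z q) • p = q := hΨZ q hq
    rw [h4] at h3
    rw [h3, h2, h2]
    rfl

end Pullback

/-- Linear coordinates adapted to a direct sum decomposition. -/
theorem exists_split {d : ℕ} {P Q : Submodule ℝ (Eu d)} (h : IsCompl P Q) (hP : P ≠ ⊥)
    (hQ : Q ≠ ⊥) : ∃ (a b : ℕ) (Θ : (Eu a × Eu b) ≃L[ℝ] Eu d), 0 < a ∧ 0 < b ∧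
      (∀ x, Θ (x, 0) ∈ P) ∧ ∀ y, Θ (0, y) ∈ Q := by
  have e₁ : Eu (Module.finrank ℝ P) ≃ₗ[ℝ] P := LinearEquiv.ofFinrankEq _ _ (by simp)
  have e₂ : Eu (Module.finrank ℝ Q) ≃ₗ[ℝ] Q := LinearEquiv.ofFinrankEq _ _ (by simp)
  refine ⟨_, _, ((e₁.prodCongr e₂).trans (Submodule.prodEquivOfIsCompl P Q h)).toContinuousLinearEquiv,
    ?_, ?_, fun x => ?_, fun y => ?_⟩
  · exact Nat.pos_of_ne_zero fun h0 => hP (Submodule.finrank_eq_zero.1 h0)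
  · exact Nat.pos_of_ne_zero fun h0 => hQ (Submodule.finrank_eq_zero.1 h0)
  · simp
  · simp

/-! ### A sum of two pullbacks is a local product -/

section Product
variable {d : ℕ} {M : Type*} [TopologicalSpace M] [ChartedSpace (EuclideanSpace ℝ (Fin d)) M]
  [IsManifold (𝓡 d) ∞ M] {p : M} {a b : ℕ}

/-- The pair `(u₁, u₂)` has differential `Θ⁻¹` at `p`, so it is a coordinate system near `p`, and
each summand of `g` involves only one of the two groups of coordinates. -/
theorem isLocalProduct_of_pullback {g β₁ β₂ : BilinField d M}
    (hg : ∀ q v w, bE g q v w = bE β₁ q v w + bE β₂ q v w) (ha : 0 < a) (hb : 0 < b)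
    (Θ : (Eu a × Eu b) ≃L[ℝ] Eu d) {U₁ U₂ : Set M} {u₁ : M → Eu a} {u₂ : M → Eu b}
    {g₁ : Eu a → Eu a →ₗ[ℝ] Eu a →ₗ[ℝ] ℝ} {g₂ : Eu b → Eu b →ₗ[ℝ] Eu b →ₗ[ℝ] ℝ}
    (hU₁ : IsOpen U₁) (hp₁ : p ∈ U₁) (hu₁ : ContMDiffOn (𝓡 d) 𝓘(ℝ, Eu a) ∞ u₁ U₁)
    (hD₁ : HasD (𝓡 d) 𝓘(ℝ, Eu a) u₁ p ((ContinuousLinearMap.fst ℝ (Eu a) (Eu b)).comp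
        (Θ.symm : Eu d →L[ℝ] Eu a × Eu b)))
    (hg₁ : ∀ q ∈ U₁, ∀ D, HasD (𝓡 d) 𝓘(ℝ, Eu a) u₁ q D → ∀ v w,
        bE β₁ q v w = g₁ (u₁ q) (D v) (D w))
    (hU₂ : IsOpen U₂) (hp₂ : p ∈ U₂) (hu₂ : ContMDiffOn (𝓡 d) 𝓘(ℝ, Eu b) ∞ u₂ U₂)
    (hD₂ : HasD (𝓡 d) 𝓘(ℝ, Eu b) u₂ p ((ContinuousLinearMap.snd ℝ (Eu a) (Eu b)).comp
        (Θ.symm : Eu d →L[ℝ] Eu a × Eu b)))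
    (hg₂ : ∀ q ∈ U₂, ∀ D, HasD (𝓡 d) 𝓘(ℝ, Eu b) u₂ q D → ∀ v w,
        bE β₂ q v w = g₂ (u₂ q) (D v) (D w)) :
    IsLocalProduct g p := by
  set c := chartAt (Eu d) p with hc
  have hpc : p ∈ c.source := mem_chart_source _ p
  have hopen : IsOpen (c.target ∩ c.symm ⁻¹' (U₁ ∩ U₂)) :=
    c.isOpen_inter_preimage_symm (hU₁.inter hU₂)
  have hsm : ContDiffOn ℝ ∞ (fun x => (u₁ (c.symm x), u₂ (c.symm x)))
      (c.target ∩ c.symm ⁻¹' (U₁ ∩ U₂)) := by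
    intro x hx
    have h1 : ContMDiffAt 𝓘(ℝ, Eu d) 𝓘(ℝ, Eu a) ∞ (fun x => u₁ (c.symm x)) x :=
      ContMDiffAt.comp (g := u₁) (f := c.symm) x (hu₁.contMDiffAt (hU₁.mem_nhds hx.2.1))
        (contMDiffAt_chart_symm hx.1)
    have h2 : ContMDiffAt 𝓘(ℝ, Eu d) 𝓘(ℝ, Eu b) ∞ (fun x => u₂ (c.symm x)) x :=
      ContMDiffAt.comp (g := u₂) (f := c.symm) x (hu₂.contMDiffAt (hU₂.mem_nhds hx.2.2))
        (contMDiffAt_chart_symm hx.1)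
    exact (h1.contDiffAt.prodMk h2.contDiffAt).contDiffWithinAt
  have hcp : c p ∈ c.target ∩ c.symm ⁻¹' (U₁ ∩ U₂) := ⟨c.map_source hpc, by
    rw [Set.mem_preimage, c.left_inv hpc]
    exact ⟨hp₁, hp₂⟩⟩
  have hD : HasFDerivAt (fun x => (u₁ (c.symm x), u₂ (c.symm x)))
      (Θ.symm : Eu d →L[ℝ] Eu a × Eu b) (c p) := by
    have h1 := hasD_iff_hasFDerivAt.1 (hD₁.comp (hasD_chart_symm_self p) (c.left_inv hpc))
    have h2 := hasD_iff_hasFDerivAt.1 (hD₂.comp (hasD_chart_symm_self p) (c.left_inv hpc))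
    exact h1.prodMk h2
  obtain ⟨ψ, hψp, hψU, hψ, hψs⟩ := exists_openPartialHomeomorph hopen hsm hcp hD
  set φ := c.trans ψ with hφ
  have hsrc : ∀ q ∈ φ.source, q ∈ c.source ∧ c q ∈ ψ.source := fun q hq => by
    rwa [hφ, OpenPartialHomeomorph.trans_source] at hq
  have hφq : ∀ q ∈ φ.source, φ q = (u₁ q, u₂ q) ∧ q ∈ U₁ ∧ q ∈ U₂ := by
    intro q hq
    obtain ⟨h1, h2⟩ := hsrc q hq
    have h3 := (hψU h2).2
    rw [Set.mem_preimage, c.left_inv h1] at h3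
    refine ⟨?_, h3⟩
    change ψ (c q) = _
    rw [hψ, c.left_inv h1]
  have hφs : ∀ q ∈ φ.source, ContMDiffAt (𝓡 d) 𝓘(ℝ, Eu a × Eu b) ∞ φ q := by
    intro q hq
    obtain ⟨-, h1, h2⟩ := hφq q hq
    have h3 : ContMDiffAt (𝓡 d) 𝓘(ℝ, Eu a × Eu b) ∞ (fun q => (u₁ q, u₂ q)) q := by
      have := (hu₁.contMDiffAt (hU₁.mem_nhds h1)).prodMk_space (hu₂.contMDiffAt (hU₂.mem_nhds h2))
      exact this
    refine h3.congr_of_eventuallyEq ?_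
    filter_upwards [φ.open_source.mem_nhds hq] with y hy using (hφq y hy).1
  refine ⟨a, b, φ, g₁, g₂, ha, hb, ?_, fun q hq => (hφs q hq).contMDiffWithinAt, ?_, ?_⟩
  · rw [hφ, OpenPartialHomeomorph.trans_source]
    exact ⟨hpc, hψp⟩
  · intro z hz
    rw [hφ, OpenPartialHomeomorph.trans_target] at hz
    exact (ContMDiffAt.comp (g := c.symm) (f := ψ.symm) z (contMDiffAt_chart_symm hz.2)
      (hψs.contDiffAt (ψ.open_target.mem_nhds hz.1)).contMDiffAt).contMDiffWithinAt
  · intro q hq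
    obtain ⟨h0, h1, h2⟩ := hφq q hq
    obtain ⟨D, hDdef⟩ : ∃ D : Eu d →L[ℝ] Eu a × Eu b,
        D = mfderiv (𝓡 d) 𝓘(ℝ, Eu a × Eu b) φ q := ⟨_, rfl⟩
    have hDφ : HasD (𝓡 d) 𝓘(ℝ, Eu a × Eu b) φ q D := by
      rw [hDdef]
      exact hasD_of_mdifferentiableAt ((hφs q hq).mdifferentiableAt (by simp))
    have e1 : HasD (𝓡 d) 𝓘(ℝ, Eu a) u₁ q ((ContinuousLinearMap.fst ℝ (Eu a) (Eu b)).comp D) := by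
      have := HasD.comp (g := fun z : Eu a × Eu b => z.1)
        (hasD_iff_hasFDerivAt.2 hasFDerivAt_fst) hDφ rfl
      refine this.congr ?_
      filter_upwards [φ.open_source.mem_nhds hq] with y hy
      rw [(hφq y hy).1]
    have e2 : HasD (𝓡 d) 𝓘(ℝ, Eu b) u₂ q ((ContinuousLinearMap.snd ℝ (Eu a) (Eu b)).comp D) := by
      have := HasD.comp (g := fun z : Eu a × Eu b => z.2)
        (hasD_iff_hasFDerivAt.2 hasFDerivAt_snd) hDφ rfl
      refine this.congr ?_
      filter_upwards [φ.open_source.mem_nhds hq] with y hy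
      rw [(hφq y hy).1]
    have key : ∀ v w : Eu d, bE g q v w =
        g₁ (φ q).1 (D v).1 (D w).1 + g₂ (φ q).2 (D v).2 (D w).2 := by
      intro v w
      rw [hg, hg₁ q h1 _ e1, hg₂ q h2 _ e2, h0]
      rfl
    rw [hDdef] at key
    exact key

end Product

/-! ### The bracket defined by a section of geodesic vectors -/

section Rigidity
variable {n d s : ℕ}
  {G : Type*} [TopologicalSpace G] [ChartedSpace (EuclideanSpace ℝ (Fin n)) G] [Group G]
  [LieGroup (𝓡 n) ∞ G]
  {M : Type*} [TopologicalSpace M] [ChartedSpace (EuclideanSpace ℝ (Fin d)) M]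
  [IsManifold (𝓡 d) ∞ M] [MulAction G M] [ContMDiffSMul (𝓡 n) (𝓡 d) ∞ G M]
  {p : M} {m : Submodule ℝ (Eu n)} {ms : Fin s → Submodule ℝ (Eu n)}
  {α : Fin s → BilinField d M}

/-- The inverse of the isomorphism of a reductive complement with the tangent space. -/
theorem IsReductive.exists_section (hsub : Function.Surjective (dO n d G p))
    (hm : IsReductive (n := n) (G := G) d p m) :
    ∃ σ : Eu d →ₗ[ℝ] Eu n, ∀ v, dO n d G p (σ v) = v ∧ σ v ∈ m := by
  have hsurj : Function.Surjective ((dO n d G p).toLinearMap ∘ₗ m.subtype) := by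
    intro v
    obtain ⟨X, rfl⟩ := hsub v
    obtain ⟨η, hη, y, hy, hX⟩ := exists_add_of_isCompl (K := (dO n d G p).toLinearMap.ker) hm.1 X
    have hη0 : dO n d G p η = 0 := hη
    refine ⟨⟨y, hy⟩, ?_⟩
    rw [← hX, map_add, hη0, zero_add]
    rfl
  obtain ⟨τ, hτ⟩ := LinearMap.exists_rightInverse_of_surjective _ (LinearMap.range_eq_top.2 hsurj)
  exact ⟨m.subtype ∘ₗ τ, fun v => ⟨LinearMap.congr_fun hτ v, (τ v).2⟩⟩

theorem isOrthoSum_map (hsub : Function.Surjective (dO n d G p))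
    (hm : IsReductive (n := n) (G := G) d p m)
    (hms : IsIrredDecomposition (n := n) (G := G) p m ms)
    (hα : IsBasicForms (n := n) (G := G) p ms α) :
    IsOrthoSum (basicForm α p) fun k => (ms k).map (dO n d G p).toLinearMap := by
  refine ⟨?_, fun v => ?_, fun i => ?_⟩
  · rintro i j hij _ ⟨x, hx, rfl⟩ w
    exact hα.basicForm_zero hij hx w
  · obtain ⟨x, hx, rfl⟩ := exists_decomposition hsub hm hms v
    exact ⟨fun i => dO n d G p (x i), fun i => ⟨x i, hx i, rfl⟩, (map_sum _ _ _).symm⟩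
  · obtain ⟨x, hx, hx0⟩ := Submodule.exists_mem_ne_zero_of_ne_bot (hms.1 i).1
    refine ⟨dO n d G p x, ⟨x, hx, rfl⟩, fun h => ?_⟩
    have h1 := hα.basicForm_pos i hx hx0
    rw [h, map_zero] at h1
    exact lt_irrefl _ h1

/-- The bracket on the tangent space defined by a linear section `σ` of `𝔤 → T_p M`. -/
def sectionBracket (p : M) (σ : Eu d →ₗ[ℝ] Eu n) (G : Type*) [TopologicalSpace G]
    [ChartedSpace (EuclideanSpace ℝ (Fin n)) G] [Group G] [LieGroup (𝓡 n) ∞ G] [MulAction G M] :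
    Eu d →ₗ[ℝ] Eu d →ₗ[ℝ] Eu d :=
  ((brL n G).compl₁₂ σ σ).compr₂ (dO n d G p).toLinearMap

theorem sectionBracket_apply (σ : Eu d →ₗ[ℝ] Eu n) (x y : Eu d) :
    sectionBracket p σ G x y = dO n d G p (brE n G (σ x) (σ y)) := rfl

theorem sectionBracket_skew (σ : Eu d →ₗ[ℝ] Eu n) (x y : Eu d) :
    sectionBracket p σ G x y = -sectionBracket p σ G y x := by
  rw [sectionBracket_apply, sectionBracket_apply, brE_skew, map_neg]

variable [T2Space G] [T2Space M]

/-- Each metric has its own reductive complement, with a section `σ' = σ + l` where `l` takes values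
in `𝔥`. In `[σ' z, σ' x]` the terms with `l z` cancel because `𝔥` acts by skew endomorphisms, and
`[l x, σ z]` is the correction `R`. -/
theorem natRed_sectionBracket (hsub : Function.Surjective (dO n d G p))
    (hms : IsIrredDecomposition (n := n) (G := G) p m ms) (hinv : ∀ i, BilinInv G (α i))
    (hnat : ∀ c : Fin s → ℝ, (∀ i, 0 < c i) → IsNaturallyReductiveRiem n G (relMetric α c) p)
    {σ : Eu d →ₗ[ℝ] Eu n} (hσ : ∀ v, dO n d G p (σ v) = v) :
    NatRed (basicForm α p) (fun k => (ms k).map (dO n d G p).toLinearMap)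
      (sectionBracket p σ G) := by
  intro c hc
  obtain ⟨m', hm', hskew⟩ := hnat c hc
  obtain ⟨σ', hσ'⟩ := hm'.exists_section hsub
  set l : Eu d → Eu n := fun x => σ' x - σ x with hl
  have hl0 : ∀ x, dO n d G p (l x) = 0 := fun x => by
    rw [hl, map_sub, (hσ' x).1, hσ, sub_self]
  have hσl : ∀ x, σ' x = σ x + l x := fun x => by simp [hl]
  refine ⟨fun x z => dO n d G p (brE n G (l x) (σ z)), ?_, fun x y z => ?_⟩
  -- `σ w'` need not lie in `𝔪ₖ`, but it differs from `w` by an element of `𝔥`, which is a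
  -- subalgebra; and the action of `𝔥` preserves `𝔪ₖ`.
  · rintro x k _ ⟨w, hw, rfl⟩
    set w' : Eu d := dO n d G p w with hw'
    have h1 : σ w' = w + (σ w' - w) := by abel
    have h2 : dO n d G p (σ w' - w) = 0 := by rw [map_sub, hσ, hw', sub_self]
    refine ⟨brE n G (l x) w, brE_mem_of_adInvariant (hms.1 k).2.1 (hl0 x) hw, ?_⟩
    change dO n d G p (brE n G (l x) w) = dO n d G p (brE n G (l x) (σ w'))
    rw [h1, brE_add_right, map_add, dO_brE_isotropy (hl0 x) h2, add_zero]
  · have h1 : ∑ i, c i * basicForm α p i (dO n d G p (brE n G (σ' z) (σ' x))) (dO n d G p (σ' y)) +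
        ∑ i, c i * basicForm α p i (dO n d G p (σ' x)) (dO n d G p (brE n G (σ' z) (σ' y))) = 0 := by
      rw [← bE_relMetric, ← bE_relMetric]
      exact hskew _ (hσ' x).2 _ (hσ' y).2 _ (hσ' z).2
    have h2 : ∀ x, dO n d G p (brE n G (σ' z) (σ' x)) = sectionBracket p σ G z x -
        dO n d G p (brE n G (l x) (σ z)) + dO n d G p (brE n G (l z) (σ x)) := by
      intro x
      rw [hσl, hσl, brE_add_left, brE_add_right, brE_add_right, map_add, map_add, map_add,
        dO_brE_isotropy (hl0 z) (hl0 x), brE_skew (σ z) (l x), map_neg, sectionBracket_apply]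
      abel
    rw [← Finset.sum_add_distrib, (hσ' x).1, (hσ' y).1, h2, h2] at h1
    rw [← h1]
    refine Finset.sum_congr rfl fun i _ => ?_
    have h3 : basicForm α p i (dO n d G p (brE n G (l z) (σ x))) (dO n d G p (σ y)) +
        basicForm α p i (dO n d G p (σ x)) (dO n d G p (brE n G (l z) (σ y))) = 0 :=
      (hinv i).brE_skew (hl0 z) (σ x) (σ y)
    rw [hσ, hσ] at h3
    simp only [map_add, LinearMap.add_apply]
    linear_combination -(c i) * h3

/-- Vectors tangent to the summands outside of `A` act by skew endomorphisms on the forms with index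
in `A`. -/
theorem killing_section (hsub : Function.Surjective (dO n d G p))
    (hm : IsReductive (n := n) (G := G) d p m)
    (hms : IsIrredDecomposition (n := n) (G := G) p m ms)
    (hα : IsBasicForms (n := n) (G := G) p ms α)
    (hnat : ∀ c : Fin s → ℝ, (∀ i, 0 < c i) → IsNaturallyReductiveRiem n G (relMetric α c) p)
    {σ : Eu d →ₗ[ℝ] Eu n} (hσ : ∀ v, dO n d G p (σ v) = v) {φ : (Fin s → ℝ) → Fin s → ℝ}
    (hφ : ∀ v, v ≠ 0 → GeoCond α G p (φ (formVec (basicForm α p) v)) (σ v))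
    {A : Finset (Fin s)} (hA : ∀ l ∈ A, ∀ k ∉ A, ¬ ConstRatio φ l k) {u : Eu d}
    (hu : ∀ i ∈ A, basicForm α p i u u = 0) (c : Fin s → ℝ) (X Y : Eu n) :
    (∀ i ∈ A, ∀ w, basicForm α p i u w = 0) ∧
    ∑ i ∈ A, c i * (basicForm α p i (dO n d G p (brE n G (σ u) X)) (dO n d G p Y) +
      basicForm α p i (dO n d G p X) (dO n d G p (brE n G (σ u) Y))) = 0 := by
  have ha := isFormFamily hsub hm hms hα
  have hT := isOrthoSum_map hsub hm hms hα
  have hrad : ∀ i ∈ A, ∀ w, basicForm α p i u w = 0 := by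
    intro i hi w
    have h1 := hu i hi
    obtain ⟨f, hf, rfl⟩ := hT.exists_sum u
    rw [hT.apply_sum hf, ha.symm, hT.apply_sum hf] at h1
    rw [hT.apply_sum hf]
    by_cases h : f i = 0
    · rw [h, map_zero, LinearMap.zero_apply]
    · exact absurd h1 (ha.pos_of_mem hT (hf i) h).ne'
  refine ⟨hrad, ?_⟩
  have hb := natRed_sectionBracket hsub hms hα.bilinInv hnat hσ
  have h1 := hb.killing hT ha (sectionBracket_skew σ) (φ := φ) (fun y z hy => by
    have := hφ y hy (σ z)
    rw [hσ] at this
    exact this) hA hu c (dO n d G p X) (dO n d G p Y)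
  rw [← h1]
  have h2 : ∀ i ∈ A, ∀ (X : Eu n) (w : Eu d), basicForm α p i (dO n d G p (brE n G (σ u) X)) w =
      basicForm α p i (sectionBracket p σ G u (dO n d G p X)) w := by
    intro i hi X w
    -- `X` differs from the section by `η ∈ 𝔥`, whose contribution is `αᵢ([η, σ u], W) = -αᵢ(u, [η,
    -- W]) = 0`, as `u` is in the radical.
    set η := X - σ (dO n d G p X) with hη
    have hη0 : dO n d G p η = 0 := by rw [hη, map_sub, hσ, sub_self]
    have hX : X = σ (dO n d G p X) + η := by rw [hη]; abel
    obtain ⟨W, rfl⟩ := hsub w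
    have h3 : basicForm α p i (dO n d G p (brE n G η (σ u))) (dO n d G p W) +
        basicForm α p i (dO n d G p (σ u)) (dO n d G p (brE n G η W)) = 0 :=
      (hα.bilinInv i).brE_skew hη0 (σ u) W
    rw [hσ, hrad i hi, add_zero] at h3
    have h4 : dO n d G p (brE n G (σ u) X) = sectionBracket p σ G u (dO n d G p X) -
        dO n d G p (brE n G η (σ u)) := by
      conv_lhs => rw [hX]
      rw [brE_add_right, map_add, brE_skew (σ u) η, map_neg, sectionBracket_apply]
      abel
    rw [h4, map_sub, LinearMap.sub_apply, h3, sub_zero]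
  refine Finset.sum_congr rfl fun i hi => ?_
  rw [h2 i hi, ha.symm i _ (dO n d G p (brE n G (σ u) Y)), h2 i hi, ha.symm i (dO n d G p X)]

end Rigidity

/-! ### Kernels of complementary families of forms -/

section Kernel
variable {s : ℕ} {E : Type*} [NormedAddCommGroup E] [NormedSpace ℝ E]
  {a : Fin s → E →ₗ[ℝ] E →ₗ[ℝ] ℝ} {T : Fin s → Submodule ℝ E}

/-- The common kernel of the forms with index in `A`. -/
def formKer (a : Fin s → E →ₗ[ℝ] E →ₗ[ℝ] ℝ) (A : Finset (Fin s)) : Submodule ℝ E :=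
  ⨅ i ∈ A, LinearMap.ker (a i)

theorem mem_formKer {A : Finset (Fin s)} {v : E} : v ∈ formKer a A ↔ ∀ i ∈ A, a i v = 0 := by
  simp [formKer]

theorem IsOrthoSum.mem_formKer (hT : IsOrthoSum a T) {A : Finset (Fin s)} {i : Fin s} (hi : i ∉ A)
    {v : E} (hv : v ∈ T i) : v ∈ formKer a A :=
  FinslerGO.mem_formKer.2 fun j hj =>
    LinearMap.ext fun w => hT.zero j i (fun h => hi (h ▸ hj)) v hv w

theorem IsOrthoSum.isCompl_formKer (hT : IsOrthoSum a T) (ha : IsFormFamily a)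
    (A : Finset (Fin s)) : IsCompl (formKer a Aᶜ) (formKer a A) := by
  constructor
  · refine Submodule.disjoint_def.2 fun v h1 h2 => ha.definite v fun i => ?_
    by_cases hi : i ∈ A
    · rw [FinslerGO.mem_formKer.1 h2 i hi, LinearMap.zero_apply]
    · rw [FinslerGO.mem_formKer.1 h1 i (Finset.mem_compl.2 hi), LinearMap.zero_apply]
  · refine codisjoint_iff.2 (eq_top_iff.2 fun v _ => ?_)
    obtain ⟨u, hu, rfl⟩ := hT.exists_sum v
    refine Submodule.sum_mem _ fun i _ => ?_
    by_cases hi : i ∈ A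
    · exact Submodule.mem_sup_left (hT.mem_formKer (by simpa using hi) (hu i))
    · exact Submodule.mem_sup_right (hT.mem_formKer hi (hu i))

theorem IsOrthoSum.formKer_ne_bot (hT : IsOrthoSum a T) {A : Finset (Fin s)} {i : Fin s}
    (hi : i ∉ A) : formKer a A ≠ ⊥ := by
  obtain ⟨v, hv, hv0⟩ := hT.exists_ne i
  exact fun h => hv0 ((Submodule.mem_bot ℝ).1 (h ▸ hT.mem_formKer hi hv))

end Kernel

/-! ### Splitting of the metrics and rigidity -/

section Rigidity
variable {n d s : ℕ}
  {G : Type*} [TopologicalSpace G] [ChartedSpace (EuclideanSpace ℝ (Fin n)) G] [Group G]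
  [LieGroup (𝓡 n) ∞ G]
  {M : Type*} [TopologicalSpace M] [ChartedSpace (EuclideanSpace ℝ (Fin d)) M]
  [IsManifold (𝓡 d) ∞ M] [MulAction G M] [ContMDiffSMul (𝓡 n) (𝓡 d) ∞ G M]
  {p : M} {m : Submodule ℝ (Eu n)} {ms : Fin s → Submodule ℝ (Eu n)}
  {α : Fin s → BilinField d M} [T2Space G] [T2Space M]

theorem bE_relMetric_restrict (α : Fin s → BilinField d M) (c : Fin s → ℝ) (A : Finset (Fin s))
    (q : M) (v w : Eu d) : bE (relMetric α fun i => if i ∈ A then c i else 0) q v w =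
      ∑ i ∈ A, c i * basicForm α q i v w := by
  rw [bE_relMetric]
  simp [ite_mul]

/-- The form `∑_{i ∈ A} cⁱ αᵢ` has the common kernel of these `αᵢ` in its radical, and by
`killing_section` that kernel acts on it by skew endomorphisms, as `exists_pullback` requires. -/
theorem exists_pullback_restrict (hsub : Function.Surjective (dO n d G p))
    (hm : IsReductive (n := n) (G := G) d p m)
    (hms : IsIrredDecomposition (n := n) (G := G) p m ms)
    (hα : IsBasicForms (n := n) (G := G) p ms α)
    (hnat : ∀ c : Fin s → ℝ, (∀ i, 0 < c i) → IsNaturallyReductiveRiem n G (relMetric α c) p)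
    {σ : Eu d →ₗ[ℝ] Eu n} (hσ : ∀ v, dO n d G p (σ v) = v) {φ : (Fin s → ℝ) → Fin s → ℝ}
    (hφ : ∀ v, v ≠ 0 → GeoCond α G p (φ (formVec (basicForm α p) v)) (σ v))
    {A : Finset (Fin s)} (hA : ∀ l ∈ A, ∀ k ∉ A, ¬ ConstRatio φ l k) (c : Fin s → ℝ) {a b : ℕ}
    (Θ : (Eu a × Eu b) ≃L[ℝ] Eu d) (hΘ : ∀ y, Θ (0, y) ∈ formKer (basicForm α p) A) :
    ∃ (U : Set M) (u : M → Eu a) (g₁ : Eu a → Eu a →ₗ[ℝ] Eu a →ₗ[ℝ] ℝ), IsOpen U ∧ p ∈ U ∧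
      ContMDiffOn (𝓡 d) 𝓘(ℝ, Eu a) ∞ u U ∧
      HasD (𝓡 d) 𝓘(ℝ, Eu a) u p ((ContinuousLinearMap.fst ℝ (Eu a) (Eu b)).comp
        (Θ.symm : Eu d →L[ℝ] Eu a × Eu b)) ∧
      ∀ q ∈ U, ∀ D, HasD (𝓡 d) 𝓘(ℝ, Eu a) u q D → ∀ v w,
        bE (relMetric α fun i => if i ∈ A then c i else 0) q v w = g₁ (u q) (D v) (D w) := by
  have hker : ∀ y, ∀ i ∈ A, basicForm α p i (Θ (0, y)) (Θ (0, y)) = 0 := fun y i hi => by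
    rw [mem_formKer.1 (hΘ y) i hi, LinearMap.zero_apply]
  have hkill := fun y => killing_section hsub hm hms hα hnat hσ hφ hA (hker y) c
  refine exists_pullback (n := n) (G := G) (fun g q v w => ?_) (fun v w => ?_) Θ
    ((LinearMap.toContinuousLinearMap σ).comp
      ((Θ : (Eu a × Eu b) →L[ℝ] Eu d).comp (ContinuousLinearMap.inl ℝ (Eu a) (Eu b))))
    (fun j => σ (Θ (0, EuclideanSpace.single j 1))) (fun x => ?_) (fun j => ?_) (fun j v => ?_)
    fun j X Y => ?_
  · rw [bE_relMetric_restrict, bE_relMetric_restrict]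
    exact Finset.sum_congr rfl fun i _ => by rw [BilinInv.basicForm hα.bilinInv]
  · rw [bE_relMetric_restrict, bE_relMetric_restrict]
    exact Finset.sum_congr rfl fun i _ => by rw [hα.basicForm_symm]
  · exact hσ _
  · exact hσ _
  · rw [hσ, bE_relMetric_restrict]
    refine Finset.sum_eq_zero fun i hi => ?_
    rw [(hkill _ 0 0).1 i hi, mul_zero]
  · rw [bE_relMetric_restrict, bE_relMetric_restrict, ← Finset.sum_add_distrib,
      ← (hkill (EuclideanSpace.single j 1) X Y).2]
    exact Finset.sum_congr rfl fun i _ => by ring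

/-- If the coefficients of two summands are not proportional, all metrics of the family split. -/
theorem isLocalProduct_of_not_constRatio (hsub : Function.Surjective (dO n d G p))
    (hm : IsReductive (n := n) (G := G) d p m)
    (hms : IsIrredDecomposition (n := n) (G := G) p m ms)
    (hα : IsBasicForms (n := n) (G := G) p ms α)
    (hnat : ∀ c : Fin s → ℝ, (∀ i, 0 < c i) → IsNaturallyReductiveRiem n G (relMetric α c) p)
    {σ : Eu d →ₗ[ℝ] Eu n} (hσ : ∀ v, dO n d G p (σ v) = v) {φ : (Fin s → ℝ) → Fin s → ℝ}
    (hpos : ∀ t, (∀ i, 0 < t i) → ∀ i, 0 < φ t i)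
    (hφ : ∀ v, v ≠ 0 → GeoCond α G p (φ (formVec (basicForm α p) v)) (σ v))
    {i k : Fin s} (hik : ¬ ConstRatio φ i k) (c : Fin s → ℝ) :
    IsLocalProduct (relMetric α c) p := by
  classical
  have ha := isFormFamily hsub hm hms hα
  have hT := isOrthoSum_map hsub hm hms hα
  -- The class of `i` under constancy of ratios. No ratio between `A` and its complement is
  -- constant, so both partial sums of the metric are pullbacks.
  set A : Finset (Fin s) := Finset.univ.filter fun l => ConstRatio φ i l with hAdef
  have hmem : ∀ l, l ∈ A ↔ ConstRatio φ i l := fun l => by simp [hAdef]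
  have hA : ∀ l ∈ A, ∀ k ∉ A, ¬ ConstRatio φ l k := fun l hl k hk h =>
    hk ((hmem k).2 (((hmem l).1 hl).trans hpos h))
  have hAc : ∀ l ∈ Aᶜ, ∀ k ∉ Aᶜ, ¬ ConstRatio φ l k := fun l hl k hk h =>
    hA k (by simpa using hk) l (by simpa using hl) h.symm
  have hiA : i ∈ A := (hmem i).2 fun _ _ _ _ => mul_comm _ _
  have hkA : k ∉ A := fun h => hik ((hmem k).1 h)
  obtain ⟨x, y, Θ, hx, hy, hΘx, hΘy⟩ := exists_split (hT.isCompl_formKer ha A)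
    (hT.formKer_ne_bot (i := i) (by simpa using hiA)) (hT.formKer_ne_bot hkA)
  obtain ⟨U₁, u₁, g₁, hU₁, hp₁, hu₁, hD₁, hg₁⟩ :=
    exists_pullback_restrict hsub hm hms hα hnat hσ hφ hA c Θ hΘy
  obtain ⟨U₂, u₂, g₂, hU₂, hp₂, hu₂, hD₂, hg₂⟩ :=
    exists_pullback_restrict hsub hm hms hα hnat hσ hφ hAc c
      ((ContinuousLinearEquiv.prodComm ℝ (Eu y) (Eu x)).trans Θ) hΘx
  refine isLocalProduct_of_pullback (fun q v w => ?_) hx hy Θ hU₁ hp₁ hu₁ hD₁ hg₁ hU₂ hp₂ hu₂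
    hD₂ hg₂
  rw [bE_relMetric, bE_relMetric_restrict, bE_relMetric_restrict, Finset.sum_add_sum_compl]

/-- If the geodesic vectors of `F` form a linear section of `𝔤 → T_p M` and one of the metrics of the
family does not split, then `F` is Riemannian. -/
theorem isRiemannianAt_of_section (hsub : Function.Surjective (dO n d G p))
    (hm : IsReductive (n := n) (G := G) d p m) (hs : 0 < s)
    (hms : IsIrredDecomposition (n := n) (G := G) p m ms)
    (hα : IsBasicForms (n := n) (G := G) p ms α)
    (hirr : ∃ c : Fin s → ℝ, (∀ i, 0 < c i) ∧ ¬ IsLocalProduct (relMetric α c) p)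
    (hnat : ∀ c : Fin s → ℝ, (∀ i, 0 < c i) → IsNaturallyReductiveRiem n G (relMetric α c) p)
    {k : ℕ} {L : (Fin k → ℝ) → ℝ} {c : Fin k → Fin s → ℝ} (hL : Admissible L)
    (hc : ∀ j i, 0 < c j i) [MulAction.IsPretransitive G M]
    {σ : Eu d →ₗ[ℝ] Eu n} (hσ : ∀ v, dO n d G p (σ v) = v)
    (hgeo : ∀ v, v ≠ 0 →
      IsGeodesicVector (n := n) (G := G) (combine L fun j => relMetric α (c j)) p (σ v)) :
    IsRiemannianAt (combine L fun j => relMetric α (c j)) p := by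
  have ha := isFormFamily hsub hm hms hα
  have hF := hasCoeff_combine hsub hL hc hα.bilinInv ha
  have hφ : ∀ v, v ≠ 0 → GeoCond α G p (combPartial L c (formVec (basicForm α p) v)) (σ v) := by
    intro v hv
    have h1 := (hF.iff (σ v) (by rwa [hσ])).1 (hgeo v hv)
    rwa [hσ] at h1
  obtain ⟨c₀, -, hc₀⟩ := hirr
  -- A varying ratio would split every metric of the family, including the irreducible one.
  have hcon : ∀ i l, ConstRatio (combPartial L c) i l := by
    intro i l
    by_contra h
    refine hc₀ (isLocalProduct_of_not_constRatio hsub hm hms hα hnat hσ (fun t ht => ?_) hφ h c₀)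
    exact hF.pos t (fun i => (ht i).le) fun h0 => (ht ⟨0, hs⟩).ne' (congrFun h0 _)
  obtain ⟨r, hr⟩ := hL.eq_linear hc hs hcon
  have key : ∃ b : Eu d →ₗ[ℝ] Eu d →ₗ[ℝ] ℝ, ∀ v,
      fE (combine L fun j => relMetric α (c j)) p v ^ 2 = b v v := by
    refine ⟨∑ i, r i • basicForm α p i, fun v => ?_⟩
    have h0 : 0 ≤ L (normVec c (formVec (basicForm α p) v)) := 
      hL.nonneg hc fun i => ha.nonneg i v
    rw [fE_combine, Real.sq_sqrt h0, hr (formVec (basicForm α p) v) fun i => ha.nonneg i v]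
    simp [formVec]
  exact key

end Rigidity

/-! ### Linear graphs and natural reductivity give linear sections -/

section LinearGraph
variable {n d s : ℕ}
  {G : Type*} [TopologicalSpace G] [ChartedSpace (EuclideanSpace ℝ (Fin n)) G] [Group G]
  [LieGroup (𝓡 n) ∞ G]
  {M : Type*} [TopologicalSpace M] [ChartedSpace (EuclideanSpace ℝ (Fin d)) M]
  [IsManifold (𝓡 d) ∞ M] [MulAction G M] [ContMDiffSMul (𝓡 n) (𝓡 d) ∞ G M]
  {p : M}

/-- A linear geodesic graph defines a linear section of `𝔤 → T_p M` consisting of geodesic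
vectors. -/
theorem IsGeodesicGraph.exists_section (hsub : Function.Surjective (dO n d G p))
    {m : Submodule ℝ (GroupLieAlgebra (𝓡 n) G)} (hm : IsReductive d p m) {F : FinslerFun d M}
    {ξ : m → isotropyAlg n d G p} (hξ : IsGeodesicGraph F p m ξ) (hlin : IsLinearGraph ξ) :
    ∃ σ : Eu d →ₗ[ℝ] Eu n, (∀ v, dO n d G p (σ v) = v) ∧
      ∀ v, v ≠ 0 → IsGeodesicVector (n := n) (G := G) F p (σ v) := by
  obtain ⟨l, hl⟩ := hlin
  obtain ⟨τ, hτ⟩ := IsReductive.exists_section (m := m) hsub hm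
  set τm : Eu d → m := fun v => ⟨τ v, (hτ v).2⟩ with hτm
  have hsubE : ∀ v, subE m (τm v) = τ v := fun v => rfl
  have hadd : ∀ v w, τm (v + w) = τm v + τm w := fun v w => subE_injective m (map_add τ v w)
  have hsmul : ∀ (r : ℝ) v, τm (r • v) = r • τm v := fun r v =>
    subE_injective m (map_smul τ r v)
  set κ : Eu d →ₗ[ℝ] Eu n :=
    { toFun := fun v => subE _ (l (τm v))
      map_add' := fun v w => by rw [hadd, map_add]; rfl
      map_smul' := fun r v => by rw [hsmul, map_smul]; rfl } with hκ
  have hκa : ∀ v, κ v = subE _ (l (τm v)) := fun v => rfl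
  refine ⟨τ + κ, fun v => ?_, fun v hv => ?_⟩
  · rw [LinearMap.add_apply, map_add, hκa, dO_isotropy, add_zero, (hτ v).1]
  · have h0 : τm v ≠ 0 := by
      intro h
      have h1 := (hτ v).1
      have h2 : τ v = 0 := congrArg (subE m) h
      rw [h2, map_zero] at h1
      exact hv h1.symm
    have h1 := hξ.geodesic (τm v) h0
    rw [hl _ h0] at h1
    exact h1

/-- The same data as from a linear graph, so that one rigidity statement covers both cases. -/
theorem IsNaturallyReductive.exists_section (hsub : Function.Surjective (dO n d G p))
    {F : FinslerFun d M} (hF : IsNaturallyReductive n G F p) :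
    ∃ σ : Eu d →ₗ[ℝ] Eu n, (∀ v, dO n d G p (σ v) = v) ∧
      ∀ v, v ≠ 0 → IsGeodesicVector (n := n) (G := G) F p (σ v) := by
  obtain ⟨m, hm, h⟩ := hF
  obtain ⟨τ, hτ⟩ := IsReductive.exists_section (m := m) hsub hm
  refine ⟨τ, fun v => (hτ v).1, fun v hv => h _ (hτ v).2 fun h0 => hv ?_⟩
  have h2 : τ v = 0 := h0
  rw [← (hτ v).1, h2, map_zero]

end LinearGraph

end FinslerGO

end

/-! ### Assembly of the theorem -/

theorem corollary2 {n d s : ℕ}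
    {G : Type*} [TopologicalSpace G] [T2Space G] [ConnectedSpace G]
    [ChartedSpace (EuclideanSpace ℝ (Fin n)) G] [Group G] [LieGroup (𝓡 n) ∞ G]
    {M : Type*} [TopologicalSpace M] [T2Space M]
    [ChartedSpace (EuclideanSpace ℝ (Fin d)) M] [IsManifold (𝓡 d) ∞ M]
    [MulAction G M] [ContMDiffSMul (𝓡 n) (𝓡 d) ∞ G M] [MulAction.IsPretransitive G M]
    (p : M)
    -- `M` carries the manifold structure of `G/H`, for which `G → G/H` is a submersion
    (hsub : Function.Surjective (FinslerGO.dOrbit (n := n) (d := d) (G := G) p))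
    (m : Submodule ℝ (GroupLieAlgebra (𝓡 n) G)) (hm : FinslerGO.IsReductive d p m)
    (hs : 2 ≤ s) (ms : Fin s → Submodule ℝ (GroupLieAlgebra (𝓡 n) G))
    (hms : FinslerGO.IsIrredDecomposition p m ms)
    (α : Fin s → FinslerGO.BilinField d M) (hα : FinslerGO.IsBasicForms p ms α)
    -- `M` is irreducible
    (hirr : ∃ c : Fin s → ℝ, (∀ i, 0 < c i) ∧
      ¬ FinslerGO.IsLocalProduct (FinslerGO.relMetric α c) p)
    (hnat : ∀ c : Fin s → ℝ, (∀ i, 0 < c i) →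
      FinslerGO.IsNaturallyReductiveRiem n G (FinslerGO.relMetric α c) p)
    (huniq : ∀ c : Fin s → ℝ, (∀ i, 0 < c i) →
      FinslerGO.HasUniqueGeodesicGraph (FinslerGO.normOf (FinslerGO.relMetric α c)) p m) :
    -- all the metrics of the construction
    (∀ (k : ℕ) (L : (Fin k → ℝ) → ℝ), FinslerGO.Admissible L →
      ∀ c : Fin k → Fin s → ℝ, (∀ j i, 0 < c j i) →
        let F := FinslerGO.combine L fun j => FinslerGO.relMetric α (c j)
        FinslerGO.IsInvariantFinsler G F ∧
        FinslerGO.IsAlphaType p m α F ∧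
        FinslerGO.IsGeodesicOrbit n G F p ∧
        FinslerGO.HasUniqueGeodesicGraph F p m ∧
        (¬ FinslerGO.IsRiemannianAt F p →
          (∀ m' : Submodule ℝ (GroupLieAlgebra (𝓡 n) G), FinslerGO.IsReductive d p m' →
            ∀ ξ, FinslerGO.IsGeodesicGraph F p m' ξ → ¬ FinslerGO.IsLinearGraph ξ) ∧
          ¬ FinslerGO.IsNaturallyReductive n G F p)) ∧
    -- the explicit family of metrics that are not Riemannian
    (∀ (k : ℕ) (q : ℝ), 2 < q → ∀ c : Fin k → Fin s → ℝ, (∀ j i, 0 < c j i) →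
      (∃ j j' i i', c j i * c j' i' ≠ c j' i * c j i') →
        FinslerGO.Admissible (FinslerGO.powerL k q) ∧
        ¬ FinslerGO.IsRiemannianAt
          (FinslerGO.combine (FinslerGO.powerL k q) fun j => FinslerGO.relMetric α (c j)) p) := by
  have hsub' : Function.Surjective (FinslerGO.dO n d G p) := hsub
  have hinv := hα.bilinInv
  have ha := FinslerGO.isFormFamily hsub' hm hms hα
  refine ⟨fun k L hL c hc => ?_, fun k q hq c hc hne => ?_⟩
  · have hF := FinslerGO.hasCoeff_combine hsub' hL hc hinv ha
    have hgraph := hF.exists_graph hsub' hm hinv ha fun c hc => (huniq c hc).1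
    -- Uniqueness is transferred from a single metric of the family; the one with all weights `1`
    -- will do.
    have hone : ∀ i : Fin s, (0 : ℝ) < (fun _ => 1 : Fin s → ℝ) i := fun _ => one_pos
    have hrig : (∃ σ : FinslerGO.Eu d →ₗ[ℝ] FinslerGO.Eu n, (∀ v, FinslerGO.dO n d G p (σ v) = v) ∧
        ∀ v, v ≠ 0 → FinslerGO.IsGeodesicVector (n := n) (G := G)
          (FinslerGO.combine L fun j => FinslerGO.relMetric α (c j)) p (σ v)) →
        FinslerGO.IsRiemannianAt (FinslerGO.combine L fun j => FinslerGO.relMetric α (c j)) p := by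
      rintro ⟨σ, hσ, hgeo⟩
      exact FinslerGO.isRiemannianAt_of_section hsub' hm (by omega) hms hα hirr hnat hL hc hσ hgeo
    exact ⟨FinslerGO.isInvariantFinsler_combine hsub' hL hc hinv ha,
      FinslerGO.isAlphaType_combine hL hc,
      FinslerGO.isGeodesicOrbit_of_graph hsub' hm hgraph,
      ⟨hgraph, hF.unique_graph hsub' hm hinv ha hone (huniq _ hone)⟩,
      fun hR => ⟨fun m' hm' ξ hξ hlin => hR (hrig (hξ.exists_section hsub' hm' hlin)),
        fun hN => hR (hrig (hN.exists_section hsub'))⟩⟩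
  -- `powerL 0 q` is identically zero, hence not admissible; the indices of the non-proportional
  -- metrics exclude `k = 0`.
  · have hk : 0 < k := by
      obtain ⟨j, -⟩ := hne
      exact j.pos
    exact ⟨FinslerGO.admissible_powerL hk hq,
      FinslerGO.not_isRiemannianAt_power hms hα hq hc hne⟩
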